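/- Let $(M,g,J,\omega)$ be a complete noncompact almost Kähler manifold of dimension $2n$: $\omega$ is a symplectic form, $J$ an $\omega$-compatible almost complex structure and $g(\cdot,\cdot)=\omega(\cdot,J\cdot)$ a complete Riemannian metric. Let $*_s$ and $*_g$ be the symplectic and Hodge star operators, given on $k$-forms by $\alpha\wedge *_s\beta=(\omega^{-1})^k(\alpha,\beta)\,\frac{\omega^n}{n!}$ and $\alpha\wedge *_g\beta=(\alpha,\beta)_g\,d\mathrm{vol}_g$ (orientation given by $\omega^n$), and on $k$-forms put $$d^\Lambda=(-1)^{k+1}*_sd*_s,\quad d^*=-*_gd*_g,\quad d^{\Lambda*}=*_gd^\Lambda *_g,\quad (dd^\Lambda)^*=(-1)^{k+1}*_gdd^\Lambda *_g .$$ Fix $\lambda>0$ and let $$\Delta_{d+d^\Lambda}=dd^\Lambda(dd^\Lambda)^*+\lambda\,(d^*d+d^{\Lambda*}d^\Lambda),\qquad \Delta_{dd^\Lambda}=(dd^\Lambda)^*dd^\Lambda+\lambda\,(dd^*+d^\Lambda d^{\Lambda*}).$$ Let $L^2\mathcal H^k_{d+d^\Lambda}$ and $L^2\mathcal H^k_{dd^\Lambda}$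 be the spaces of smooth $k$-forms $\alpha$ with $\int_M|\alpha|_g^2\,d\mathrm{vol}_g<\infty$ that satisfy $\Delta_{d+d^\Lambda}\alpha=0$ and $\Delta_{dd^\Lambda}\alpha=0$, respectively, and let $L\alpha=\omega\wedge\alpha$. Then for every $0\le k\le n$ the map $L^{n-k}$ restricts to isomorphisms $$L^{n-k}:L^2\mathcal H^k_{d+d^\Lambda}\;\xrightarrow{\ \cong\ }\;L^2\mathcal H^{2n-k}_{d+d^\Lambda},\qquad L^{n-k}:L^2\mathcal H^k_{dd^\Lambda}\;\xrightarrow{\ \cong\ }\;L^2\mathcal H^{2n-k}_{dd^\Lambda}$$ of vector spaces, which together with their inverses are bounded for the $L^2$ norms. -/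

import Mathlib

open scoped Manifold ContDiff Bundle MeasureTheory

noncomputable section

namespace SymplecticHodge

/-! ### Alternating forms on one vector space -/

section Linear

variable {V : Type*} [AddCommGroup V] [Module ℝ V] [TopologicalSpace V]

/-- `α` regarded as a form of degree `l`: the same form if its degree `k` equals `l`,
and `0` otherwise. -/
def toDegree {k : ℕ} (l : ℕ) (α : V [⋀^Fin k]→L[ℝ] ℝ) : V [⋀^Fin l]→L[ℝ] ℝ :=
  if h : k = l then h ▸ α else 0

/-- The multilinear map `α ⊗ β : (v₁, …, v_{k+l}) ↦ α(v₁, …, v_k) β(v_{k+1}, …, v_{k+l})`. -/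
def tensor {k l : ℕ} (α : V [⋀^Fin k]→L[ℝ] ℝ) (β : V [⋀^Fin l]→L[ℝ] ℝ) :
    ContinuousMultilinearMap ℝ (fun _ : Fin (k + l) => V) ℝ where
  toMultilinearMap :=
    ((LinearMap.mul' ℝ ℝ).compMultilinearMap
      (MultilinearMap.domCoprod α.toMultilinearMap β.toMultilinearMap)).domDomCongr finSumFinEquiv
  cont := by
    change Continuous fun v : Fin (k + l) → V =>
      α (fun i => v (Fin.castAdd l i)) * β (fun i => v (Fin.natAdd k i))
    exact (α.cont.comp (continuous_pi fun i => continuous_apply _)).mul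
      (β.cont.comp (continuous_pi fun i => continuous_apply _))

theorem tensor_apply {k l : ℕ} (α : V [⋀^Fin k]→L[ℝ] ℝ) (β : V [⋀^Fin l]→L[ℝ] ℝ)
    (v : Fin (k + l) → V) :
    tensor α β v = α (fun i => v (Fin.castAdd l i)) * β (fun i => v (Fin.natAdd k i)) := rfl

/-- The exterior product,
`(α ∧ β)(v) = 1/(k! l!) ∑_σ sgn(σ) α(v_{σ(1)}, …, v_{σ(k)}) β(v_{σ(k+1)}, …, v_{σ(k+l)})`. -/
def wedge {k l : ℕ} (α : V [⋀^Fin k]→L[ℝ] ℝ) (β : V [⋀^Fin l]→L[ℝ] ℝ) :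
    V [⋀^Fin (k + l)]→L[ℝ] ℝ :=
  ((k.factorial * l.factorial : ℝ)⁻¹) • ContinuousMultilinearMap.alternatization (tensor α β)

/-- The Lefschetz operator `L α = ω ∧ α`. -/
def lefschetz (Ω : V [⋀^Fin 2]→L[ℝ] ℝ) {k : ℕ} (α : V [⋀^Fin k]→L[ℝ] ℝ) :
    V [⋀^Fin (k + 2)]→L[ℝ] ℝ :=
  toDegree (k + 2) (wedge Ω α)

/-- The iterated Lefschetz operator `L^r α`. -/
def lefschetzPow (Ω : V [⋀^Fin 2]→L[ℝ] ℝ) {k : ℕ} :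
    (r : ℕ) → (V [⋀^Fin k]→L[ℝ] ℝ) → V [⋀^Fin (k + 2 * r)]→L[ℝ] ℝ
  | 0, α => α
  | r + 1, α => lefschetz Ω (lefschetzPow Ω r α)

/-- The power `ω^n = ω ∧ ⋯ ∧ ω`, a form of degree `2n`. -/
def formPow (Ω : V [⋀^Fin 2]→L[ℝ] ℝ) (n : ℕ) : V [⋀^Fin (2 * n)]→L[ℝ] ℝ :=
  toDegree (2 * n) (lefschetzPow Ω n (ContinuousAlternatingMap.constOfIsEmpty ℝ V (Fin 0) (1 : ℝ)))

theorem append_update {V : Type*} {k l : ℕ} (u : Fin k → V) (v : Fin l → V) (i : Fin l) (x : V) :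
    Fin.append u (Function.update v i x) =
      Function.update (Fin.append u v) (Fin.natAdd k i) x := by
  funext a
  refine Fin.addCases (fun j => ?_) (fun j => ?_) a
  · rw [Function.update_of_ne (by intro h; simp [Fin.ext_iff] at h; omega)]
    simp
  · by_cases h : j = i
    · subst h; simp
    · rw [Function.update_of_ne (by simpa using h)]
      simp [h]

/-- The contraction `ι(u_k) ⋯ ι(u_1) η`, that is `v ↦ η(u_1, …, u_k, v_1, …, v_l)`. -/
def contract {N k l : ℕ} (h : k + l = N) (η : V [⋀^Fin N]→L[ℝ] ℝ) (u : Fin k → V) :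
    V [⋀^Fin l]→L[ℝ] ℝ where
  toFun v := (h ▸ η : V [⋀^Fin (k + l)]→L[ℝ] ℝ) (Fin.append u v)
  map_update_add' := by
    intro inst v i x y
    subst h
    obtain rfl : inst = instDecidableEqFin l := Subsingleton.elim _ _
    simp only [append_update]
    exact η.map_update_add _ _ _ _
  map_update_smul' := by
    intro inst v i c x
    subst h
    obtain rfl : inst = instDecidableEqFin l := Subsingleton.elim _ _
    simp only [append_update]
    exact η.map_update_smul _ _ _ _
  map_eq_zero_of_eq' := by
    intro v i j hv hij
    subst h
    refine η.map_eq_zero_of_eq _ (i := Fin.natAdd k i) (j := Fin.natAdd k j) ?_ ?_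
    · simpa using hv
    · simpa using hij
  cont := by
    subst h
    refine η.cont.comp (continuous_pi fun a => ?_)
    refine Fin.addCases (fun i => ?_) (fun i => ?_) a
    · simpa using continuous_const
    · simpa using continuous_apply i

variable {ι : Type*} [Fintype ι] [DecidableEq ι]

/-- The matrix `B_{ij} = B(e_i, e_j)`. -/
def gram (e : Module.Basis ι ℝ V) (B : V → V → ℝ) : Matrix ι ι ℝ :=
  Matrix.of fun i j => B (e i) (e j)

/-- The pairing of `k`-forms induced by a nondegenerate bilinear form `B`,
`(1/k!) B^{i₁j₁} ⋯ B^{i_k j_k} α_{i₁ … i_k} β_{j₁ … j_k}`, where `(B^{ij})` is the inverse of the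
matrix `(B_{ij})`. It does not depend on the basis. -/
def pairing (e : Module.Basis ι ℝ V) (B : V → V → ℝ) {k : ℕ} (α β : V [⋀^Fin k]→L[ℝ] ℝ) : ℝ :=
  (k.factorial : ℝ)⁻¹ * ∑ i : Fin k → ι, ∑ j : Fin k → ι,
    (∏ a, (gram e B)⁻¹ (i a) (j a)) * (α (fun a => e (i a)) * β (fun a => e (j a)))

/-- The star operator of a nondegenerate bilinear form `B` and a volume form `vol` (of top degree
`N`): for a `k`-form `β`, the form `*β` of degree `l = N - k` is
`(*β)_{m₁ … m_l} = (1/k!) B^{i₁j₁} ⋯ B^{i_k j_k} β_{j₁ … j_k} vol_{i₁ … i_k m₁ … m_l}`.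
This is the form with `α ∧ *β = (pairing of α and β) vol` for all `k`-forms `α`.
If `k + l ≠ N` the value is `0`. -/
def star (e : Module.Basis ι ℝ V) (B : V → V → ℝ) {N : ℕ} (vol : V [⋀^Fin N]→L[ℝ] ℝ)
    {k : ℕ} (l : ℕ) (β : V [⋀^Fin k]→L[ℝ] ℝ) : V [⋀^Fin l]→L[ℝ] ℝ :=
  if h : k + l = N then
    (k.factorial : ℝ)⁻¹ • ∑ i : Fin k → ι, ∑ j : Fin k → ι,
      ((∏ a, (gram e B)⁻¹ (i a) (j a)) * β (fun a => e (j a))) •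
        contract h vol (fun a => e (i a))
  else 0

end Linear

/-! ### Differential forms on a manifold of dimension `m` -/

section Forms

/-- The model space `ℝ^m`. -/
abbrev Model (m : ℕ) : Type := EuclideanSpace ℝ (Fin m)

/-- Fields of alternating `k`-linear forms on the tangent spaces (no regularity). -/
abbrev Form (m : ℕ) (M : Type*) [TopologicalSpace M] [ChartedSpace (Model m) M] (k : ℕ) : Type _ :=
  (x : M) → TangentSpace (𝓡 m) x [⋀^Fin k]→L[ℝ] ℝ

variable {m : ℕ} {M : Type*} [TopologicalSpace M] [ChartedSpace (Model m) M]

/-- The pull-back of `α` to `ℝ^m` by the inverse of the preferred chart at `x₀`: the local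
representation of `α`, meaningful on the target of the chart. -/
def localRep {k : ℕ} (α : Form m M k) (x₀ : M) (y : Model m) : Model m [⋀^Fin k]→L[ℝ] ℝ :=
  (α ((chartAt (Model m) x₀).symm y)).compContinuousLinearMap
    (mfderiv (𝓡 m) (𝓡 m) (chartAt (Model m) x₀).symm y :
      Model m →L[ℝ] TangentSpace (𝓡 m) ((chartAt (Model m) x₀).symm y))

/-- `α` is a smooth differential form. -/
def IsSmoothForm {k : ℕ} (α : Form m M k) : Prop :=
  ∀ x₀ : M, ContDiffOn ℝ ∞ (localRep α x₀) (chartAt (Model m) x₀).target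

/-- The exterior derivative, computed at `x` in the preferred chart at `x`. -/
def extD {k : ℕ} (α : Form m M k) : Form m M (k + 1) := fun x =>
  (extDeriv (localRep α x) (chartAt (Model m) x x)).compContinuousLinearMap
    (mfderiv (𝓡 m) (𝓡 m) (chartAt (Model m) x) x : TangentSpace (𝓡 m) x →L[ℝ] Model m)

/-- The standard basis of `T_x M`, which Mathlib identifies with `ℝ^m` by the preferred chart
at `x`. -/
def tangentBasis (x : M) : Module.Basis (Fin m) ℝ (TangentSpace (𝓡 m) x) :=
  (EuclideanSpace.basisFun (Fin m) ℝ).toBasis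

end Forms

/-! ### Almost Kähler manifolds -/

section AlmostKahler

variable {n : ℕ} {M : Type*} [TopologicalSpace M] [ChartedSpace (Model (2 * n)) M]
  [Bundle.RiemannianBundle (fun x : M => TangentSpace (𝓡 (2 * n)) x)]

variable (n) in
/-- The metric `g(u, v)`. -/
def metric (x : M) (u v : TangentSpace (𝓡 (2 * n)) x) : ℝ := inner ℝ u v

variable (n M) in
/-- An almost Kähler structure on a `2n`-manifold with Riemannian metric `g`: a smooth almost
complex structure `J` and a symplectic form `ω` (the field `Ω`) compatible with each other, with
`g(u, v) = ω(u, J v)` (which makes `ω` nondegenerate). -/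
structure AlmostKahlerStructure [IsManifold (𝓡 (2 * n)) ∞ M] where
  J : (x : M) → TangentSpace (𝓡 (2 * n)) x →L[ℝ] TangentSpace (𝓡 (2 * n)) x
  smooth_J : ContMDiff (𝓡 (2 * n))
    ((𝓡 (2 * n)).prod 𝓘(ℝ, Model (2 * n) →L[ℝ] Model (2 * n))) ∞
    (fun x : M => Bundle.TotalSpace.mk' (Model (2 * n) →L[ℝ] Model (2 * n))
      (E := fun x : M => TangentSpace (𝓡 (2 * n)) x →L[ℝ] TangentSpace (𝓡 (2 * n)) x) x (J x))
  J_J : ∀ x v, J x (J x v) = -v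
  Ω : Form (2 * n) M 2
  smooth_Ω : IsSmoothForm Ω
  closed_Ω : extD Ω = 0
  Ω_J : ∀ x u v, Ω x ![J x u, J x v] = Ω x ![u, v]
  metric_eq : ∀ x u v, metric n x u v = Ω x ![u, J x v]

variable [IsManifold (𝓡 (2 * n)) ∞ M] (S : AlmostKahlerStructure n M) {k : ℕ}

namespace AlmostKahlerStructure

/-- The Liouville volume form `ω^n / n!`. -/
def sympVol : Form (2 * n) M (2 * n) := fun x => (n.factorial : ℝ)⁻¹ • formPow (S.Ω x) n

/-- The Riemannian volume form for the orientation of `ω^n`: the positive multiple of `ω^n` whose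
value on a basis `(e_i)` of `T_x M` is `±√(det g(e_i, e_j))`. -/
def riemVol : Form (2 * n) M (2 * n) := fun x =>
  (√(gram (tangentBasis x) (metric n x)).det / |formPow (S.Ω x) n (tangentBasis x)|) •
    formPow (S.Ω x) n

/-- The symplectic star operator `*_s` from `k`-forms to `l`-forms, `k + l = 2n` (else `0`). -/
def starS (l : ℕ) (α : Form (2 * n) M k) : Form (2 * n) M l := fun x =>
  star (tangentBasis x) (fun u v => S.Ω x ![u, v]) (S.sympVol x) l (α x)

/-- The Hodge star operator `*_g` from `k`-forms to `l`-forms, `k + l = 2n` (else `0`). -/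
def starG (l : ℕ) (α : Form (2 * n) M k) : Form (2 * n) M l := fun x =>
  star (tangentBasis x) (metric n x) (S.riemVol x) l (α x)

/-- `d^Λ = (-1)^{k+1} *_s d *_s` from `k`-forms to `l`-forms, `l = k - 1` (else `0`). -/
def dLam (l : ℕ) (α : Form (2 * n) M k) : Form (2 * n) M l :=
  (-1 : ℝ) ^ (k + 1) • S.starS l (extD (S.starS (2 * n - k) α))

/-- `d^* = - *_g d *_g` from `k`-forms to `l`-forms, `l = k - 1` (else `0`). -/
def dStar (l : ℕ) (α : Form (2 * n) M k) : Form (2 * n) M l :=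
  -S.starG l (extD (S.starG (2 * n - k) α))

/-- `d^{Λ*} = *_g d^Λ *_g` from `k`-forms to `l`-forms, `l = k + 1` (else `0`). -/
def dLamStar (l : ℕ) (α : Form (2 * n) M k) : Form (2 * n) M l :=
  S.starG l (S.dLam (2 * n - l) (S.starG (2 * n - k) α))

/-- `d d^Λ` on `k`-forms (for `k = 0` it is `0`, as `d^Λ = 0`). -/
def ddLam (α : Form (2 * n) M k) : Form (2 * n) M k := fun x =>
  toDegree k (extD (S.dLam (k - 1) α) x)

/-- `(d d^Λ)^* = (-1)^{k+1} *_g d d^Λ *_g` on `k`-forms. -/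
def ddLamStar (α : Form (2 * n) M k) : Form (2 * n) M k :=
  (-1 : ℝ) ^ (k + 1) • S.starG k (S.ddLam (S.starG (2 * n - k) α))

/-- `d d^*` on `k`-forms (for `k = 0` it is `0`, as `d^* = 0`). -/
def ddStar (α : Form (2 * n) M k) : Form (2 * n) M k := fun x =>
  toDegree k (extD (S.dStar (k - 1) α) x)

/-- `Δ_{d+d^Λ} = d d^Λ (d d^Λ)^* + lam (d^* d + d^{Λ*} d^Λ)`. -/
def laplacianAdd (lam : ℝ) (α : Form (2 * n) M k) : Form (2 * n) M k :=
  S.ddLam (S.ddLamStar α) +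
    lam • (S.dStar k (extD α) + S.dLamStar k (S.dLam (k - 1) α))

/-- `Δ_{dd^Λ} = (d d^Λ)^* d d^Λ + lam (d d^* + d^Λ d^{Λ*})`. -/
def laplacianMul (lam : ℝ) (α : Form (2 * n) M k) : Form (2 * n) M k :=
  S.ddLamStar (S.ddLam α) +
    lam • (S.ddStar α + S.dLam k (S.dLamStar (k + 1) α))

/-- `L^r` on differential forms. -/
def lefPow (r : ℕ) (α : Form (2 * n) M k) : Form (2 * n) M (k + 2 * r) := fun x =>
  lefschetzPow (S.Ω x) r (α x)

/-- `L^{n-k}` from `k`-forms to `(2n-k)`-forms, for `k ≤ n`. -/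
def lefIso (α : Form (2 * n) M k) : Form (2 * n) M (2 * n - k) := fun x =>
  toDegree (2 * n - k) (S.lefPow (n - k) α x)

end AlmostKahlerStructure

end AlmostKahler

/-! ### Square-integrable harmonic forms -/

section L2

variable {n : ℕ} {M : Type*} [EMetricSpace M] [ChartedSpace (Model (2 * n)) M]
  [Bundle.RiemannianBundle (fun x : M => TangentSpace (𝓡 (2 * n)) x)]
  [MeasurableSpace M] [BorelSpace M] {k : ℕ}

/-- The squared `L²` norm `∫_M |α|²_g dvol_g`. The Riemannian volume measure of a Riemannian
manifold of dimension `2n` is the `2n`-dimensional Hausdorff measure of its Riemannian distance,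
normalized to agree with Lebesgue measure on `ℝ^{2n}`. -/
def l2NormSq (α : Form (2 * n) M k) : ENNReal :=
  ∫⁻ x, ENNReal.ofReal (pairing (tangentBasis x) (metric n x) (α x) (α x))
    ∂(μHE[2 * n] : MeasureTheory.Measure M)

variable [IsManifold (𝓡 (2 * n)) ∞ M] (S : AlmostKahlerStructure n M)

/-- `L²ℋ^k_{d+d^Λ}`: smooth square-integrable `k`-forms in the kernel of `Δ_{d+d^Λ}`. -/
def harmonicAdd (lam : ℝ) (k : ℕ) : Set (Form (2 * n) M k) :=
  {α | IsSmoothForm α ∧ l2NormSq α < ⊤ ∧ S.laplacianAdd lam α = 0}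

/-- `L²ℋ^k_{dd^Λ}`: smooth square-integrable `k`-forms in the kernel of `Δ_{dd^Λ}`. -/
def harmonicMul (lam : ℝ) (k : ℕ) : Set (Form (2 * n) M k) :=
  {α | IsSmoothForm α ∧ l2NormSq α < ⊤ ∧ S.laplacianMul lam α = 0}

/-- `T` restricts to an isomorphism from `A` to `B`: both are linear subspaces, `T` restricts to a
linear bijection between them, and the restriction and its inverse are bounded for the
`L²` norms. -/
def IsL2Iso {l : ℕ} (T : Form (2 * n) M k → Form (2 * n) M l)
    (A : Set (Form (2 * n) M k)) (B : Set (Form (2 * n) M l)) : Prop :=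
  ∃ (U : Submodule ℝ (Form (2 * n) M k)) (W : Submodule ℝ (Form (2 * n) M l)) (f : U ≃ₗ[ℝ] W),
    (U : Set (Form (2 * n) M k)) = A ∧ (W : Set (Form (2 * n) M l)) = B ∧
    (∀ α : U, (f α : Form (2 * n) M l) = T α) ∧
    ∃ C : NNReal, ∀ α : U, l2NormSq (T α) ≤ C * l2NormSq (α : Form (2 * n) M k) ∧
      l2NormSq (α : Form (2 * n) M k) ≤ C * l2NormSq (T α)

end L2

end SymplecticHodge

end

/-!
# Hard Lefschetz for square-integrable harmonic forms on almost Kähler manifolds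

The operator `L^{n-k}` is a pointwise isomorphism from `k`-forms to `(2n-k)`-forms, and it commutes
with both fourth-order Laplacians. The isomorphism of the kernels follows, and no integration by
parts is involved: `L^{n-k}` and its inverse are bounded at each point by constants depending only
on `n` and `k`, so they preserve square-integrability.

**Commutation.** On all forms, `L`, the contraction `Λ = ½ ω^{ij} ι(e_i) ι(e_j)` and the weight
`H = n - k` satisfy the relations of `sl₂` (`lam_mul_lef`, `IsLefschetzTriple`). Two linear maps on
the exterior algebra agree if they agree on `1` and have the same commutation rule with exterior
multiplication by covectors (`end_ext`). In this way the symplectic star is identified, up to a sign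
in each degree, with the Weyl element `exp(L) exp(-Λ) exp(L)` (`starΩ_eq_weyl`), and the Hodge star
with the symplectic star composed with `J` (`Compatible.starL_met`). As `ω` is closed, `d` commutes
with `L` (`extD_lefschetz`) and has weight `-1`; in an `sl₂`-representation with nilpotent `L` and
`Λ` this forces `[Λ, [Λ, d]] = 0` (`IsLefschetzTriple.lam_mul_commutator`), so that `d` and `[Λ, d]`
span a two-dimensional representation, which the Weyl element rotates. Hence `d^Λ = [d, Λ]`
(`KahlerRelations.star_d_star`), and with `*_g L *_g = Λ (-1)^k` the commutation of `L` with the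
Laplacians is a computation in a noncommutative ring (`KahlerRelations.lef_mul_laplacian`). The
integrability of `J` plays no role.

**Inversion and bounds.** On `k`-forms the operator `Λ^{n-k} L^{n-k}` is a polynomial in `L Λ` with
negative roots, while `L Λ` is annihilated by a polynomial with non-negative roots. The two are
coprime, so the inverse of `Λ^{n-k} L^{n-k}` is again a polynomial in `L Λ`
(`exists_inverse_polynomial`), and this gives an inverse of `L^{n-k}` that is a polynomial in `L`
and `Λ` (`AlmostKahlerStructure.exists_leftInverse`). In an orthonormal basis the matrix of `ω` and
its inverse have entries at most `1`, which bounds `L` and `Λ`, and with them every polynomial in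
both, uniformly on the manifold (`AlmostKahlerStructure.boundedOps`).
-/

noncomputable section

namespace SymplecticHodge

set_option linter.unusedSectionVars false

/-! ### The exterior algebra: exterior multiplication and contraction -/

section ExteriorAlgebra

variable {V : Type*} [AddCommGroup V] [Module ℝ V] [TopologicalSpace V]

variable (V) in
/-- Inhomogeneous forms: families with one form in each degree. Working with families keeps
degrees out of the types, so that operators live in one endomorphism ring. -/
structure Forms : Type _ where
  /-- The component in each degree. -/
  toFun : (k : ℕ) → V [⋀^Fin k]→L[ℝ] ℝ

namespace Forms

instance : CoeFun (Forms V) (fun _ => (k : ℕ) → V [⋀^Fin k]→L[ℝ] ℝ) := ⟨toFun⟩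

theorem toFun_injective : Function.Injective (toFun : Forms V → _) := by
  rintro ⟨α⟩ ⟨β⟩ h
  exact congrArg _ h

instance : Zero (Forms V) := ⟨⟨0⟩⟩
instance : Add (Forms V) := ⟨fun α β => ⟨α.toFun + β.toFun⟩⟩
instance : Neg (Forms V) := ⟨fun α => ⟨-α.toFun⟩⟩
instance : Sub (Forms V) := ⟨fun α β => ⟨α.toFun - β.toFun⟩⟩
instance {R : Type*} [SMul R ((k : ℕ) → V [⋀^Fin k]→L[ℝ] ℝ)] : SMul R (Forms V) :=
  ⟨fun c α => ⟨c • α.toFun⟩⟩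

instance : AddCommGroup (Forms V) :=
  toFun_injective.addCommGroup toFun rfl (fun _ _ => rfl) (fun _ => rfl) (fun _ _ => rfl)
    (fun _ _ => rfl) fun _ _ => rfl

instance : Module ℝ (Forms V) :=
  toFun_injective.module ℝ ⟨⟨toFun, rfl⟩, fun _ _ => rfl⟩ fun _ _ => rfl

@[ext] theorem ext {α β : Forms V} (h : ∀ k, α k = β k) : α = β := toFun_injective (funext h)

@[simp] theorem add_apply (α β : Forms V) (k : ℕ) : (α + β) k = α k + β k := rfl
@[simp] theorem sub_apply (α β : Forms V) (k : ℕ) : (α - β) k = α k - β k := rfl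
@[simp] theorem neg_apply (α : Forms V) (k : ℕ) : (-α) k = -α k := rfl
@[simp] theorem smul_apply (c : ℝ) (α : Forms V) (k : ℕ) : (c • α) k = c • α k := rfl
@[simp] theorem zero_apply (k : ℕ) : (0 : Forms V) k = 0 := rfl

/-- The component in degree `k`, as a linear map. -/
def proj (k : ℕ) : Forms V →ₗ[ℝ] V [⋀^Fin k]→L[ℝ] ℝ where
  toFun α := α k
  map_add' _ _ := rfl
  map_smul' _ _ := rfl

@[simp] theorem proj_apply (k : ℕ) (α : Forms V) : proj k α = α k := rfl

theorem sum_apply {κ : Type*} (s : Finset κ) (f : κ → Forms V) (k : ℕ) :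
    (∑ i ∈ s, f i) k = ∑ i ∈ s, f i k := map_sum (proj k) f s

end Forms

theorem toDegree_self {k : ℕ} (α : V [⋀^Fin k]→L[ℝ] ℝ) : toDegree k α = α := by
  simp [toDegree]

theorem toDegree_of_ne {k l : ℕ} (h : k ≠ l) (α : V [⋀^Fin k]→L[ℝ] ℝ) : toDegree l α = 0 := by
  simp [toDegree, h]

theorem toDegree_add {k : ℕ} (l : ℕ) (α β : V [⋀^Fin k]→L[ℝ] ℝ) :
    toDegree l (α + β) = toDegree l α + toDegree l β := by
  by_cases h : k = l
  · subst h; simp [toDegree_self]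
  · simp [toDegree_of_ne h]

theorem toDegree_smul {k : ℕ} (l : ℕ) (c : ℝ) (α : V [⋀^Fin k]→L[ℝ] ℝ) :
    toDegree l (c • α) = c • toDegree l α := by
  by_cases h : k = l
  · subst h; simp [toDegree_self]
  · simp [toDegree_of_ne h]

/-- The family consisting of a single form in degree `k`. -/
def single (k : ℕ) : (V [⋀^Fin k]→L[ℝ] ℝ) →ₗ[ℝ] Forms V where
  toFun α := ⟨fun l => toDegree l α⟩
  map_add' α β := by ext1 l; exact toDegree_add l α β
  map_smul' c α := by ext1 l; exact toDegree_smul l c α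

@[simp] theorem single_same (k : ℕ) (α : V [⋀^Fin k]→L[ℝ] ℝ) : single k α k = α :=
  toDegree_self α

theorem single_of_ne {k l : ℕ} (h : l ≠ k) (α : V [⋀^Fin k]→L[ℝ] ℝ) : single k α l = 0 :=
  toDegree_of_ne h.symm α

theorem single_toDegree {k l : ℕ} (h : k = l) (α : V [⋀^Fin k]→L[ℝ] ℝ) :
    single l (toDegree l α) = single k α := by
  subst h; rw [toDegree_self]

variable (V) in
/-- The constant `0`-form `1`. -/
def oneForm : V [⋀^Fin 0]→L[ℝ] ℝ := ContinuousAlternatingMap.constOfIsEmpty ℝ V (Fin 0) (1 : ℝ)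

/-- The exterior product `ξ ∧ α` of a covector and a form. -/
def covWedge (ξ : V →L[ℝ] ℝ) {k : ℕ} (α : V [⋀^Fin k]→L[ℝ] ℝ) : V [⋀^Fin (k + 1)]→L[ℝ] ℝ :=
  { AlternatingMap.alternatizeUncurryFin ((ξ : V →ₗ[ℝ] ℝ).smulRight α.toAlternatingMap) with
    cont := by
      have h : (fun v : Fin (k + 1) → V => AlternatingMap.alternatizeUncurryFin
          ((ξ : V →ₗ[ℝ] ℝ).smulRight α.toAlternatingMap) v) = fun v : Fin (k + 1) → V =>
            ∑ i : Fin (k + 1), (-1 : ℝ) ^ (i : ℕ) * (ξ (v i) * α (i.removeNth v)) := by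
        funext v
        simp [AlternatingMap.alternatizeUncurryFin_apply]
      refine (congrArg Continuous h).mpr ?_
      refine continuous_finsetSum _ fun i _ => ?_
      have h1 : Continuous fun v : Fin (k + 1) → V => ξ (v i) :=
        ξ.continuous.comp (continuous_apply i)
      have h2 : Continuous fun v : Fin (k + 1) → V => α (i.removeNth v) :=
        α.cont.comp (continuous_pi fun j => continuous_apply (i.succAbove j))
      exact continuous_const.mul (h1.mul h2) }

theorem covWedge_apply (ξ : V →L[ℝ] ℝ) {k : ℕ} (α : V [⋀^Fin k]→L[ℝ] ℝ) (v : Fin (k + 1) → V) :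
    covWedge ξ α v = ∑ i : Fin (k + 1), (-1 : ℝ) ^ (i : ℕ) * (ξ (v i) * α (i.removeNth v)) := by
  change AlternatingMap.alternatizeUncurryFin _ v = _
  simp [AlternatingMap.alternatizeUncurryFin_apply]

/-- Exterior multiplication `α ↦ ξ ∧ α` by a covector, on forms of one degree. -/
def extMul (ξ : V →L[ℝ] ℝ) {k : ℕ} :
    (V [⋀^Fin k]→L[ℝ] ℝ) →ₗ[ℝ] (V [⋀^Fin (k + 1)]→L[ℝ] ℝ) where
  toFun := covWedge ξ
  map_add' α β := by
    ext v
    simp [covWedge_apply, mul_add, Finset.sum_add_distrib]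
  map_smul' c α := by
    ext v
    simp [covWedge_apply, Finset.mul_sum, mul_left_comm]

theorem extMul_apply (ξ : V →L[ℝ] ℝ) {k : ℕ} (α : V [⋀^Fin k]→L[ℝ] ℝ) (v : Fin (k + 1) → V) :
    extMul ξ α v = ∑ i : Fin (k + 1), (-1 : ℝ) ^ (i : ℕ) * (ξ (v i) * α (i.removeNth v)) :=
  covWedge_apply ξ α v

/-- Contraction of the first slot with a vector, on forms of one degree. -/
def contr (u : V) {k : ℕ} : (V [⋀^Fin (k + 1)]→L[ℝ] ℝ) →ₗ[ℝ] (V [⋀^Fin k]→L[ℝ] ℝ) where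
  toFun α :=
    { α.toAlternatingMap.curryLeft u with
      cont := by
        change Continuous fun v : Fin k → V => α (Fin.cons u v)
        refine α.cont.comp (continuous_pi fun j => ?_)
        refine Fin.cases ?_ (fun i => ?_) j
        · simpa using continuous_const
        · simpa using continuous_apply i }
  map_add' _ _ := rfl
  map_smul' _ _ := rfl

theorem contr_apply (u : V) {k : ℕ} (α : V [⋀^Fin (k + 1)]→L[ℝ] ℝ) (v : Fin k → V) :
    contr u α v = α (Fin.cons u v) := rfl

/-- Exterior multiplication `α ↦ ξ ∧ α` by a covector. -/
def eps (ξ : V →L[ℝ] ℝ) : Module.End ℝ (Forms V) where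
  toFun α := ⟨fun k => match k with
    | 0 => 0
    | k + 1 => extMul ξ (α k)⟩
  map_add' α β := by
    ext1 k
    cases k with
    | zero => exact (add_zero _).symm
    | succ k => exact map_add (extMul ξ) (α k) (β k)
  map_smul' c α := by
    ext1 k
    cases k with
    | zero => exact (smul_zero c).symm
    | succ k => exact map_smul (extMul ξ) c (α k)

@[simp] theorem eps_zero (ξ : V →L[ℝ] ℝ) (α : Forms V) : eps ξ α 0 = 0 := rfl
@[simp] theorem eps_succ (ξ : V →L[ℝ] ℝ) (α : Forms V) (k : ℕ) :
    eps ξ α (k + 1) = extMul ξ (α k) := rfl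

/-- Contraction with a vector. -/
def iota (u : V) : Module.End ℝ (Forms V) where
  toFun α := ⟨fun k => contr u (α (k + 1))⟩
  map_add' _ _ := rfl
  map_smul' _ _ := rfl

@[simp] theorem iota_apply (u : V) (α : Forms V) (k : ℕ) : iota u α k = contr u (α (k + 1)) := rfl

theorem eps_add (ξ η : V →L[ℝ] ℝ) : eps (ξ + η) = eps ξ + eps η := by
  ext α k v
  cases k with
  | zero => simp
  | succ k => simp [extMul_apply, ← Finset.sum_add_distrib, add_mul, mul_add]

theorem eps_smul (c : ℝ) (ξ : V →L[ℝ] ℝ) : eps (c • ξ) = c • eps ξ := by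
  ext α k v
  cases k with
  | zero => simp
  | succ k => simp [extMul_apply, Finset.mul_sum, mul_assoc, mul_left_comm]

theorem iota_add (u v : V) : iota (u + v) = iota u + iota v := by
  ext α k w
  simpa [contr_apply] using ContinuousAlternatingMap.cons_add (α (k + 1)) w u v

theorem iota_smul (c : ℝ) (u : V) : iota (c • u) = c • iota u := by
  ext α k w
  simpa [contr_apply] using ContinuousAlternatingMap.cons_smul (α (k + 1)) w c u

variable (V) in
/-- `iota` as a linear map. -/
def iotaHom : V →ₗ[ℝ] Module.End ℝ (Forms V) where
  toFun := iota
  map_add' := iota_add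
  map_smul' := iota_smul

variable (V) in
/-- `eps` as a linear map. -/
def epsHom : (V →L[ℝ] ℝ) →ₗ[ℝ] Module.End ℝ (Forms V) where
  toFun := eps
  map_add' := eps_add
  map_smul' := eps_smul

theorem iota_sum {ι : Type*} (s : Finset ι) (f : ι → V) :
    iota (∑ i ∈ s, f i) = ∑ i ∈ s, iota (f i) := map_sum (iotaHom V) f s

theorem eps_sum {ι : Type*} (s : Finset ι) (f : ι → V →L[ℝ] ℝ) :
    eps (∑ i ∈ s, f i) = ∑ i ∈ s, eps (f i) := map_sum (epsHom V) f s

theorem iota_mul_self (u : V) : iota u * iota u = 0 := by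
  ext α k w
  simp only [Module.End.mul_apply, iota_apply, contr_apply, LinearMap.zero_apply, Forms.zero_apply,
    ContinuousAlternatingMap.coe_zero]
  exact (α (k + 1 + 1)).map_eq_zero_of_eq (i := 0) (j := 1) _ (by simp [Fin.cons_one]) (by simp)

theorem iota_mul_iota (u v : V) : iota u * iota v = -(iota v * iota u) := by
  have h := iota_mul_self (u + v)
  rw [iota_add, add_mul, mul_add, mul_add, iota_mul_self, iota_mul_self] at h
  rw [eq_neg_iff_add_eq_zero]
  simpa using h

/-- The canonical anticommutation relation. -/
theorem iota_mul_eps (u : V) (ξ : V →L[ℝ] ℝ) :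
    iota u * eps ξ = ξ u • (1 : Module.End ℝ (Forms V)) - eps ξ * iota u := by
  ext α k w
  cases k with
  | zero =>
    simp only [Module.End.mul_apply, iota_apply, contr_apply, eps_succ, extMul_apply,
      LinearMap.sub_apply, LinearMap.smul_apply, Module.End.one_apply, Forms.sub_apply, eps_zero,
      Forms.smul_apply, Fin.sum_univ_succ, Finset.univ_eq_empty, Finset.sum_empty, sub_zero,
      ContinuousAlternatingMap.smul_apply, smul_eq_mul]
    simp
  | succ k =>
    simp only [Module.End.mul_apply, iota_apply, contr_apply, eps_succ, extMul_apply,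
      LinearMap.sub_apply, LinearMap.smul_apply, Module.End.one_apply, Forms.sub_apply,
      Forms.smul_apply, ContinuousAlternatingMap.smul_apply, smul_eq_mul,
      ContinuousAlternatingMap.sub_apply]
    rw [Fin.sum_univ_succ, sub_eq_add_neg, ← Finset.sum_neg_distrib]
    congr 1
    · simp
    · refine Finset.sum_congr rfl fun i _ => ?_
      have : (Fin.succ i).removeNth (Fin.cons u w : Fin (k + 2) → V) =
          Fin.cons u (i.removeNth w) := by
        funext j
        refine Fin.cases ?_ (fun j => ?_) j
        · simp [Fin.removeNth]
        · simp [Fin.removeNth]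
      rw [this]
      simp [pow_succ]

theorem eps_mul_self (ξ : V →L[ℝ] ℝ) : eps ξ * eps ξ = 0 := by
  -- By induction on the degree: all contractions of `ξ ∧ ξ ∧ α` vanish.
  have key : ∀ (k : ℕ) (α : Forms V), eps ξ (eps ξ α) k = 0 := by
    intro k
    induction k with
    | zero => intro α; rfl
    | succ k ih =>
      intro α
      ext w
      have h : iota (w 0) * (eps ξ * eps ξ) = (eps ξ * eps ξ) * iota (w 0) := by
        rw [← mul_assoc, iota_mul_eps, sub_mul, mul_assoc, iota_mul_eps, mul_sub, mul_assoc]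
        simp
      have h2 := congrArg (fun A : Module.End ℝ (Forms V) => A α k (Fin.tail w)) h
      simp only [Module.End.mul_apply, iota_apply, contr_apply, Fin.cons_self_tail, ih] at h2
      simpa using h2
  ext α k : 2
  exact key k α

theorem eps_mul_eps (ξ η : V →L[ℝ] ℝ) : eps ξ * eps η = -(eps η * eps ξ) := by
  have h := eps_mul_self (ξ + η)
  rw [eps_add, add_mul, mul_add, mul_add, eps_mul_self, eps_mul_self] at h
  rw [eq_neg_iff_add_eq_zero]
  simpa using h

theorem iota_oneForm (u : V) : iota u (single 0 (oneForm V)) = 0 := by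
  ext1 k
  simp [single_of_ne]

/-- The operator that multiplies forms of degree `k` by `c k`. -/
def diag (c : ℕ → ℝ) : Module.End ℝ (Forms V) where
  toFun α := ⟨fun k => c k • α k⟩
  map_add' α β := by ext1 k; exact smul_add _ _ _
  map_smul' a α := by ext1 k; exact smul_comm (c k) a (α k)

@[simp] theorem diag_apply (c : ℕ → ℝ) (α : Forms V) (k : ℕ) : diag c α k = c k • α k := rfl

theorem diag_mul_diag (c c' : ℕ → ℝ) :
    (diag c * diag c' : Module.End ℝ (Forms V)) = diag (fun k => c k * c' k) := by
  ext α k v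
  simp [mul_assoc]

theorem diag_single (c : ℕ → ℝ) (k : ℕ) (α : V [⋀^Fin k]→L[ℝ] ℝ) :
    diag c (single k α) = c k • single k α := by
  ext1 l
  by_cases h : l = k
  · subst h; simp
  · simp [single_of_ne h]

theorem diag_mul_eps (c : ℕ → ℝ) (ξ : V →L[ℝ] ℝ) :
    diag c * eps ξ = eps ξ * diag (fun k => c (k + 1)) := by
  ext α k v
  cases k <;> simp

/-- The exterior product of a list of covectors. -/
def decomposable : (k : ℕ) → (Fin k → V →L[ℝ] ℝ) → V [⋀^Fin k]→L[ℝ] ℝ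
  | 0, _ => oneForm V
  | k + 1, ζ => extMul (ζ 0) (decomposable k (Fin.tail ζ))

theorem decomposable_apply (k : ℕ) (ζ : Fin k → V →L[ℝ] ℝ) (v : Fin k → V) :
    decomposable k ζ v = (Matrix.of fun i j => ζ i (v j)).det := by
  induction k with
  | zero => simp [decomposable, oneForm]
  | succ k ih =>
    rw [decomposable, extMul_apply, Matrix.det_succ_row _ 0]
    refine Finset.sum_congr rfl fun i _ => ?_
    rw [ih]
    simp only [Fin.val_zero, zero_add, Matrix.of_apply, mul_assoc]
    rfl

theorem eps_single (ξ : V →L[ℝ] ℝ) (k : ℕ) (α : V [⋀^Fin k]→L[ℝ] ℝ) :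
    eps ξ (single k α) = single (k + 1) (extMul ξ α) := by
  ext1 l
  cases l with
  | zero => rw [single_of_ne (by omega)]; rfl
  | succ l =>
    by_cases h : l = k
    · subst h; simp
    · simp [single_of_ne h, single_of_ne (show l + 1 ≠ k + 1 by omega)]

theorem single_decomposable_succ (k : ℕ) (ζ : Fin (k + 1) → V →L[ℝ] ℝ) :
    single (k + 1) (decomposable (k + 1) ζ) =
      eps (ζ 0) (single k (decomposable k (Fin.tail ζ))) := by
  rw [eps_single]; rfl

end ExteriorAlgebra

section Basis

variable {V : Type*} [AddCommGroup V] [Module ℝ V] [TopologicalSpace V]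
  [IsTopologicalAddGroup V] [ContinuousSMul ℝ V] [T2Space V] {ι : Type*} [Fintype ι]

/-- The dual basis, as continuous covectors. -/
def dualCov (e : Module.Basis ι ℝ V) (i : ι) : V →L[ℝ] ℝ :=
  have := Module.Finite.of_basis e
  LinearMap.toContinuousLinearMap (e.coord i)

@[simp] theorem dualCov_apply (e : Module.Basis ι ℝ V) (i : ι) (v : V) :
    dualCov e i v = e.repr v i := rfl

theorem apply_eq_sum_basis (e : Module.Basis ι ℝ V) {k : ℕ} (α : V [⋀^Fin k]→L[ℝ] ℝ)
    (v : Fin k → V) :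
    α v = ∑ I : Fin k → ι, (∏ a, e.repr (v a) (I a)) * α (fun a => e (I a)) := by
  classical
  conv_lhs => rw [show v = fun a => ∑ i, e.repr (v a) i • e i from
    funext fun a => (e.sum_repr (v a)).symm]
  rw [ContinuousAlternatingMap.map_sum]
  refine Finset.sum_congr rfl fun I _ => ?_
  rw [α.map_smul_univ (fun a => e.repr (v a) (I a)) (fun a => e (I a)), smul_eq_mul]

/-- The expansion of a form in the exterior products of a dual basis. -/
theorem eq_sum_decomposable (e : Module.Basis ι ℝ V) {k : ℕ} (α : V [⋀^Fin k]→L[ℝ] ℝ) :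
    α = ∑ I : Fin k → ι, ((k.factorial : ℝ)⁻¹ * α (fun a => e (I a))) •
      decomposable k (fun a => dualCov e (I a)) := by
  ext v
  rw [ContinuousAlternatingMap.sum_apply]
  simp only [ContinuousAlternatingMap.smul_apply, decomposable_apply, Matrix.det_apply,
    Matrix.of_apply, dualCov_apply, smul_eq_mul]
  have key : ∀ σ : Equiv.Perm (Fin k), ∑ I : Fin k → ι, α (fun a => e (I a)) *
      (Equiv.Perm.sign σ • ∏ x, e.repr (v x) (I (σ x))) = α v := by
    intro σ
    rw [apply_eq_sum_basis e α v, ← (Equiv.arrowCongr σ (Equiv.refl ι)).sum_comp]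
    refine Finset.sum_congr rfl fun I _ => ?_
    have h : α (fun a => e (I (σ.symm a))) = Equiv.Perm.sign σ.symm • α (fun a => e (I a)) :=
      α.toAlternatingMap.map_perm (fun a => e (I a)) σ.symm
    have h2 : ((Equiv.arrowCongr σ (Equiv.refl ι)) I) = fun a => I (σ.symm a) := rfl
    rw [h2, h]
    simp only [Equiv.symm_apply_apply, Equiv.Perm.sign_symm]
    rcases Int.units_eq_one_or (Equiv.Perm.sign σ) with hs | hs <;> simp [hs, mul_comm]
  simp only [Finset.mul_sum, mul_assoc]
  rw [Finset.sum_comm]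
  simp only [← Finset.mul_sum, key]
  simp [Fintype.card_perm]
  field_simp

theorem eq_zero_of_card_lt (e : Module.Basis ι ℝ V) {k : ℕ} (hk : Fintype.card ι < k)
    (α : V [⋀^Fin k]→L[ℝ] ℝ) : α = 0 := by
  ext v
  rw [apply_eq_sum_basis e α v]
  refine Finset.sum_eq_zero fun I _ => ?_
  have : ¬ Function.Injective I := fun h => by
    have := Fintype.card_le_of_injective I h
    simp at this; omega
  rw [α.map_eq_zero_of_not_injective _ fun h => this fun a b hab => h (by simp [hab]), mul_zero]

theorem eq_sum_single (e : Module.Basis ι ℝ V) (α : Forms V) :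
    α = ∑ k ∈ Finset.range (Fintype.card ι + 1), single k (α k) := by
  ext1 l
  rw [Forms.sum_apply]
  by_cases h : l < Fintype.card ι + 1
  · rw [Finset.sum_eq_single_of_mem l (by simpa using h) fun k _ hk => single_of_ne hk.symm _]
    simp
  · rw [eq_zero_of_card_lt e (by omega) (α l), Finset.sum_eq_zero]
    intro k hk
    exact single_of_ne (by simp at hk; omega) _

/-- The exterior algebra is generated from `1` by exterior multiplication with covectors. -/
theorem submodule_eq_top (e : Module.Basis ι ℝ V) (U : Submodule ℝ (Forms V))
    (h1 : single 0 (oneForm V) ∈ U) (he : ∀ (ξ : V →L[ℝ] ℝ), ∀ α ∈ U, eps ξ α ∈ U) : U = ⊤ := by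
  have hD : ∀ (k : ℕ) (ζ : Fin k → V →L[ℝ] ℝ), single k (decomposable k ζ) ∈ U := by
    intro k
    induction k with
    | zero => intro ζ; exact h1
    | succ k ih => intro ζ; rw [single_decomposable_succ]; exact he _ _ (ih _)
  rw [eq_top_iff]
  rintro α -
  rw [eq_sum_single e α]
  refine U.sum_mem fun k _ => ?_
  rw [eq_sum_decomposable e (α k), map_sum]
  refine U.sum_mem fun I _ => ?_
  rw [map_smul]
  exact U.smul_mem _ (hD _ _)

/-- Two linear maps agree if they agree on `1` and intertwine exterior multiplication by each
covector with the same operator. -/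
theorem hom_ext (e : Module.Basis ι ℝ V) {W : Type*} [AddCommGroup W] [Module ℝ W]
    {A B : Forms V →ₗ[ℝ] W} (c : (V →L[ℝ] ℝ) → W →ₗ[ℝ] W)
    (h1 : A (single 0 (oneForm V)) = B (single 0 (oneForm V)))
    (hA : ∀ ξ α, A (eps ξ α) = c ξ (A α)) (hB : ∀ ξ α, B (eps ξ α) = c ξ (B α)) : A = B := by
  have := submodule_eq_top e (LinearMap.eqLocus A B) h1 fun ξ α hα => by
    rw [LinearMap.mem_eqLocus] at hα ⊢
    rw [hA, hB, hα]
  ext1 α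
  have h : α ∈ LinearMap.eqLocus A B := this ▸ Submodule.mem_top
  exact h

/-- The version of `hom_ext` for endomorphisms, in the endomorphism ring. -/
theorem end_ext (e : Module.Basis ι ℝ V) {A B : Module.End ℝ (Forms V)}
    (c : (V →L[ℝ] ℝ) → Module.End ℝ (Forms V))
    (h1 : A (single 0 (oneForm V)) = B (single 0 (oneForm V)))
    (hA : ∀ ξ, A * eps ξ = c ξ * A) (hB : ∀ ξ, B * eps ξ = c ξ * B) : A = B :=
  hom_ext e c h1 (fun ξ α => LinearMap.congr_fun (hA ξ) α)
    fun ξ α => LinearMap.congr_fun (hB ξ) α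

theorem cov_eq_sum (e : Module.Basis ι ℝ V) (ξ : V →L[ℝ] ℝ) :
    ξ = ∑ i, ξ (e i) • dualCov e i := by
  ext v
  conv_lhs => rw [← e.sum_repr v, map_sum]
  simp [mul_comm]

end Basis

/-! ### Commutators and exponentials of nilpotent elements -/

section NilpotentExp

variable {R : Type*} [Ring R] [Algebra ℝ R]

/-- The exponential series of `X` up to order `N`; it is the exponential of `X` if `X ^ N = 0`. -/
def expSum (N : ℕ) (X : R) : R := ∑ i ∈ Finset.range (N + 1), (i.factorial : ℝ)⁻¹ • X ^ i

theorem pow_mul_of_commutator {X a b : R} (hab : X * a = a * X + b) (hb : X * b = b * X) (i : ℕ) :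
    X ^ (i + 1) * a = a * X ^ (i + 1) + ((i + 1 : ℕ) : ℝ) • (b * X ^ i) := by
  induction i with
  | zero => simp [hab]
  | succ i ih =>
    rw [pow_succ' X (i + 1), mul_assoc, ih, mul_add, ← mul_assoc, hab, add_mul, mul_smul_comm,
      ← mul_assoc, hb, mul_assoc, mul_assoc, ← pow_succ', ← pow_succ']
    push_cast
    module

/-- If `[X, a] = b` commutes with `X`, then `exp(X) a exp(-X) = a + b`. -/
theorem expSum_mul {N : ℕ} {X a b : R} (hN : X ^ N = 0) (hab : X * a = a * X + b)
    (hb : X * b = b * X) : expSum N X * a = (a + b) * expSum N X := by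
  have h1 : expSum N X = ∑ i ∈ Finset.range N, (i.factorial : ℝ)⁻¹ • X ^ i := by
    rw [expSum, Finset.sum_range_succ, hN, smul_zero, add_zero]
  rw [add_mul]
  conv_rhs => rw [h1]
  conv_rhs => arg 1; rw [← h1]
  rw [expSum, Finset.sum_range_succ', add_mul, Finset.sum_mul,
    mul_add, Finset.mul_sum, Finset.mul_sum]
  have h2 : ∀ i ∈ Finset.range N, ((i + 1).factorial : ℝ)⁻¹ • X ^ (i + 1) * a =
      a * ((i + 1).factorial : ℝ)⁻¹ • X ^ (i + 1) + b * (i.factorial : ℝ)⁻¹ • X ^ i := by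
    intro i _
    rw [smul_mul_assoc, pow_mul_of_commutator hab hb, smul_add, mul_smul_comm, mul_smul_comm,
      smul_smul]
    congr 2
    rw [Nat.factorial_succ]
    push_cast
    have : (i.factorial : ℝ) ≠ 0 := by positivity
    field_simp
  rw [Finset.sum_congr rfl h2, Finset.sum_add_distrib]
  simp
  abel

theorem expSum_mul_of_commute {N : ℕ} {X a : R} (h : X * a = a * X) :
    expSum N X * a = a * expSum N X := by
  have : Commute X a := h
  simp only [expSum, Finset.sum_mul, Finset.mul_sum, smul_mul_assoc, mul_smul_comm]
  exact Finset.sum_congr rfl fun i _ => by rw [(this.pow_left i).eq]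

theorem expSum_neg_mul_expSum {N : ℕ} {X : R} (hN : X ^ N = 0) :
    expSum N (-X) * expSum N X = 1 := by
  let _ : Module ℚ R := Module.compHom R (algebraMap ℚ ℝ)
  have h : ∀ Y : R, Y ^ N = 0 → expSum N Y = IsNilpotent.exp Y := by
    intro Y hY
    rw [IsNilpotent.exp_eq_sum (k := N + 1) (by rw [pow_succ, hY, zero_mul]), expSum]
    refine Finset.sum_congr rfl fun i _ => ?_
    change _ = (algebraMap ℚ ℝ ((i.factorial : ℚ)⁻¹)) • Y ^ i
    simp
  rw [h X hN, h (-X) (by rw [neg_pow, hN, mul_zero]), IsNilpotent.exp_neg_mul_exp_self ⟨N, hN⟩]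

end NilpotentExp

/-! ### The exterior product with a `2`-form -/

section Wedge

variable {V : Type*} [AddCommGroup V] [Module ℝ V] [TopologicalSpace V]

theorem wedge_apply {k l : ℕ} (α : V [⋀^Fin k]→L[ℝ] ℝ) (β : V [⋀^Fin l]→L[ℝ] ℝ)
    (v : Fin (k + l) → V) :
    wedge α β v = (k.factorial * l.factorial : ℝ)⁻¹ * ∑ σ : Equiv.Perm (Fin (k + l)),
      Equiv.Perm.sign σ • (α (fun i => v (σ (Fin.castAdd l i))) *
        β (fun i => v (σ (Fin.natAdd k i)))) := by
  rw [wedge, ContinuousAlternatingMap.smul_apply,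
    ContinuousMultilinearMap.alternatization_apply_apply]
  rfl

theorem wedge_decomposable {k l : ℕ} (η : Fin k → V →L[ℝ] ℝ) (ζ : Fin l → V →L[ℝ] ℝ) :
    wedge (decomposable k η) (decomposable l ζ) = decomposable (k + l) (Fin.append η ζ) := by
  ext v
  rw [wedge_apply, decomposable_apply, ← Matrix.det_transpose]
  simp only [decomposable_apply, Matrix.det_apply, Matrix.of_apply, Matrix.transpose_apply]
  -- The summand of the pair `(τ, ρ)` is reindexed by `σ ↦ σ ∘ (τ ⊕ ρ)`.
  have key : ∀ (τ : Equiv.Perm (Fin k)) (ρ : Equiv.Perm (Fin l)),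
      ∑ σ : Equiv.Perm (Fin (k + l)), Equiv.Perm.sign σ •
        ((Equiv.Perm.sign τ • ∏ a, η (τ a) (v (σ (Fin.castAdd l a)))) *
          (Equiv.Perm.sign ρ • ∏ b, ζ (ρ b) (v (σ (Fin.natAdd k b))))) =
      ∑ σ : Equiv.Perm (Fin (k + l)), Equiv.Perm.sign σ •
        ∏ i, Fin.append η ζ i (v (σ i)) := by
    intro τ ρ
    set θ : Equiv.Perm (Fin (k + l)) := finSumFinEquiv.permCongr (Equiv.Perm.sumCongr τ ρ)
      with hθ
    have hsign : Equiv.Perm.sign θ = Equiv.Perm.sign τ * Equiv.Perm.sign ρ := by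
      rw [hθ, Equiv.Perm.sign_permCongr, Equiv.Perm.sign_sumCongr]
    have hθ1 : ∀ a, θ (Fin.castAdd l a) = Fin.castAdd l (τ a) := fun a => by
      simp [hθ, Equiv.permCongr_apply]
    have hθ2 : ∀ b, θ (Fin.natAdd k b) = Fin.natAdd k (ρ b) := fun b => by
      simp [hθ, Equiv.permCongr_apply]
    rw [← Equiv.sum_comp (Equiv.mulRight θ⁻¹) (fun σ => Equiv.Perm.sign σ •
        ∏ i, Fin.append η ζ i (v (σ i)))]
    refine Finset.sum_congr rfl fun σ _ => ?_
    have hprod : ∏ i, Fin.append η ζ i (v ((Equiv.mulRight θ⁻¹ σ) i)) =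
        (∏ a, η (τ a) (v (σ (Fin.castAdd l a)))) * ∏ b, ζ (ρ b) (v (σ (Fin.natAdd k b))) := by
      have hv : ∀ i, (Equiv.mulRight θ⁻¹ σ) (θ i) = σ i := fun i => by simp
      rw [← Equiv.prod_comp θ, Fin.prod_univ_add]
      simp only [hv]
      simp only [hθ1, hθ2, Fin.append_left, Fin.append_right]
    rw [hprod, Equiv.coe_mulRight, Equiv.Perm.sign_mul, Equiv.Perm.sign_inv, hsign]
    simp only [smul_mul_smul_comm, smul_smul]
  simp only [Finset.sum_mul_sum, Finset.smul_sum]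
  rw [Finset.sum_comm]
  rw [Finset.sum_congr rfl fun τ _ => Finset.sum_comm]
  simp only [key]
  simp [Fintype.card_perm]
  field_simp

/-- The Lefschetz operator as a bilinear map. -/
def lefschetzHom (k : ℕ) :
    (V [⋀^Fin 2]→L[ℝ] ℝ) →ₗ[ℝ] (V [⋀^Fin k]→L[ℝ] ℝ) →ₗ[ℝ] (V [⋀^Fin (k + 2)]→L[ℝ] ℝ) :=
  LinearMap.mk₂ ℝ (fun Ω α => lefschetz Ω α)
    (fun Ω Ω' α => by
      rw [lefschetz, lefschetz, lefschetz, ← toDegree_add]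
      congr 1
      ext v
      simp [wedge_apply, add_mul, smul_add, Finset.sum_add_distrib, mul_add])
    (fun c Ω α => by
      rw [lefschetz, lefschetz, ← toDegree_smul]
      congr 1
      ext v
      simp [wedge_apply, Finset.mul_sum, Units.smul_def, mul_left_comm, mul_assoc])
    (fun Ω α β => by
      rw [lefschetz, lefschetz, lefschetz, ← toDegree_add]
      congr 1
      ext v
      simp [wedge_apply, smul_add, Finset.sum_add_distrib, mul_add])
    (fun c Ω α => by
      rw [lefschetz, lefschetz, ← toDegree_smul]
      congr 1
      ext v
      simp [wedge_apply, Finset.mul_sum, Units.smul_def, mul_left_comm, mul_assoc])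

@[simp] theorem lefschetzHom_apply {k : ℕ} (Ω : V [⋀^Fin 2]→L[ℝ] ℝ) (α : V [⋀^Fin k]→L[ℝ] ℝ) :
    lefschetzHom k Ω α = lefschetz Ω α := rfl

/-- The Lefschetz operator `α ↦ Ω ∧ α` on families. -/
def lef (Ω : V [⋀^Fin 2]→L[ℝ] ℝ) : Module.End ℝ (Forms V) where
  toFun α := ⟨fun k => match k with
    | 0 => 0
    | 1 => 0
    | k + 2 => lefschetz Ω (α k)⟩
  map_add' α β := by
    ext1 k
    match k with
    | 0 => exact (add_zero _).symm
    | 1 => exact (add_zero _).symm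
    | k + 2 => exact map_add (lefschetzHom k Ω) (α k) (β k)
  map_smul' c α := by
    ext1 k
    match k with
    | 0 => exact (smul_zero c).symm
    | 1 => exact (smul_zero c).symm
    | k + 2 => exact map_smul (lefschetzHom k Ω) c (α k)

@[simp] theorem lef_zero (Ω : V [⋀^Fin 2]→L[ℝ] ℝ) (α : Forms V) : lef Ω α 0 = 0 := rfl
@[simp] theorem lef_one (Ω : V [⋀^Fin 2]→L[ℝ] ℝ) (α : Forms V) : lef Ω α 1 = 0 := rfl
@[simp] theorem lef_add_two (Ω : V [⋀^Fin 2]→L[ℝ] ℝ) (α : Forms V) (k : ℕ) :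
    lef Ω α (k + 2) = lefschetz Ω (α k) := rfl

theorem lef_single (Ω : V [⋀^Fin 2]→L[ℝ] ℝ) (k : ℕ) (α : V [⋀^Fin k]→L[ℝ] ℝ) :
    lef Ω (single k α) = single (k + 2) (lefschetz Ω α) := by
  ext1 l
  match l with
  | 0 => rw [single_of_ne (by omega)]; rfl
  | 1 => rw [single_of_ne (by omega)]; rfl
  | l + 2 =>
    by_cases h : l = k
    · subst h; simp
    · rw [lef_add_two, single_of_ne h, single_of_ne (show l + 2 ≠ k + 2 by omega)]
      exact map_zero (lefschetzHom l Ω)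

theorem lef_sum_smul {κ : Type*} (s : Finset κ) (c : κ → ℝ) (f : κ → V [⋀^Fin 2]→L[ℝ] ℝ) :
    lef (∑ i ∈ s, c i • f i) = ∑ i ∈ s, c i • lef (f i) := by
  ext1 α
  ext1 k
  rw [LinearMap.sum_apply, Forms.sum_apply]
  match k with
  | 0 => simp
  | 1 => simp
  | k + 2 =>
    rw [lef_add_two, ← lefschetzHom_apply, map_sum, LinearMap.sum_apply]
    exact Finset.sum_congr rfl fun i _ => by rw [map_smul]; rfl

theorem single_decomposable_cast {k l : ℕ} (h : l = k) (ζ : Fin k → V →L[ℝ] ℝ) :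
    single k (decomposable k ζ) = single l (decomposable l (fun a => ζ (Fin.cast h a))) := by
  subst h; rfl

theorem lef_decomposable_two (ξ η : V →L[ℝ] ℝ) (k : ℕ) (ζ : Fin k → V →L[ℝ] ℝ) :
    lef (decomposable 2 ![ξ, η]) (single k (decomposable k ζ)) =
      eps ξ (eps η (single k (decomposable k ζ))) := by
  rw [lef_single, lefschetz, single_toDegree (by omega), wedge_decomposable,
    single_decomposable_cast (show k + 2 = 2 + k by omega), single_decomposable_succ,
    single_decomposable_succ]
  have h0 : Fin.append ![ξ, η] ζ (Fin.cast (show k + 2 = 2 + k by omega) 0) = ξ := by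
    have : Fin.cast (show k + 2 = 2 + k by omega) 0 = Fin.castAdd k (0 : Fin 2) := by
      ext; simp
    rw [this, Fin.append_left]; rfl
  have h1 : Fin.append ![ξ, η] ζ (Fin.cast (show k + 2 = 2 + k by omega) (Fin.succ 0)) = η := by
    have : Fin.cast (show k + 2 = 2 + k by omega) (Fin.succ 0) = Fin.castAdd k (1 : Fin 2) := by
      ext; simp
    rw [this, Fin.append_left]; rfl
  have h2 : ∀ a : Fin k, Fin.append ![ξ, η] ζ
      (Fin.cast (show k + 2 = 2 + k by omega) (Fin.succ (Fin.succ a))) = ζ a := fun a => by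
    have : Fin.cast (show k + 2 = 2 + k by omega) (Fin.succ (Fin.succ a)) = Fin.natAdd 2 a := by
      ext; simp; omega
    rw [this, Fin.append_right]
  simp only [Fin.tail, h0, h1]
  congr 4
  funext a
  exact h2 a

theorem lefschetzPow_eq (Ω : V [⋀^Fin 2]→L[ℝ] ℝ) {k : ℕ} (r : ℕ) (α : V [⋀^Fin k]→L[ℝ] ℝ) :
    (lef Ω ^ r) (single k α) = single (k + 2 * r) (lefschetzPow Ω r α) := by
  induction r with
  | zero => rfl
  | succ r ih => rw [pow_succ', Module.End.mul_apply, ih, lef_single]; rfl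

theorem single_formPow (Ω : V [⋀^Fin 2]→L[ℝ] ℝ) (n : ℕ) :
    single (2 * n) (formPow Ω n) = (lef Ω ^ n) (single 0 (oneForm V)) := by
  rw [formPow, single_toDegree (by omega), lefschetzPow_eq]
  rfl

end Wedge

section WedgeBasis

variable {V : Type*} [AddCommGroup V] [Module ℝ V] [TopologicalSpace V]
  [IsTopologicalAddGroup V] [ContinuousSMul ℝ V] [T2Space V] {ι : Type*} [Fintype ι]

/-- Linear maps agree if they agree on exterior products of covectors. -/
theorem hom_ext_decomposable (e : Module.Basis ι ℝ V) {W : Type*} [AddCommGroup W] [Module ℝ W]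
    {A B : Forms V →ₗ[ℝ] W}
    (h : ∀ k ζ, A (single k (decomposable k ζ)) = B (single k (decomposable k ζ))) : A = B := by
  ext1 α
  rw [eq_sum_single e α, map_sum, map_sum]
  refine Finset.sum_congr rfl fun k _ => ?_
  rw [eq_sum_decomposable e (α k)]
  simp only [map_sum, map_smul, h]

theorem lef_eq_sum (e : Module.Basis ι ℝ V) (Ω : V [⋀^Fin 2]→L[ℝ] ℝ) :
    lef Ω = (2 : ℝ)⁻¹ • ∑ i, ∑ j, Ω ![e i, e j] • (eps (dualCov e i) * eps (dualCov e j)) := by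
  have h2 : ∀ ξ η : V →L[ℝ] ℝ, lef (decomposable 2 ![ξ, η]) = eps ξ * eps η := fun ξ η =>
    hom_ext_decomposable e fun k ζ => lef_decomposable_two ξ η k ζ
  conv_lhs => rw [eq_sum_decomposable e Ω]
  rw [lef_sum_smul, ← (finTwoArrowEquiv ι).symm.sum_comp, Fintype.sum_prod_type,
    Finset.smul_sum]
  refine Finset.sum_congr rfl fun i _ => ?_
  rw [Finset.smul_sum]
  refine Finset.sum_congr rfl fun j _ => ?_
  have h3 : (fun a => dualCov e ((finTwoArrowEquiv ι).symm (i, j) a)) =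
      ![dualCov e i, dualCov e j] := by
    funext a; fin_cases a <;> rfl
  have h4 : (fun a => e ((finTwoArrowEquiv ι).symm (i, j) a)) = ![e i, e j] := by
    funext a; fin_cases a <;> rfl
  rw [h3, h4, h2, smul_smul]
  simp

theorem lef_mul_eps (e : Module.Basis ι ℝ V) (Ω : V [⋀^Fin 2]→L[ℝ] ℝ) (ξ : V →L[ℝ] ℝ) :
    lef Ω * eps ξ = eps ξ * lef Ω := by
  rw [lef_eq_sum e]
  simp only [smul_mul_assoc, mul_smul_comm, Finset.sum_mul, Finset.mul_sum]
  congr 1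
  refine Finset.sum_congr rfl fun i _ => Finset.sum_congr rfl fun j _ => ?_
  congr 1
  rw [mul_assoc, eps_mul_eps _ ξ, mul_neg, ← mul_assoc, eps_mul_eps _ ξ, neg_mul, neg_neg,
    mul_assoc]

end WedgeBasis

/-! ### The musical isomorphism of a bilinear form -/

section Sharp

variable {V : Type*} [AddCommGroup V] [Module ℝ V] [TopologicalSpace V]
  {ι : Type*} [Fintype ι] [DecidableEq ι]

/-- The vector dual to a covector, `ξ^# = B^{ij} ξ_j e_i`; then `B(v, ξ^#) = ξ(v)`. -/
def sharp (e : Module.Basis ι ℝ V) (B : V → V → ℝ) (ξ : V →L[ℝ] ℝ) : V :=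
  ∑ i, (∑ j, (gram e B)⁻¹ i j * ξ (e j)) • e i

theorem sharp_eq_sum (e : Module.Basis ι ℝ V) (B : V → V → ℝ) (ξ : V →L[ℝ] ℝ) :
    sharp e B ξ = ∑ j, ξ (e j) • ∑ i, (gram e B)⁻¹ i j • e i := by
  simp only [sharp, Finset.sum_smul, Finset.smul_sum, smul_smul]
  rw [Finset.sum_comm]
  simp only [mul_comm]

theorem gram_isUnit (e : Module.Basis ι ℝ V) (B : V →ₗ[ℝ] V →ₗ[ℝ] ℝ)
    (hB : ∀ u, (∀ v, B v u = 0) → u = 0) : IsUnit (gram e fun u v => B u v).det := by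
  rw [← Matrix.isUnit_iff_isUnit_det, ← Matrix.mulVec_injective_iff_isUnit]
  intro c c' h
  rw [← sub_eq_zero, ← Matrix.mulVec_sub] at h
  have h2 : ∑ j, (c - c') j • e j = 0 := by
    refine hB _ fun v => ?_
    rw [← e.sum_repr v, map_sum B, LinearMap.sum_apply]
    refine Finset.sum_eq_zero fun i _ => ?_
    have h3 := congrFun h i
    simp only [Matrix.mulVec, dotProduct, gram, Matrix.of_apply, Pi.zero_apply] at h3
    rw [map_smul, LinearMap.smul_apply, map_sum]
    simp only [map_smul, smul_eq_mul]
    rw [show ∑ x, (c - c') x * (B (e i)) (e x) = 0 by rw [← h3]; simp only [mul_comm], mul_zero]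
  have h4 := Fintype.linearIndependent_iff.mp e.linearIndependent _ h2
  rw [← sub_eq_zero]
  exact funext h4

theorem apply_sharp (e : Module.Basis ι ℝ V) (B : V →ₗ[ℝ] V →ₗ[ℝ] ℝ)
    (hB : IsUnit (gram e fun u v => B u v).det) (ξ : V →L[ℝ] ℝ) (v : V) :
    B v (sharp e (fun u v => B u v) ξ) = ξ v := by
  have key : ∀ k, B (e k) (sharp e (fun u v => B u v) ξ) = ξ (e k) := by
    intro k
    have h := Matrix.mul_nonsing_inv _ hB
    rw [sharp, map_sum]
    simp only [map_smul, smul_eq_mul, Finset.sum_mul]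
    rw [Finset.sum_comm]
    have h2 : ∀ j, ∑ i, (gram e fun u v => B u v)⁻¹ i j * ξ (e j) * B (e k) (e i) =
        (if k = j then 1 else 0) * ξ (e j) := by
      intro j
      rw [← Matrix.one_apply, ← h, Matrix.mul_apply, Finset.sum_mul]
      refine Finset.sum_congr rfl fun i _ => ?_
      simp only [gram, Matrix.of_apply]
      ring
    simp only [h2]
    simp
  rw [← e.sum_repr v, map_sum, map_sum, LinearMap.sum_apply]
  refine Finset.sum_congr rfl fun k _ => ?_
  rw [map_smul, LinearMap.smul_apply, key, map_smul]

theorem sharp_unique (e : Module.Basis ι ℝ V) (B : V →ₗ[ℝ] V →ₗ[ℝ] ℝ)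
    (hB : ∀ u, (∀ v, B v u = 0) → u = 0) (ξ : V →L[ℝ] ℝ) {u : V} (hu : ∀ v, B v u = ξ v) :
    sharp e (fun u v => B u v) ξ = u := by
  rw [← sub_eq_zero]
  refine hB _ fun v => ?_
  rw [map_sub, apply_sharp e B (gram_isUnit e B hB), hu, sub_self]

end Sharp

/-! ### The star operator on exterior products -/

section Star

variable {V : Type*} [AddCommGroup V] [Module ℝ V] [TopologicalSpace V]

theorem contract_zero {N : ℕ} (h : 0 + N = N) (η : V [⋀^Fin N]→L[ℝ] ℝ) (u : Fin 0 → V) :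
    contract h η u = η := by
  ext v
  have : ∀ (M : ℕ) (h' : 0 + N = M) (θ : V [⋀^Fin M]→L[ℝ] ℝ),
      (h' ▸ θ : V [⋀^Fin (0 + N)]→L[ℝ] ℝ) (Fin.append u v) =
        θ (fun a => v (Fin.cast (by omega) a)) := by
    intro M h' θ
    subst h'
    congr 1
    funext a
    have : a = Fin.natAdd 0 (Fin.cast (by omega) a : Fin N) := by ext; simp
    conv_lhs => rw [this, Fin.append_right]
  exact this N h η

/-- `contract h η (u₀, …, u_k) = ι(u_k) ⋯ ι(u₀) η`. -/
theorem contract_succ {N k l : ℕ} (h : k + 1 + l = N + 1) (h' : k + l = N)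
    (η : V [⋀^Fin (N + 1)]→L[ℝ] ℝ) (u : Fin (k + 1) → V) :
    contract h η u = contract h' (contr (u 0) η) (Fin.tail u) := by
  subst h'
  ext v
  have : ∀ (M : ℕ) (h₁ : k + 1 + l = M) (h₂ : M = k + l + 1) (θ : V [⋀^Fin M]→L[ℝ] ℝ),
      (h₁ ▸ θ : V [⋀^Fin (k + 1 + l)]→L[ℝ] ℝ) (Fin.append u v) =
        (h₂ ▸ θ : V [⋀^Fin (k + l + 1)]→L[ℝ] ℝ)
          (Fin.cons (u 0) (Fin.append (Fin.tail u) v)) := by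
    intro M h₁ h₂ θ
    subst h₂
    have h3 : ∀ (M' : ℕ) (h₁ : M' = k + l + 1) (w : Fin M' → V),
        (h₁ ▸ θ : V [⋀^Fin M']→L[ℝ] ℝ) w = θ (fun a => w (Fin.cast h₁.symm a)) := by
      intro M' h₁ w
      subst h₁
      rfl
    rw [h3 _ h₁]
    congr 1
    conv_lhs => rw [← Fin.cons_self_tail u, Fin.append_cons]
    rfl
  exact this _ h rfl η

/-- Iterated contraction: `iotas k u = ι(u_{k-1}) ⋯ ι(u₀)`. -/
def iotas : (k : ℕ) → (Fin k → V) → Module.End ℝ (Forms V)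
  | 0, _ => 1
  | k + 1, u => iotas k (Fin.tail u) * iota (u 0)

theorem iotas_mul_iota (k : ℕ) (u : Fin k → V) (w : V) :
    iotas k u * iota w = (-1 : ℝ) ^ k • (iota w * iotas k u) := by
  induction k with
  | zero => simp [iotas]
  | succ k ih =>
    rw [iotas, mul_assoc, iota_mul_iota, mul_neg, ← mul_assoc, ih, smul_mul_assoc, mul_assoc,
      pow_succ, mul_neg_one, neg_smul]

theorem iota_single (u : V) {N : ℕ} (η : V [⋀^Fin (N + 1)]→L[ℝ] ℝ) :
    iota u (single (N + 1) η) = single N (contr u η) := by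
  ext1 l
  by_cases h : l = N
  · subst h; simp
  · rw [iota_apply, single_of_ne h, single_of_ne (by omega), map_zero]

theorem single_contract {N k l : ℕ} (h : k + l = N) (η : V [⋀^Fin N]→L[ℝ] ℝ) (u : Fin k → V) :
    single l (contract h η u) = iotas k u (single N η) := by
  induction k generalizing N with
  | zero =>
    obtain rfl : N = l := by omega
    rw [contract_zero]
    rfl
  | succ k ih =>
    obtain ⟨N, rfl⟩ : ∃ N', N = N' + 1 := ⟨N - 1, by omega⟩
    rw [contract_succ h (by omega), ih, iotas, Module.End.mul_apply, iota_single]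

theorem contract_apply {N k l : ℕ} (h : k + l = N) (η : V [⋀^Fin N]→L[ℝ] ℝ) (u : Fin k → V)
    (v : Fin l → V) : contract h η u v = η (fun a => Fin.append u v (Fin.cast h.symm a)) := by
  subst h; rfl

variable {ι : Type*} [Fintype ι] [DecidableEq ι]

theorem star_add (e : Module.Basis ι ℝ V) (B : V → V → ℝ) {N : ℕ} (vol : V [⋀^Fin N]→L[ℝ] ℝ)
    {k : ℕ} (l : ℕ) (α β : V [⋀^Fin k]→L[ℝ] ℝ) :
    star e B vol l (α + β) = star e B vol l α + star e B vol l β := by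
  unfold star
  split_ifs
  · simp [mul_add, add_smul, Finset.sum_add_distrib]
  · simp

theorem star_smul (e : Module.Basis ι ℝ V) (B : V → V → ℝ) {N : ℕ} (vol : V [⋀^Fin N]→L[ℝ] ℝ)
    {k : ℕ} (l : ℕ) (c : ℝ) (α : V [⋀^Fin k]→L[ℝ] ℝ) :
    star e B vol l (c • α) = c • star e B vol l α := by
  unfold star
  split_ifs
  · rw [smul_comm]
    congr 1
    simp only [Finset.smul_sum, smul_smul, ContinuousAlternatingMap.smul_apply, smul_eq_mul,
      mul_left_comm]
  · simp

/-- The star operator on families. -/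
def starL (e : Module.Basis ι ℝ V) (B : V → V → ℝ) {N : ℕ} (vol : V [⋀^Fin N]→L[ℝ] ℝ) :
    Module.End ℝ (Forms V) where
  toFun α := ⟨fun l => star e B vol l (α (N - l))⟩
  map_add' α β := by ext1 l; exact star_add e B vol l _ _
  map_smul' c α := by ext1 l; exact star_smul e B vol l _ _

theorem starL_apply (e : Module.Basis ι ℝ V) (B : V → V → ℝ) {N : ℕ} (vol : V [⋀^Fin N]→L[ℝ] ℝ)
    (α : Forms V) (l : ℕ) : starL e B vol α l = star e B vol l (α (N - l)) := rfl

theorem star_of_ne (e : Module.Basis ι ℝ V) (B : V → V → ℝ) {N : ℕ} (vol : V [⋀^Fin N]→L[ℝ] ℝ)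
    {k l : ℕ} (h : k + l ≠ N) (α : V [⋀^Fin k]→L[ℝ] ℝ) : star e B vol l α = 0 := by
  simp [star, h]

theorem star_zero (e : Module.Basis ι ℝ V) (B : V → V → ℝ) {N : ℕ} (vol : V [⋀^Fin N]→L[ℝ] ℝ)
    {k : ℕ} (l : ℕ) : star e B vol l (0 : V [⋀^Fin k]→L[ℝ] ℝ) = 0 := by
  unfold star
  split_ifs <;> simp

theorem starL_single_apply (e : Module.Basis ι ℝ V) (B : V → V → ℝ) {N : ℕ}
    (vol : V [⋀^Fin N]→L[ℝ] ℝ) {k : ℕ} (α : V [⋀^Fin k]→L[ℝ] ℝ) (l : ℕ) :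
    starL e B vol (single k α) l = star e B vol l α := by
  rw [starL_apply]
  by_cases h : N - l = k
  · subst h; rw [single_same]
  · rw [single_of_ne h, star_zero, star_of_ne]
    omega

theorem starL_single (e : Module.Basis ι ℝ V) (B : V → V → ℝ) {N : ℕ}
    (vol : V [⋀^Fin N]→L[ℝ] ℝ) {k : ℕ} (α : V [⋀^Fin k]→L[ℝ] ℝ) :
    starL e B vol (single k α) = single (N - k) (star e B vol (N - k) α) := by
  ext1 l
  rw [starL_single_apply]
  by_cases h : l = N - k
  · subst h; rw [single_same]
  · rw [single_of_ne h, star_of_ne]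
    omega

/-- Iterated contraction is multilinear in the contracted vectors. -/
theorem contract_map_sum {N k l : ℕ} (h : k + l = N) (η : V [⋀^Fin N]→L[ℝ] ℝ)
    (c : Fin k → ι → ℝ) (e : ι → V) :
    ∑ I : Fin k → ι, (∏ a, c a (I a)) • contract h η (fun a => e (I a)) =
      contract h η (fun a => ∑ i, c a i • e i) := by
  ext v
  rw [ContinuousAlternatingMap.sum_apply]
  subst h
  simp only [ContinuousAlternatingMap.smul_apply, contract_apply, Fin.cast_refl]
  have key : ∀ u : Fin k → V, η (fun a => Fin.append u v a) =
      (η.toMultilinearMap.domDomCongr finSumFinEquiv.symm).currySum u v := by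
    intro u
    rw [MultilinearMap.currySum_apply, MultilinearMap.domDomCongr_apply]
    refine congrArg η (funext fun a => ?_)
    refine Fin.addCases (fun i => ?_) (fun i => ?_) a <;> simp
  simp only [id, key]
  rw [MultilinearMap.map_sum, sum_apply]
  refine Finset.sum_congr rfl fun I _ => ?_
  rw [MultilinearMap.map_smul_univ _ (fun a => c a (I a)) (fun a => e (I a))]
  rfl

theorem contract_perm {N k l : ℕ} (h : k + l = N) (η : V [⋀^Fin N]→L[ℝ] ℝ) (u : Fin k → V)
    (σ : Equiv.Perm (Fin k)) :
    contract h η (fun a => u (σ a)) = Equiv.Perm.sign σ • contract h η u := by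
  subst h
  ext v
  have h1 : ∀ w : Fin k → V, contract rfl η w v = η (Fin.append w v) := fun w => rfl
  have h2 : (Fin.append (fun a => u (σ a)) v : Fin (k + l) → V) =
      (Fin.append u v) ∘ (finSumFinEquiv.permCongr (Equiv.Perm.sumCongr σ 1)) := by
    funext a
    refine Fin.addCases (fun i => ?_) (fun i => ?_) a <;> simp [Equiv.permCongr_apply]
  have h3 := η.toAlternatingMap.map_perm (Fin.append u v)
    (finSumFinEquiv.permCongr (Equiv.Perm.sumCongr σ 1))
  rw [Equiv.Perm.sign_permCongr, Equiv.Perm.sign_sumCongr, Equiv.Perm.sign_one, mul_one] at h3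
  rw [h1, h2]
  exact h3

theorem star_eq_contract {N k l : ℕ} (h : k + l = N) (e : Module.Basis ι ℝ V) (B : V → V → ℝ)
    (vol : V [⋀^Fin N]→L[ℝ] ℝ) (α : V [⋀^Fin k]→L[ℝ] ℝ) :
    star e B vol l α = (k.factorial : ℝ)⁻¹ • ∑ J : Fin k → ι, α (fun a => e (J a)) •
      contract h vol (fun a => ∑ i, (gram e B)⁻¹ i (J a) • e i) := by
  rw [star, dif_pos h, Finset.sum_comm]
  congr 1
  refine Finset.sum_congr rfl fun J _ => ?_
  rw [← contract_map_sum h vol (fun a i => (gram e B)⁻¹ i (J a)) e, Finset.smul_sum]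
  refine Finset.sum_congr rfl fun I _ => ?_
  rw [smul_smul, mul_comm]

/-- The star of an exterior product of covectors contracts the volume form with the dual
vectors. -/
theorem star_decomposable {N k l : ℕ} (h : k + l = N) (e : Module.Basis ι ℝ V) (B : V → V → ℝ)
    (vol : V [⋀^Fin N]→L[ℝ] ℝ) (ζ : Fin k → V →L[ℝ] ℝ) :
    star e B vol l (decomposable k ζ) = contract h vol (fun a => sharp e B (ζ a)) := by
  rw [star_eq_contract h]
  simp only [decomposable_apply, Matrix.det_apply, Matrix.of_apply, Finset.sum_smul]
  rw [Finset.sum_comm]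
  have key : ∀ σ : Equiv.Perm (Fin k), ∑ J : Fin k → ι,
      (Equiv.Perm.sign σ • ∏ a, ζ (σ a) (e (J a))) •
        contract h vol (fun a => ∑ i, (gram e B)⁻¹ i (J a) • e i) =
      contract h vol (fun a => sharp e B (ζ a)) := by
    intro σ
    simp only [smul_assoc]
    rw [← Finset.smul_sum, contract_map_sum h vol (fun a j => ζ (σ a) (e j))
      (fun j => ∑ i, (gram e B)⁻¹ i j • e i)]
    simp only [← sharp_eq_sum]
    rw [contract_perm h vol (fun a => sharp e B (ζ a)), smul_smul, Int.units_mul_self, one_smul]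
  simp only [key]
  rw [Finset.sum_const, Finset.card_univ, Fintype.card_perm, Fintype.card_fin,
    ← Nat.cast_smul_eq_nsmul ℝ, smul_smul, inv_mul_cancel₀ (by positivity), one_smul]

theorem starL_one (e : Module.Basis ι ℝ V) (B : V → V → ℝ) {N : ℕ} (vol : V [⋀^Fin N]→L[ℝ] ℝ) :
    starL e B vol (single 0 (oneForm V)) = single N vol := by
  have h := star_decomposable (zero_add N) e B vol (fun i => i.elim0)
  rw [contract_zero] at h
  rw [starL_single, Nat.sub_zero]
  exact congrArg _ h

theorem starL_decomposable (e : Module.Basis ι ℝ V) (B : V → V → ℝ) {N : ℕ}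
    (vol : V [⋀^Fin N]→L[ℝ] ℝ) {k : ℕ} (hk : k ≤ N) (ζ : Fin k → V →L[ℝ] ℝ) :
    starL e B vol (single k (decomposable k ζ)) =
      iotas k (fun a => sharp e B (ζ a)) (single N vol) := by
  rw [starL_single, star_decomposable (by omega), single_contract]

theorem iotas_single_of_lt {N k : ℕ} (h : N < k) (u : Fin k → V) (η : V [⋀^Fin N]→L[ℝ] ℝ) :
    iotas k u (single N η) = 0 := by
  induction k generalizing N with
  | zero => omega
  | succ k ih =>
    rw [iotas, Module.End.mul_apply]
    cases N with
    | zero =>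
      have : iota (u 0) (single 0 η) = 0 := by
        ext1 l
        rw [iota_apply, single_of_ne (by omega), map_zero, Forms.zero_apply]
      rw [this, map_zero]
    | succ N => rw [iota_single, ih (by omega)]

/-- The sign operator `(-1)^k` on `k`-forms. -/
def parity : Module.End ℝ (Forms V) := diag fun k => (-1) ^ k

end Star

section StarBasis

variable {V : Type*} [AddCommGroup V] [Module ℝ V] [TopologicalSpace V]
  [IsTopologicalAddGroup V] [ContinuousSMul ℝ V] [T2Space V] {ι : Type*} [Fintype ι]
  [DecidableEq ι]

/-- The star operator turns exterior multiplication by `ξ` into contraction with `ξ^#`. -/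
theorem starL_mul_eps (e : Module.Basis ι ℝ V) (B : V → V → ℝ) {N : ℕ}
    (vol : V [⋀^Fin N]→L[ℝ] ℝ) (ξ : V →L[ℝ] ℝ) :
    starL e B vol * eps ξ = iota (sharp e B ξ) * starL e B vol * parity := by
  refine hom_ext_decomposable e fun k ζ => ?_
  have hz : ∀ k : ℕ, N < k → ∀ θ : V [⋀^Fin k]→L[ℝ] ℝ, starL e B vol (single k θ) = 0 := by
    intro k hk θ
    ext1 l
    rw [starL_single_apply, star_of_ne _ _ _ (by omega), Forms.zero_apply]
  simp only [Module.End.mul_apply, parity, diag_single, map_smul]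
  have h1 : eps ξ (single k (decomposable k ζ)) =
      single (k + 1) (decomposable (k + 1) (Fin.cons ξ ζ)) := by
    rw [single_decomposable_succ, Fin.cons_zero, Fin.tail_cons]
  rw [h1]
  by_cases hk : k ≤ N
  · have h2 : starL e B vol (single (k + 1) (decomposable (k + 1) (Fin.cons ξ ζ))) =
        iotas (k + 1) (Fin.cons (sharp e B ξ) fun a => sharp e B (ζ a)) (single N vol) := by
      have h3 : (fun a => sharp e B ((Fin.cons ξ ζ : Fin (k + 1) → V →L[ℝ] ℝ) a)) =
          Fin.cons (sharp e B ξ) fun a => sharp e B (ζ a) := by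
        funext a
        refine Fin.cases ?_ (fun i => ?_) a <;> simp
      by_cases hk' : k + 1 ≤ N
      · rw [starL_decomposable e B vol hk', h3]
      · rw [hz _ (by omega), iotas_single_of_lt (by omega)]
    rw [h2, starL_decomposable e B vol hk, iotas, Fin.cons_zero, Fin.tail_cons, iotas_mul_iota]
    rfl
  · rw [hz _ (by omega), hz _ (by omega)]
    simp

end StarBasis

/-! ### The Lefschetz triple -/

section Grading

variable {V : Type*} [AddCommGroup V] [Module ℝ V] [TopologicalSpace V]

theorem diag_mul_lef (c : ℕ → ℝ) (Ω : V [⋀^Fin 2]→L[ℝ] ℝ) :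
    diag c * lef Ω = lef Ω * diag fun k => c (k + 2) := by
  ext1 α
  ext1 k
  match k with
  | 0 => simp
  | 1 => simp
  | k + 2 => exact (map_smul (lefschetzHom k Ω) (c (k + 2)) (α k)).symm

theorem parity_mul_parity : (parity * parity : Module.End ℝ (Forms V)) = 1 := by
  ext1 α
  ext1 k
  simp [parity, smul_smul, ← mul_pow]

theorem parity_mul_eps (ξ : V →L[ℝ] ℝ) : parity * eps ξ = -(eps ξ * parity) := by
  rw [parity, diag_mul_eps]
  ext1 α
  ext1 k
  cases k with
  | zero => simp
  | succ k =>
    simp only [Module.End.mul_apply, diag_apply, eps_succ, LinearMap.neg_apply,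
      Forms.neg_apply, pow_succ, map_smul]
    module

theorem parity_mul_lef (Ω : V [⋀^Fin 2]→L[ℝ] ℝ) : parity * lef Ω = lef Ω * parity := by
  rw [parity, diag_mul_lef]
  simp [pow_succ]

theorem parity_mul_iota (u : V) : parity * iota u = -(iota u * parity) := by
  ext1 α
  ext1 k
  simp only [Module.End.mul_apply, parity, diag_apply, iota_apply, LinearMap.neg_apply,
    Forms.neg_apply, pow_succ, map_smul]
  module

variable {ι : Type*} [Fintype ι] [DecidableEq ι]

theorem parity_mul_starL (e : Module.Basis ι ℝ V) (B : V → V → ℝ) {n : ℕ}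
    (vol : V [⋀^Fin (2 * n)]→L[ℝ] ℝ) :
    parity * starL e B vol = starL e B vol * parity := by
  ext1 α
  ext1 k
  simp only [Module.End.mul_apply, parity, diag_apply, starL_apply, star_smul]
  by_cases hk : k ≤ 2 * n
  · congr 1
    obtain ⟨j, hj⟩ : ∃ j, 2 * n = k + j := ⟨2 * n - k, by omega⟩
    rw [show 2 * n - k = j by omega]
    rcases Nat.even_or_odd k with h | h
    · have : Even j := by
        have : Even (k + j) := hj ▸ even_two_mul n
        exact (Nat.even_add.mp this).mp h
      rw [h.neg_one_pow, this.neg_one_pow]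
    · have : Odd j := by
        have : Even (k + j) := hj ▸ even_two_mul n
        rw [Nat.even_add, ← Nat.not_odd_iff_even, ← Nat.not_odd_iff_even] at this
        tauto
      rw [h.neg_one_pow, this.neg_one_pow]
  · rw [star_of_ne _ _ _ (by omega)]
    simp

/-- The sign `(-1)^{k(k+1)/2}` on `k`-forms. -/
def triSign : Module.End ℝ (Forms V) := diag fun k => (-1) ^ (k + 1).choose 2

theorem triSign_mul_eps (ξ : V →L[ℝ] ℝ) : triSign * eps ξ = -(eps ξ * triSign * parity) := by
  ext1 α
  ext1 k
  cases k with
  | zero => simp [triSign]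
  | succ k =>
    simp only [Module.End.mul_apply, triSign, parity, diag_apply, eps_succ, LinearMap.neg_apply,
      Forms.neg_apply, map_smul, smul_smul]
    rw [Nat.choose_succ_succ' (k + 1) 1, Nat.choose_one_right, pow_add, pow_succ]
    module

theorem triSign_mul_iota (u : V) : triSign * iota u = iota u * triSign * parity := by
  ext1 α
  ext1 k
  simp only [Module.End.mul_apply, triSign, parity, diag_apply, iota_apply, map_smul, smul_smul]
  congr 1
  rw [Nat.choose_succ_succ' (k + 1) 1, Nat.choose_one_right, pow_add, mul_right_comm, ← mul_pow]
  simp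

theorem parity_mul_triSign : (parity * triSign : Module.End ℝ (Forms V)) = triSign * parity := by
  rw [parity, triSign, diag_mul_diag, diag_mul_diag]
  simp only [mul_comm]

end Grading

section Symplectic

variable {V : Type*} [AddCommGroup V] [Module ℝ V] [TopologicalSpace V]

/-- A `2`-form as a bilinear map. -/
def bil (Ω : V [⋀^Fin 2]→L[ℝ] ℝ) : V →ₗ[ℝ] V →ₗ[ℝ] ℝ :=
  LinearMap.mk₂ ℝ (fun u v => Ω ![u, v])
    (fun u u' v => Ω.vecCons_add ![v] u u')
    (fun c u v => Ω.vecCons_smul ![v] c u)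
    (fun u v v' => by
      have h := Ω.map_update_add ![u, v] 1 v v'
      have h2 : ∀ w, Function.update ![u, v] 1 w = ![u, w] := fun w => by
        funext a; fin_cases a <;> simp
      rwa [h2, h2, h2] at h)
    (fun c u v => by
      have h := Ω.map_update_smul ![u, v] 1 c v
      have h2 : ∀ w, Function.update ![u, v] 1 w = ![u, w] := fun w => by
        funext a; fin_cases a <;> simp
      rwa [h2, h2] at h)

theorem bil_apply (Ω : V [⋀^Fin 2]→L[ℝ] ℝ) (u v : V) : bil Ω u v = Ω ![u, v] := rfl

theorem two_form_swap (Ω : V [⋀^Fin 2]→L[ℝ] ℝ) (u v : V) : Ω ![u, v] = -Ω ![v, u] := by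
  have h := Ω.toAlternatingMap.map_swap ![v, u] (i := 0) (j := 1) (by simp)
  have h2 : ![v, u] ∘ ⇑(Equiv.swap (0 : Fin 2) 1) = ![u, v] := by
    funext a; fin_cases a <;> simp
  rw [h2] at h
  exact h

/-- Nondegeneracy of a `2`-form. -/
def Nondeg (Ω : V [⋀^Fin 2]→L[ℝ] ℝ) : Prop := ∀ u, (∀ v, Ω ![v, u] = 0) → u = 0

variable [IsTopologicalAddGroup V] [ContinuousSMul ℝ V] [T2Space V]
  {ι : Type*} [Fintype ι] [DecidableEq ι]

/-- The matrix of a `2`-form. -/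
abbrev gramΩ (e : Module.Basis ι ℝ V) (Ω : V [⋀^Fin 2]→L[ℝ] ℝ) : Matrix ι ι ℝ :=
  gram e fun u v => Ω ![u, v]

/-- The musical isomorphism of a `2`-form. -/
abbrev sharpΩ (e : Module.Basis ι ℝ V) (Ω : V [⋀^Fin 2]→L[ℝ] ℝ) (ξ : V →L[ℝ] ℝ) : V :=
  sharp e (fun u v => Ω ![u, v]) ξ

theorem Nondeg.isUnit {Ω : V [⋀^Fin 2]→L[ℝ] ℝ} (hΩ : Nondeg Ω) (e : Module.Basis ι ℝ V) :
    IsUnit (gramΩ e Ω).det := gram_isUnit e (bil Ω) hΩ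

theorem Nondeg.apply_sharp {Ω : V [⋀^Fin 2]→L[ℝ] ℝ} (hΩ : Nondeg Ω) (e : Module.Basis ι ℝ V)
    (ξ : V →L[ℝ] ℝ) (v : V) : Ω ![v, sharpΩ e Ω ξ] = ξ v :=
  SymplecticHodge.apply_sharp e (bil Ω) (hΩ.isUnit e) ξ v

theorem Nondeg.sharp_unique {Ω : V [⋀^Fin 2]→L[ℝ] ℝ} (hΩ : Nondeg Ω) (e : Module.Basis ι ℝ V)
    (ξ : V →L[ℝ] ℝ) {u : V} (hu : ∀ v, Ω ![v, u] = ξ v) : sharpΩ e Ω ξ = u :=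
  SymplecticHodge.sharp_unique e (bil Ω) hΩ ξ hu

theorem gramΩ_inv_swap (e : Module.Basis ι ℝ V) (Ω : V [⋀^Fin 2]→L[ℝ] ℝ) (i j : ι) :
    (gramΩ e Ω)⁻¹ i j = -(gramΩ e Ω)⁻¹ j i := by
  have h : (gramΩ e Ω).transpose = -gramΩ e Ω := by
    ext a b
    simp only [Matrix.transpose_apply, gram, Matrix.of_apply, Matrix.neg_apply]
    exact two_form_swap Ω _ _
  have h2 : (gramΩ e Ω)⁻¹.transpose = -(gramΩ e Ω)⁻¹ := by
    rw [Matrix.transpose_nonsing_inv, h]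
    by_cases hu : IsUnit (gramΩ e Ω).det
    · apply Matrix.inv_eq_left_inv
      rw [neg_mul_neg, Matrix.nonsing_inv_mul _ hu]
    · have hu' : ¬ IsUnit (-gramΩ e Ω).det := by
        rw [Matrix.det_neg]
        simpa [isUnit_iff_ne_zero] using hu
      rw [Matrix.nonsing_inv_apply_not_isUnit _ hu, Matrix.nonsing_inv_apply_not_isUnit _ hu',
        neg_zero]
  have h3 := congrFun (congrFun h2 j) i
  simpa using h3

/-- The dual Lefschetz operator `Λ = ½ ω^{ij} ι(e_i) ι(e_j)`. -/
def lam (e : Module.Basis ι ℝ V) (Ω : V [⋀^Fin 2]→L[ℝ] ℝ) : Module.End ℝ (Forms V) :=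
  (2 : ℝ)⁻¹ • ∑ i, ∑ j, (gramΩ e Ω)⁻¹ i j • (iota (e i) * iota (e j))

theorem iota_sharp (e : Module.Basis ι ℝ V) (B : V → V → ℝ) (ξ : V →L[ℝ] ℝ) :
    iota (sharp e B ξ) = ∑ i, ∑ j, ((gram e B)⁻¹ i j * ξ (e j)) • iota (e i) := by
  rw [sharp, iota_sum]
  refine Finset.sum_congr rfl fun i _ => ?_
  rw [iota_smul, Finset.sum_smul]

theorem repr_sharp (e : Module.Basis ι ℝ V) (B : V → V → ℝ) (ξ : V →L[ℝ] ℝ) (i : ι) :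
    e.repr (sharp e B ξ) i = ∑ j, (gram e B)⁻¹ i j * ξ (e j) := by
  rw [sharp, e.repr_sum_self]

/-- `[Λ, ξ ∧ ·] = ι(ξ^#)`. -/
theorem lam_mul_eps (e : Module.Basis ι ℝ V) (Ω : V [⋀^Fin 2]→L[ℝ] ℝ) (ξ : V →L[ℝ] ℝ) :
    lam e Ω * eps ξ = eps ξ * lam e Ω + iota (sharpΩ e Ω ξ) := by
  have h1 : ∀ i j, iota (e i) * iota (e j) * eps ξ = eps ξ * (iota (e i) * iota (e j)) +
      (ξ (e j) • iota (e i) - ξ (e i) • iota (e j)) := by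
    intro i j
    rw [mul_assoc, iota_mul_eps, mul_sub, ← mul_assoc, iota_mul_eps, sub_mul, mul_smul_comm,
      mul_one, smul_mul_assoc, one_mul, mul_assoc]
    abel
  have h2 : ∑ i, ∑ j, (gramΩ e Ω)⁻¹ i j • (ξ (e j) • iota (e i) - ξ (e i) • iota (e j)) =
      (2 : ℝ) • iota (sharpΩ e Ω ξ) := by
    simp only [smul_sub, Finset.sum_sub_distrib]
    have h3 : ∑ i, ∑ j, (gramΩ e Ω)⁻¹ i j • ξ (e i) • iota (e j) =
        -∑ i, ∑ j, (gramΩ e Ω)⁻¹ i j • ξ (e j) • iota (e i) := by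
      rw [Finset.sum_comm, ← Finset.sum_neg_distrib]
      refine Finset.sum_congr rfl fun i _ => ?_
      rw [← Finset.sum_neg_distrib]
      refine Finset.sum_congr rfl fun j _ => ?_
      rw [gramΩ_inv_swap, neg_smul]
    rw [h3, sub_neg_eq_add, ← two_smul ℝ, iota_sharp]
    simp only [smul_smul]
  simp only [lam, smul_mul_assoc, mul_smul_comm, Finset.sum_mul, Finset.mul_sum, h1, smul_add,
    Finset.sum_add_distrib, h2, smul_smul]
  norm_num

/-- `[L, ι(u)] = ξ ∧ ·` for the covector `ξ = ω(·, u)`. -/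
theorem lef_mul_iota (e : Module.Basis ι ℝ V) (Ω : V [⋀^Fin 2]→L[ℝ] ℝ) {ξ : V →L[ℝ] ℝ} {u : V}
    (h : ∀ v, Ω ![v, u] = ξ v) : lef Ω * iota u = iota u * lef Ω + eps ξ := by
  have h1 : ∀ i j, eps (dualCov e i) * eps (dualCov e j) * iota u =
      iota u * (eps (dualCov e i) * eps (dualCov e j)) +
        (e.repr u j • eps (dualCov e i) - e.repr u i • eps (dualCov e j)) := by
    intro i j
    have h2 : ∀ k, eps (dualCov e k) * iota u =
        e.repr u k • (1 : Module.End ℝ (Forms V)) - iota u * eps (dualCov e k) := fun k => by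
      rw [iota_mul_eps, dualCov_apply, sub_sub_cancel]
    rw [mul_assoc, h2, mul_sub, ← mul_assoc, h2, sub_mul, mul_smul_comm, mul_one, smul_mul_assoc,
      one_mul, mul_assoc]
    abel
  have h2 : ∑ i, ∑ j, Ω ![e i, e j] • (e.repr u j • eps (dualCov e i) -
      e.repr u i • eps (dualCov e j)) = (2 : ℝ) • eps ξ := by
    simp only [smul_sub, Finset.sum_sub_distrib]
    have h3 : ∑ i, ∑ j, Ω ![e i, e j] • e.repr u i • eps (dualCov e j) =
        -∑ i, ∑ j, Ω ![e i, e j] • e.repr u j • eps (dualCov e i) := by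
      rw [Finset.sum_comm, ← Finset.sum_neg_distrib]
      refine Finset.sum_congr rfl fun i _ => ?_
      rw [← Finset.sum_neg_distrib]
      refine Finset.sum_congr rfl fun j _ => ?_
      rw [two_form_swap, neg_smul]
    rw [h3, sub_neg_eq_add, ← two_smul ℝ, cov_eq_sum e ξ, eps_sum]
    congr 1
    refine Finset.sum_congr rfl fun i _ => ?_
    rw [eps_smul, ← h (e i), ← bil_apply]
    conv_rhs => rw [← e.sum_repr u, map_sum, Finset.sum_smul]
    refine Finset.sum_congr rfl fun j _ => ?_
    rw [map_smul, smul_smul, smul_eq_mul, mul_comm, bil_apply]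
  rw [lef_eq_sum e]
  simp only [smul_mul_assoc, mul_smul_comm, Finset.sum_mul, Finset.mul_sum, h1, smul_add,
    Finset.sum_add_distrib, h2, smul_smul]
  norm_num

theorem lam_mul_iota (e : Module.Basis ι ℝ V) (Ω : V [⋀^Fin 2]→L[ℝ] ℝ) (u : V) :
    lam e Ω * iota u = iota u * lam e Ω := by
  simp only [lam, smul_mul_assoc, mul_smul_comm, Finset.sum_mul, Finset.mul_sum]
  congr 1
  refine Finset.sum_congr rfl fun i _ => Finset.sum_congr rfl fun j _ => ?_
  congr 1
  rw [mul_assoc, iota_mul_iota _ u, mul_neg, ← mul_assoc, iota_mul_iota _ u, neg_mul, neg_neg,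
    mul_assoc]

theorem lam_oneForm (e : Module.Basis ι ℝ V) (Ω : V [⋀^Fin 2]→L[ℝ] ℝ) :
    lam e Ω (single 0 (oneForm V)) = 0 := by
  simp [lam, LinearMap.sum_apply, iota_oneForm]

theorem parity_mul_lam (e : Module.Basis ι ℝ V) (Ω : V [⋀^Fin 2]→L[ℝ] ℝ) :
    parity * lam e Ω = lam e Ω * parity := by
  simp only [lam, smul_mul_assoc, mul_smul_comm, Finset.sum_mul, Finset.mul_sum]
  congr 1
  refine Finset.sum_congr rfl fun i _ => Finset.sum_congr rfl fun j _ => ?_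
  rw [← mul_assoc, parity_mul_iota, neg_mul, mul_assoc, parity_mul_iota, mul_neg, neg_neg,
    mul_assoc]

/-- The weight operator `n - k` on `k`-forms. -/
def weight (n : ℕ) : Module.End ℝ (Forms V) := diag fun k => (n : ℝ) - k

theorem weight_mul_eps (n : ℕ) (ξ : V →L[ℝ] ℝ) :
    weight n * eps ξ = eps ξ * weight n - eps ξ := by
  ext1 α
  ext1 k
  cases k with
  | zero => simp [weight]
  | succ k =>
    simp only [weight, Module.End.mul_apply, diag_apply, eps_succ, LinearMap.sub_apply,
      Forms.sub_apply, map_smul, Nat.cast_succ]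
    module

/-- The commutator `[Λ, L] = n - k` on `k`-forms, in dimension `2n`. -/
theorem lam_mul_lef (e : Module.Basis ι ℝ V) {Ω : V [⋀^Fin 2]→L[ℝ] ℝ} (hΩ : Nondeg Ω) {n : ℕ}
    (hn : Fintype.card ι = 2 * n) : lam e Ω * lef Ω = lef Ω * lam e Ω + weight n := by
  rw [← sub_eq_zero]
  refine end_ext e (fun ξ => eps ξ) ?_ (fun ξ => ?_) fun ξ => by simp
  · have h1 : ∀ i j, lam e Ω (eps (dualCov e i) (eps (dualCov e j) (single 0 (oneForm V)))) =
        (gramΩ e Ω)⁻¹ j i • single 0 (oneForm V) := by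
      intro i j
      have h2 := LinearMap.congr_fun (lam_mul_eps e Ω (dualCov e i))
        (eps (dualCov e j) (single 0 (oneForm V)))
      have h3 := LinearMap.congr_fun (lam_mul_eps e Ω (dualCov e j)) (single 0 (oneForm V))
      have h4 := LinearMap.congr_fun (iota_mul_eps (sharpΩ e Ω (dualCov e i)) (dualCov e j))
        (single 0 (oneForm V))
      simp only [Module.End.mul_apply, LinearMap.add_apply, lam_oneForm, iota_oneForm, map_zero,
        add_zero, LinearMap.sub_apply, LinearMap.smul_apply, Module.End.one_apply, sub_zero]
        at h2 h3 h4
      rw [h2, h3, map_zero, zero_add, h4]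
      congr 1
      rw [dualCov_apply, repr_sharp]
      simp [Finsupp.single_apply]
    have h5 : ∑ i, ∑ j, Ω ![e i, e j] * (gramΩ e Ω)⁻¹ j i = 2 * n := by
      have h6 := congrArg Matrix.trace (Matrix.mul_nonsing_inv _ (hΩ.isUnit e))
      rw [Matrix.trace_one, hn] at h6
      simp only [Matrix.trace, Matrix.diag, Matrix.mul_apply] at h6
      push_cast at h6
      exact h6
    simp only [LinearMap.sub_apply, LinearMap.add_apply, Module.End.mul_apply, lam_oneForm,
      map_zero, zero_add, weight, diag_single, LinearMap.zero_apply]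
    rw [lef_eq_sum e]
    simp only [LinearMap.smul_apply, LinearMap.sum_apply, Module.End.mul_apply, map_smul, map_sum,
      h1, smul_smul, ← Finset.sum_smul, h5]
    simp
  · rw [sub_mul, mul_sub, add_mul, mul_add, mul_assoc, lef_mul_eps e, ← mul_assoc, lam_mul_eps,
      mul_assoc (lef Ω), lam_mul_eps, mul_add, ← mul_assoc (lef Ω), lef_mul_eps e,
      lef_mul_iota e Ω (hΩ.apply_sharp e ξ), weight_mul_eps, add_mul]
    simp only [mul_assoc]
    abel

end Symplectic

/-! ### The symplectic star operator as a Weyl element -/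

section Weyl

variable {V : Type*} [AddCommGroup V] [Module ℝ V] [TopologicalSpace V]
  [IsTopologicalAddGroup V] [ContinuousSMul ℝ V] [T2Space V]
  {ι : Type*} [Fintype ι] [DecidableEq ι]

theorem lef_pow_apply_of_lt (Ω : V [⋀^Fin 2]→L[ℝ] ℝ) (p : ℕ) (α : Forms V) {k : ℕ}
    (hk : k < 2 * p) : (lef Ω ^ p) α k = 0 := by
  induction p generalizing k with
  | zero => omega
  | succ p ih =>
    rw [pow_succ', Module.End.mul_apply]
    match k with
    | 0 => rfl
    | 1 => rfl
    | k + 2 => rw [lef_add_two, ih (by omega), ← lefschetzHom_apply, map_zero]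

theorem lef_pow_eq_zero (e : Module.Basis ι ℝ V) (Ω : V [⋀^Fin 2]→L[ℝ] ℝ) {n : ℕ}
    (hn : Fintype.card ι = 2 * n) : lef Ω ^ (n + 1) = 0 := by
  ext1 α
  ext1 k
  by_cases hk : k < 2 * (n + 1)
  · rw [lef_pow_apply_of_lt Ω _ _ hk]; rfl
  · rw [eq_zero_of_card_lt e (by omega) ((lef Ω ^ (n + 1)) α k)]; rfl

theorem lam_apply_eq_zero (e : Module.Basis ι ℝ V) (Ω : V [⋀^Fin 2]→L[ℝ] ℝ) (α : Forms V) {k : ℕ}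
    (h : α (k + 2) = 0) : lam e Ω α k = 0 := by
  simp [lam, LinearMap.sum_apply, Forms.sum_apply, h]

theorem lam_pow_apply_eq_zero (e : Module.Basis ι ℝ V) (Ω : V [⋀^Fin 2]→L[ℝ] ℝ) (p : ℕ)
    (α : Forms V) {k : ℕ} (h : α (k + 2 * p) = 0) : (lam e Ω ^ p) α k = 0 := by
  induction p generalizing k with
  | zero => exact h
  | succ p ih =>
    rw [pow_succ', Module.End.mul_apply]
    refine lam_apply_eq_zero e Ω _ (ih ?_)
    rw [show k + 2 + 2 * p = k + 2 * (p + 1) by ring]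
    exact h

theorem lam_pow_eq_zero (e : Module.Basis ι ℝ V) (Ω : V [⋀^Fin 2]→L[ℝ] ℝ) {n : ℕ}
    (hn : Fintype.card ι = 2 * n) : lam e Ω ^ (n + 1) = 0 := by
  ext1 α
  ext1 k
  exact lam_pow_apply_eq_zero e Ω _ α (eq_zero_of_card_lt e (by omega) _)

/-- The divided power `ω^c / c!`. -/
def divPow (Ω : V [⋀^Fin 2]→L[ℝ] ℝ) (c : ℕ) : Forms V :=
  (c.factorial : ℝ)⁻¹ • (lef Ω ^ c) (single 0 (oneForm V))

theorem weight_lef_pow (Ω : V [⋀^Fin 2]→L[ℝ] ℝ) (n c : ℕ) :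
    weight n ((lef Ω ^ c) (single 0 (oneForm V))) =
      ((n : ℝ) - 2 * c) • (lef Ω ^ c) (single 0 (oneForm V)) := by
  rw [← single_formPow, weight, diag_single]
  push_cast
  rfl

theorem lam_lef_pow (e : Module.Basis ι ℝ V) {Ω : V [⋀^Fin 2]→L[ℝ] ℝ} (hΩ : Nondeg Ω) {n : ℕ}
    (hn : Fintype.card ι = 2 * n) (c : ℕ) :
    lam e Ω ((lef Ω ^ (c + 1)) (single 0 (oneForm V))) =
      (((c : ℝ) + 1) * (n - c)) • (lef Ω ^ c) (single 0 (oneForm V)) := by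
  have h := fun α => LinearMap.congr_fun (lam_mul_lef e hΩ hn) α
  simp only [Module.End.mul_apply, LinearMap.add_apply] at h
  induction c with
  | zero =>
    have h0 := h (single 0 (oneForm V))
    rw [lam_oneForm, map_zero, zero_add] at h0
    have hw := weight_lef_pow Ω n 0
    simp only [pow_zero, Module.End.one_apply] at hw
    rw [zero_add, pow_one, h0, hw]
    simp
  | succ c ih =>
    rw [pow_succ', Module.End.mul_apply, h, ih, map_smul, weight_lef_pow, ← Module.End.mul_apply,
      ← pow_succ', ← add_smul]
    congr 1
    push_cast
    ring

theorem lam_divPow (e : Module.Basis ι ℝ V) {Ω : V [⋀^Fin 2]→L[ℝ] ℝ} (hΩ : Nondeg Ω) {n : ℕ}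
    (hn : Fintype.card ι = 2 * n) (c : ℕ) :
    lam e Ω (divPow Ω (c + 1)) = ((n : ℝ) - c) • divPow Ω c := by
  rw [divPow, divPow, map_smul, lam_lef_pow e hΩ hn, smul_smul, smul_smul]
  congr 1
  rw [Nat.factorial_succ]
  push_cast
  have : (c.factorial : ℝ) ≠ 0 := by positivity
  field_simp

theorem lam_pow_divPow (e : Module.Basis ι ℝ V) {Ω : V [⋀^Fin 2]→L[ℝ] ℝ} (hΩ : Nondeg Ω) {n : ℕ}
    (hn : Fintype.card ι = 2 * n) {b : ℕ} (hb : b ≤ n) :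
    (lam e Ω ^ b) (divPow Ω n) = (b.factorial : ℝ) • divPow Ω (n - b) := by
  induction b with
  | zero => simp
  | succ b ih =>
    rw [pow_succ', Module.End.mul_apply, ih (by omega), map_smul,
      show n - b = n - (b + 1) + 1 by omega, lam_divPow e hΩ hn, smul_smul, Nat.factorial_succ]
    congr 1
    have : ((n - (b + 1) : ℕ) : ℝ) = n - (b + 1) := by push_cast [Nat.cast_sub hb]; ring
    rw [this]
    push_cast
    ring

theorem expSum_lef_one (e : Module.Basis ι ℝ V) (Ω : V [⋀^Fin 2]→L[ℝ] ℝ) {n : ℕ}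
    (hn : Fintype.card ι = 2 * n) (a : ℝ) :
    expSum (n + 1) (a • lef Ω) (single 0 (oneForm V)) =
      ∑ c ∈ Finset.range (n + 1), a ^ c • divPow Ω c := by
  rw [expSum, Finset.sum_range_succ, smul_pow, lef_pow_eq_zero e Ω hn, smul_zero, smul_zero,
    add_zero, LinearMap.sum_apply]
  refine Finset.sum_congr rfl fun c _ => ?_
  rw [smul_pow, divPow, LinearMap.smul_apply, LinearMap.smul_apply, smul_comm]

theorem expSum_lam_divPow (e : Module.Basis ι ℝ V) {Ω : V [⋀^Fin 2]→L[ℝ] ℝ} (hΩ : Nondeg Ω)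
    {n : ℕ} (hn : Fintype.card ι = 2 * n) (a : ℝ) :
    expSum (n + 1) (a • lam e Ω) (divPow Ω n) =
      ∑ b ∈ Finset.range (n + 1), a ^ b • divPow Ω (n - b) := by
  rw [expSum, Finset.sum_range_succ, smul_pow, lam_pow_eq_zero e Ω hn, smul_zero, smul_zero,
    add_zero, LinearMap.sum_apply]
  refine Finset.sum_congr rfl fun b hb => ?_
  rw [smul_pow, LinearMap.smul_apply, LinearMap.smul_apply,
    lam_pow_divPow e hΩ hn (by simpa [Nat.lt_succ_iff] using hb), smul_comm, smul_smul (_⁻¹),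
    inv_mul_cancel₀ (by positivity), one_smul]

/-- The Weyl element `exp(L) exp(-Λ) exp(L)` of a pair of nilpotent elements. -/
def weyl {R : Type*} [Ring R] [Algebra ℝ R] (n : ℕ) (L Λ : R) : R :=
  expSum (n + 1) L * expSum (n + 1) (-Λ) * expSum (n + 1) L

/-- The Weyl element rotates the pair `(a, [Λ, a])` of a two-dimensional representation. -/
theorem weyl_mul {R : Type*} [Ring R] [Algebra ℝ R] {n : ℕ} {L Λ a f : R}
    (hL : L ^ (n + 1) = 0) (hΛ : Λ ^ (n + 1) = 0) (ha : L * a = a * L)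
    (hΛa : Λ * a = a * Λ + f) (hΛf : Λ * f = f * Λ) (hLf : L * f = f * L + a) :
    weyl n L Λ * a = -f * weyl n L Λ ∧ weyl n L Λ * f = a * weyl n L Λ := by
  have h1 : expSum (n + 1) L * a = a * expSum (n + 1) L := expSum_mul_of_commute ha
  have h2 : expSum (n + 1) L * f = (f + a) * expSum (n + 1) L := expSum_mul hL hLf ha
  have h3 : expSum (n + 1) (-Λ) * a = (a + -f) * expSum (n + 1) (-Λ) :=
    expSum_mul (by rw [neg_pow, hΛ, mul_zero]) (by rw [neg_mul, hΛa]; noncomm_ring)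
      (by rw [neg_mul, mul_neg, hΛf]; noncomm_ring)
  have h4 : expSum (n + 1) (-Λ) * f = f * expSum (n + 1) (-Λ) :=
    expSum_mul_of_commute (by rw [neg_mul, mul_neg, hΛf])
  unfold weyl
  generalize expSum (n + 1) L = E at *
  generalize expSum (n + 1) (-Λ) = F at *
  constructor
  · linear_combination (norm := noncomm_ring) E * F * h1 + E * h3 * E + h1 * F * E - h2 * F * E
  · linear_combination (norm := noncomm_ring) E * F * h2 + E * h3 * E + E * h4 * E + h1 * F * E

theorem lef_divPow_top (e : Module.Basis ι ℝ V) (Ω : V [⋀^Fin 2]→L[ℝ] ℝ) {n : ℕ}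
    (hn : Fintype.card ι = 2 * n) : lef Ω (divPow Ω n) = 0 := by
  rw [divPow, map_smul, ← Module.End.mul_apply, ← pow_succ', lef_pow_eq_zero e Ω hn]
  simp

theorem weyl_one (e : Module.Basis ι ℝ V) {Ω : V [⋀^Fin 2]→L[ℝ] ℝ} (hΩ : Nondeg Ω) {n : ℕ}
    (hn : Fintype.card ι = 2 * n) :
    weyl n (lef Ω) (lam e Ω) (single 0 (oneForm V)) = divPow Ω n := by
  -- `exp(L) 1 = exp(Λ) (ω^n / n!)`, both being the sum of all divided powers of `ω`.
  have h1 : expSum (n + 1) (lef Ω) (single 0 (oneForm V)) =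
      expSum (n + 1) (lam e Ω) (divPow Ω n) := by
    have h2 := expSum_lef_one e Ω hn 1
    have h3 := expSum_lam_divPow e hΩ hn 1
    simp only [one_smul, one_pow] at h2 h3
    rw [h2, h3, ← Finset.sum_range_reflect]
    simp
  rw [weyl, Module.End.mul_apply, Module.End.mul_apply, h1,
    ← Module.End.mul_apply (expSum _ (-lam e Ω)),
    expSum_neg_mul_expSum (lam_pow_eq_zero e Ω hn), Module.End.one_apply, expSum,
    Finset.sum_range_succ']
  simp only [LinearMap.add_apply, LinearMap.sum_apply, LinearMap.smul_apply, pow_succ,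
    Module.End.mul_apply, lef_divPow_top e Ω hn, map_zero, smul_zero, Finset.sum_const_zero]
  simp

theorem weyl_divPow (e : Module.Basis ι ℝ V) {Ω : V [⋀^Fin 2]→L[ℝ] ℝ} (hΩ : Nondeg Ω) {n : ℕ}
    (hn : Fintype.card ι = 2 * n) :
    weyl n (lef Ω) (lam e Ω) (divPow Ω n) = (-1 : ℝ) ^ n • single 0 (oneForm V) := by
  have h0 : expSum (n + 1) (lef Ω) (divPow Ω n) = divPow Ω n := by
    rw [expSum, Finset.sum_range_succ']
    simp only [LinearMap.add_apply, LinearMap.sum_apply, LinearMap.smul_apply, pow_succ,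
      Module.End.mul_apply, lef_divPow_top e Ω hn, map_zero, smul_zero, Finset.sum_const_zero]
    simp
  have h1 : expSum (n + 1) (-lam e Ω) (divPow Ω n) =
      (-1 : ℝ) ^ n • expSum (n + 1) (-lef Ω) (single 0 (oneForm V)) := by
    have h2 := expSum_lef_one e Ω hn (-1)
    have h3 := expSum_lam_divPow e hΩ hn (-1)
    rw [neg_one_smul] at h2 h3
    rw [h2, h3, ← Finset.sum_range_reflect, Finset.smul_sum]
    refine Finset.sum_congr rfl fun c hc => ?_
    have hc' : c ≤ n := by simpa [Nat.lt_succ_iff] using hc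
    rw [smul_smul, show n + 1 - 1 - c = n - c by omega, show n - (n - c) = c by omega]
    congr 1
    obtain ⟨d, rfl⟩ := Nat.exists_eq_add_of_le hc'
    rw [Nat.add_sub_cancel_left, pow_add, mul_right_comm, ← mul_pow]
    simp
  have h2 : expSum (n + 1) (lef Ω) * expSum (n + 1) (-lef Ω) = 1 := by
    have := expSum_neg_mul_expSum (X := -lef Ω) (N := n + 1)
      (by rw [neg_pow, lef_pow_eq_zero e Ω hn, mul_zero])
    rwa [neg_neg] at this
  rw [weyl, Module.End.mul_apply, Module.End.mul_apply, h0, h1, map_smul, ← Module.End.mul_apply,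
    h2, Module.End.one_apply]

theorem expSum_comm_of_commute {R : Type*} [Ring R] [Algebra ℝ R] {N : ℕ} {X a : R}
    (h : a * X = X * a) : a * expSum N X = expSum N X * a :=
  (expSum_mul_of_commute h.symm).symm

theorem parity_mul_weyl (e : Module.Basis ι ℝ V) (Ω : V [⋀^Fin 2]→L[ℝ] ℝ) (n : ℕ) :
    parity * weyl n (lef Ω) (lam e Ω) = weyl n (lef Ω) (lam e Ω) * parity := by
  have h1 : parity * expSum (n + 1) (lef Ω) = expSum (n + 1) (lef Ω) * parity :=
    expSum_comm_of_commute (parity_mul_lef Ω)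
  have h2 : parity * expSum (n + 1) (-lam e Ω) = expSum (n + 1) (-lam e Ω) * parity :=
    expSum_comm_of_commute (by rw [mul_neg, neg_mul, parity_mul_lam])
  rw [weyl, ← mul_assoc, ← mul_assoc, h1, mul_assoc _ parity, h2, mul_assoc, mul_assoc, h1]
  simp only [mul_assoc]

variable {n : ℕ} {e : Module.Basis ι ℝ V} {Ω : V [⋀^Fin 2]→L[ℝ] ℝ}
  {vol : V [⋀^Fin (2 * n)]→L[ℝ] ℝ}

variable (e Ω vol) in
/-- The symplectic star operator on families. -/
abbrev starΩ : Module.End ℝ (Forms V) := starL e (fun u v => Ω ![u, v]) vol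

/-- The symplectic star operator is the Weyl element of the Lefschetz triple up to sign: both
turn exterior multiplication into contraction and send `1` to `ω^n / n!`. -/
theorem starΩ_eq_weyl (hΩ : Nondeg Ω) (hn : Fintype.card ι = 2 * n)
    (hvol : single (2 * n) vol = divPow Ω n) :
    starΩ e Ω vol = weyl n (lef Ω) (lam e Ω) * triSign := by
  refine end_ext e (fun ξ => iota (sharpΩ e Ω ξ) * parity) ?_ (fun ξ => ?_) fun ξ => ?_
  · rw [starL_one, hvol, Module.End.mul_apply, triSign, diag_single, map_smul, weyl_one e hΩ hn]
    simp
  · rw [starL_mul_eps, mul_assoc, ← parity_mul_starL, ← mul_assoc]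
  · have h := (weyl_mul (lef_pow_eq_zero e Ω hn) (lam_pow_eq_zero e Ω hn) (lef_mul_eps e Ω ξ)
      (lam_mul_eps e Ω ξ) (lam_mul_iota e Ω _)
      (lef_mul_iota e Ω (hΩ.apply_sharp e ξ))).1
    have h2 := parity_mul_weyl e Ω n
    have h3 := parity_mul_triSign (V := V)
    have h4 := triSign_mul_eps ξ
    linear_combination (norm := noncomm_ring) weyl n (lef Ω) (lam e Ω) * h4 -
      h * triSign * parity - iota (sharpΩ e Ω ξ) * h2 * triSign +
      iota (sharpΩ e Ω ξ) * weyl n (lef Ω) (lam e Ω) * -h3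

/-- The symplectic star operator turns contraction back into exterior multiplication. -/
theorem starΩ_mul_iota (hΩ : Nondeg Ω) (hn : Fintype.card ι = 2 * n)
    (hvol : single (2 * n) vol = divPow Ω n) (ξ : V →L[ℝ] ℝ) :
    starΩ e Ω vol * iota (sharpΩ e Ω ξ) = eps ξ * starΩ e Ω vol * parity := by
  have h := (weyl_mul (lef_pow_eq_zero e Ω hn) (lam_pow_eq_zero e Ω hn) (lef_mul_eps e Ω ξ)
      (lam_mul_eps e Ω ξ) (lam_mul_iota e Ω _)
      (lef_mul_iota e Ω (hΩ.apply_sharp e ξ))).2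
  rw [starΩ_eq_weyl hΩ hn hvol, mul_assoc, triSign_mul_iota, ← mul_assoc, ← mul_assoc, h]
  simp only [mul_assoc]

theorem starΩ_vol (hΩ : Nondeg Ω) (hn : Fintype.card ι = 2 * n)
    (hvol : single (2 * n) vol = divPow Ω n) :
    starΩ e Ω vol (single (2 * n) vol) = single 0 (oneForm V) := by
  rw [starΩ_eq_weyl hΩ hn hvol, Module.End.mul_apply, triSign, diag_single, map_smul, hvol,
    weyl_divPow e hΩ hn, smul_smul]
  have : (2 * n + 1).choose 2 = n * (2 * n + 1) := by
    rw [Nat.choose_two_right, Nat.add_sub_cancel,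
      show (2 * n + 1) * (2 * n) = n * (2 * n + 1) * 2 by ring, Nat.mul_div_cancel _ two_pos]
  have h2 : ((-1 : ℝ) ^ n) ^ 2 = 1 := by rw [← pow_mul, mul_comm, pow_mul]; simp
  rw [this, pow_mul, pow_succ, pow_mul, h2, one_pow, one_mul, ← pow_two, h2, one_smul]

theorem starΩ_mul_starΩ (hΩ : Nondeg Ω) (hn : Fintype.card ι = 2 * n)
    (hvol : single (2 * n) vol = divPow Ω n) : starΩ e Ω vol * starΩ e Ω vol = 1 := by
  refine end_ext e (fun ξ => eps ξ) ?_ (fun ξ => ?_) fun ξ => by simp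
  · rw [Module.End.mul_apply, starL_one, starΩ_vol hΩ hn hvol, Module.End.one_apply]
  · have h1 := starL_mul_eps e (fun u v => Ω ![u, v]) vol ξ
    have h2 := starΩ_mul_iota (e := e) hΩ hn hvol ξ
    have h3 := parity_mul_starL e (fun u v => Ω ![u, v]) vol
    have h4 := parity_mul_parity (V := V)
    linear_combination (norm := noncomm_ring) starΩ e Ω vol * h1 + h2 * starΩ e Ω vol * parity +
      eps ξ * starΩ e Ω vol * h3 * parity + eps ξ * starΩ e Ω vol * starΩ e Ω vol * h4

/-- The dual Lefschetz operator is the conjugate of `L` by the symplectic star. -/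
theorem lam_eq_star_lef_star (hΩ : Nondeg Ω) (hn : Fintype.card ι = 2 * n)
    (hvol : single (2 * n) vol = divPow Ω n) :
    starΩ e Ω vol * lef Ω * starΩ e Ω vol = lam e Ω := by
  rw [← sub_eq_zero]
  refine end_ext e (fun ξ => eps ξ) ?_ (fun ξ => ?_) fun ξ => by simp
  · rw [LinearMap.sub_apply, lam_oneForm, Module.End.mul_apply, Module.End.mul_apply, starL_one,
      hvol, lef_divPow_top e Ω hn]
    simp
  · have h1 := starL_mul_eps e (fun u v => Ω ![u, v]) vol ξ
    have h2 := starΩ_mul_iota (e := e) hΩ hn hvol ξ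
    have h3 := parity_mul_starL e (fun u v => Ω ![u, v]) vol
    have h4 := parity_mul_parity (V := V)
    have h5 := lef_mul_iota e Ω (hΩ.apply_sharp e ξ)
    have h6 := lam_mul_eps e Ω ξ
    have h7 := starΩ_mul_starΩ (e := e) hΩ hn hvol
    have h8 := parity_mul_lef Ω
    set s := starΩ e Ω vol
    set i := iota (sharpΩ e Ω ξ)
    linear_combination (norm := noncomm_ring) s * lef Ω * h1 + s * h5 * s * parity +
      h2 * lef Ω * s * parity + eps ξ * s * h8 * s * parity + eps ξ * s * lef Ω * h3 * parity +
      eps ξ * s * lef Ω * s * h4 + h1 * s * parity + i * s * h3 * parity + i * s * s * h4 +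
      i * h7 - h6

end Weyl

/-! ### Pull-back of families of forms -/

section Pullback

variable {V W : Type*} [AddCommGroup V] [Module ℝ V] [TopologicalSpace V]
  [AddCommGroup W] [Module ℝ W] [TopologicalSpace W]

/-- The pull-back of families of forms by a linear map. -/
def pb (φ : V →L[ℝ] W) : Forms W →ₗ[ℝ] Forms V where
  toFun α := ⟨fun k => (α k).compContinuousLinearMap φ⟩
  map_add' _ _ := rfl
  map_smul' _ _ := rfl

@[simp] theorem pb_apply (φ : V →L[ℝ] W) (α : Forms W) (k : ℕ) :
    pb φ α k = (α k).compContinuousLinearMap φ := rfl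

theorem toDegree_comp (φ : V →L[ℝ] W) {k : ℕ} (l : ℕ) (α : W [⋀^Fin k]→L[ℝ] ℝ) :
    (toDegree l α).compContinuousLinearMap φ = toDegree l (α.compContinuousLinearMap φ) := by
  by_cases h : k = l
  · subst h; rw [toDegree_self, toDegree_self]
  · rw [toDegree_of_ne h, toDegree_of_ne h]; rfl

theorem pb_single (φ : V →L[ℝ] W) {k : ℕ} (α : W [⋀^Fin k]→L[ℝ] ℝ) :
    pb φ (single k α) = single k (α.compContinuousLinearMap φ) := by
  ext1 l
  exact toDegree_comp φ l α

theorem pb_one (φ : V →L[ℝ] W) : pb φ (single 0 (oneForm W)) = single 0 (oneForm V) := by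
  rw [pb_single]; rfl

theorem pb_eps (φ : V →L[ℝ] W) (ξ : W →L[ℝ] ℝ) (α : Forms W) :
    pb φ (eps ξ α) = eps (ξ.comp φ) (pb φ α) := by
  ext k v
  cases k with
  | zero => rfl
  | succ k =>
    simp only [pb_apply, eps_succ, ContinuousAlternatingMap.compContinuousLinearMap_apply,
      extMul_apply]
    rfl

theorem pb_iota (φ : V →L[ℝ] W) (u : V) (α : Forms W) :
    pb φ (iota (φ u) α) = iota u (pb φ α) := by
  ext k v
  simp only [pb_apply, iota_apply, ContinuousAlternatingMap.compContinuousLinearMap_apply,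
    contr_apply]
  congr 1
  funext a
  refine Fin.cases ?_ (fun i => ?_) a <;> simp

theorem lefschetz_comp (φ : V →L[ℝ] W) (Ω : W [⋀^Fin 2]→L[ℝ] ℝ) {k : ℕ}
    (α : W [⋀^Fin k]→L[ℝ] ℝ) :
    (lefschetz Ω α).compContinuousLinearMap φ =
      lefschetz (Ω.compContinuousLinearMap φ) (α.compContinuousLinearMap φ) := by
  rw [lefschetz, toDegree_comp, lefschetz]
  congr 1
  ext v
  rw [ContinuousAlternatingMap.compContinuousLinearMap_apply, wedge_apply, wedge_apply]
  rfl

theorem pb_lef (φ : V →L[ℝ] W) (Ω : W [⋀^Fin 2]→L[ℝ] ℝ) (α : Forms W) :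
    pb φ (lef Ω α) = lef (Ω.compContinuousLinearMap φ) (pb φ α) := by
  ext1 k
  match k with
  | 0 => rfl
  | 1 => rfl
  | k + 2 => exact lefschetz_comp φ Ω (α k)

theorem pb_lef_pow (φ : V →L[ℝ] W) (Ω : W [⋀^Fin 2]→L[ℝ] ℝ) (p : ℕ) (α : Forms W) :
    pb φ ((lef Ω ^ p) α) = (lef (Ω.compContinuousLinearMap φ) ^ p) (pb φ α) := by
  induction p with
  | zero => rfl
  | succ p ih => rw [pow_succ', Module.End.mul_apply, pb_lef, ih, pow_succ', Module.End.mul_apply]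

theorem pb_divPow (φ : V →L[ℝ] W) (Ω : W [⋀^Fin 2]→L[ℝ] ℝ) (c : ℕ) :
    pb φ (divPow Ω c) = divPow (Ω.compContinuousLinearMap φ) c := by
  rw [divPow, map_smul, pb_lef_pow, pb_one, divPow]

/-- The star operator is natural: it commutes with pull-back by a linear isomorphism. -/
theorem pb_starL [IsTopologicalAddGroup V] [ContinuousSMul ℝ V] [T2Space V]
    [IsTopologicalAddGroup W] [ContinuousSMul ℝ W] [T2Space W]
    {ι κ : Type*} [Fintype ι] [DecidableEq ι] [Fintype κ] [DecidableEq κ]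
    (φ : V →L[ℝ] W) (hφ : Function.Bijective φ) (e : Module.Basis ι ℝ V)
    (e' : Module.Basis κ ℝ W) (B : W →ₗ[ℝ] W →ₗ[ℝ] ℝ)
    (hB : ∀ u, (∀ v, B v u = 0) → u = 0) {n : ℕ} (vol : W [⋀^Fin (2 * n)]→L[ℝ] ℝ)
    (α : Forms W) :
    pb φ (starL e' (fun u v => B u v) vol α) =
      starL e (fun u v => B (φ u) (φ v)) (vol.compContinuousLinearMap φ) (pb φ α) := by
  have hB' : ∀ u, (∀ v, B (φ v) (φ u) = 0) → u = 0 := by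
    intro u hu
    have : φ u = 0 := hB _ fun w => by
      obtain ⟨v, rfl⟩ := hφ.2 w
      exact hu v
    exact hφ.1 (by rw [this, map_zero])
  have hs : ∀ ξ : W →L[ℝ] ℝ, φ (sharp e (fun u v => B (φ u) (φ v)) (ξ.comp φ)) =
      sharp e' (fun u v => B u v) ξ := by
    intro ξ
    obtain ⟨u, hu⟩ := hφ.2 (sharp e' (fun u v => B u v) ξ)
    have h1 := sharp_unique e (B.compl₁₂ (φ : V →ₗ[ℝ] W) (φ : V →ₗ[ℝ] W)) hB' (ξ.comp φ) (u := u)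
      (fun v => by
        change B (φ v) (φ u) = ξ (φ v)
        rw [hu]
        exact apply_sharp e' B (gram_isUnit e' B hB) ξ (φ v))
    have h2 : sharp e (fun u v => B (φ u) (φ v)) (ξ.comp φ) = u := h1
    rw [h2, hu]
  suffices h : pb φ ∘ₗ starL e' (fun u v => B u v) vol =
      starL e (fun u v => B (φ u) (φ v)) (vol.compContinuousLinearMap φ) ∘ₗ pb φ from
    LinearMap.congr_fun h α
  refine hom_ext e' (fun ξ => iota (sharp e (fun u v => B (φ u) (φ v)) (ξ.comp φ)) * parity) ?_
    (fun ξ α => ?_) fun ξ α => ?_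
  · rw [LinearMap.comp_apply, LinearMap.comp_apply, starL_one, pb_one, starL_one, pb_single]
  · have h1 := LinearMap.congr_fun (starL_mul_eps e' (fun u v => B u v) vol ξ) α
    have h2 := LinearMap.congr_fun (parity_mul_starL e' (fun u v => B u v) vol) α
    simp only [Module.End.mul_apply] at h1 h2
    rw [LinearMap.comp_apply, h1, ← h2, ← hs, pb_iota]
    rfl
  · have h1 := LinearMap.congr_fun (starL_mul_eps e (fun u v => B (φ u) (φ v))
      (vol.compContinuousLinearMap φ) (ξ.comp φ)) (pb φ α)
    have h2 := LinearMap.congr_fun (parity_mul_starL e (fun u v => B (φ u) (φ v))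
      (vol.compContinuousLinearMap φ)) (pb φ α)
    simp only [Module.End.mul_apply] at h1 h2
    rw [LinearMap.comp_apply, pb_eps, h1, ← h2]
    rfl

end Pullback

/-! ### Compatible complex structures and the Hodge star -/

section Compatible

variable {V : Type*} [AddCommGroup V] [Module ℝ V] [TopologicalSpace V]

/-- `J` is a complex structure compatible with `Ω`: `Ω(·, J·)` is an invariant inner product. -/
structure Compatible (Ω : V [⋀^Fin 2]→L[ℝ] ℝ) (J : V →L[ℝ] V) : Prop where
  sq : ∀ v, J (J v) = -v
  invariant : ∀ u v, Ω ![J u, J v] = Ω ![u, v]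
  pos : ∀ u, u ≠ 0 → 0 < Ω ![u, J u]

variable {Ω : V [⋀^Fin 2]→L[ℝ] ℝ} {J : V →L[ℝ] V}

theorem Compatible.nondeg (h : Compatible Ω J) : Nondeg Ω := by
  intro u hu
  by_contra hne
  have h1 : J u ≠ 0 := fun h0 => hne (by rw [← neg_eq_zero, ← h.sq, h0, map_zero])
  have h2 := h.pos _ h1
  rw [h.sq, ← bil_apply, map_neg, bil_apply, hu] at h2
  simp at h2

/-- The metric `g(u, v) = Ω(u, J v)`. -/
abbrev met (Ω : V [⋀^Fin 2]→L[ℝ] ℝ) (J : V →L[ℝ] V) (u v : V) : ℝ := Ω ![u, J v]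

/-- The metric as a bilinear map. -/
def metHom (Ω : V [⋀^Fin 2]→L[ℝ] ℝ) (J : V →L[ℝ] V) : V →ₗ[ℝ] V →ₗ[ℝ] ℝ :=
  (bil Ω).compl₂ (J : V →ₗ[ℝ] V)

theorem metHom_apply (u v : V) : metHom Ω J u v = Ω ![u, J v] := rfl

theorem Compatible.met_symm (h : Compatible Ω J) (u v : V) : Ω ![u, J v] = Ω ![v, J u] := by
  rw [← h.invariant, h.sq, ← bil_apply, map_neg, bil_apply, two_form_swap, neg_neg]

theorem Compatible.met_nondeg (h : Compatible Ω J) (u : V) (hu : ∀ v, metHom Ω J v u = 0) :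
    u = 0 := by
  by_contra hne
  have := h.pos u hne
  rw [← metHom_apply, hu] at this
  exact lt_irrefl _ this

variable [IsTopologicalAddGroup V] [ContinuousSMul ℝ V] [T2Space V]

section

variable {ι : Type*} [Fintype ι] [DecidableEq ι] {e : Module.Basis ι ℝ V}

theorem Compatible.sharp_met (h : Compatible Ω J) (ξ : V →L[ℝ] ℝ) :
    sharp e (met Ω J) ξ = -J (sharpΩ e Ω ξ) :=
  sharp_unique e (metHom Ω J) h.met_nondeg ξ fun v => by
    rw [metHom_apply, map_neg, h.sq, neg_neg, h.nondeg.apply_sharp]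

theorem Compatible.sharp_comp (h : Compatible Ω J) (ξ : V →L[ℝ] ℝ) :
    sharpΩ e Ω (ξ.comp J) = -J (sharpΩ e Ω ξ) :=
  h.nondeg.sharp_unique e _ fun v => by
    rw [← bil_apply, map_neg, bil_apply, ← h.invariant, h.sq, ← bil_apply, map_neg, neg_neg,
      bil_apply, h.nondeg.apply_sharp]
    rfl

variable {n : ℕ} {vol : V [⋀^Fin (2 * n)]→L[ℝ] ℝ}

theorem Compatible.pb_mul_pb (h : Compatible Ω J) (e : Module.Basis ι ℝ V) :
    (pb J * pb J : Module.End ℝ (Forms V)) = parity := by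
  refine end_ext e (fun ξ => -eps ξ) ?_ (fun ξ => ?_) fun ξ => ?_
  · rw [Module.End.mul_apply, pb_one, pb_one, parity, diag_single]; simp
  · ext1 α
    have : (ξ.comp J).comp J = -ξ := by ext v; simp [h.sq]
    rw [Module.End.mul_apply, Module.End.mul_apply, pb_eps, pb_eps, this]
    rw [← neg_one_smul ℝ ξ, eps_smul]
    simp
  · rw [parity_mul_eps, neg_mul]

theorem Compatible.comp_eq (h : Compatible Ω J) : Ω.compContinuousLinearMap J = Ω := by
  ext v
  have : v = ![v 0, v 1] := by funext a; fin_cases a <;> rfl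
  rw [ContinuousAlternatingMap.compContinuousLinearMap_apply, this, ← h.invariant]
  congr 1
  funext a; fin_cases a <;> rfl

theorem Compatible.pb_mul_lef (h : Compatible Ω J) :
    (pb J * lef Ω : Module.End ℝ (Forms V)) = lef Ω * pb J := by
  ext1 α
  rw [Module.End.mul_apply, pb_lef, h.comp_eq, Module.End.mul_apply]

theorem Compatible.pb_mul_star (h : Compatible Ω J)
    (hvol : single (2 * n) vol = divPow Ω n) :
    (pb J * starΩ e Ω vol : Module.End ℝ (Forms V)) = starΩ e Ω vol * pb J := by
  refine end_ext e (fun ξ => iota (sharpΩ e Ω (ξ.comp J)) * parity) ?_ (fun ξ => ?_) fun ξ => ?_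
  · rw [Module.End.mul_apply, Module.End.mul_apply, pb_one, starL_one, hvol, pb_divPow, h.comp_eq]
  · ext1 α
    have h1 := LinearMap.congr_fun (starL_mul_eps e (fun u v => Ω ![u, v]) vol ξ) α
    have h2 := LinearMap.congr_fun (parity_mul_starL e (fun u v => Ω ![u, v]) vol) α
    have h3 : sharp e (fun u v => Ω ![u, v]) ξ = J (sharpΩ e Ω (ξ.comp J)) := by
      rw [h.sharp_comp, map_neg, h.sq, neg_neg]
    simp only [Module.End.mul_apply] at h1 h2 ⊢
    rw [h1, h3, ← h2, pb_iota]
    rfl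
  · ext1 α
    have h1 := LinearMap.congr_fun (starL_mul_eps e (fun u v => Ω ![u, v]) vol (ξ.comp J)) (pb J α)
    have h2 := LinearMap.congr_fun (parity_mul_starL e (fun u v => Ω ![u, v]) vol) (pb J α)
    simp only [Module.End.mul_apply] at h1 h2 ⊢
    rw [pb_eps, h1, ← h2]

/-- The Hodge star is the symplectic star composed with the action of `J`. -/
theorem Compatible.starL_met (h : Compatible Ω J) :
    starL e (met Ω J) vol = starΩ e Ω vol * pb J := by
  refine end_ext e (fun ξ => iota (sharpΩ e Ω (ξ.comp J)) * parity) ?_ (fun ξ => ?_) fun ξ => ?_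
  · rw [Module.End.mul_apply, pb_one, starL_one, starL_one]
  · rw [starL_mul_eps, h.sharp_comp, ← h.sharp_met, mul_assoc, ← parity_mul_starL, ← mul_assoc]
  · ext1 α
    have h1 := LinearMap.congr_fun (starL_mul_eps e (fun u v => Ω ![u, v]) vol (ξ.comp J)) (pb J α)
    have h2 := LinearMap.congr_fun (parity_mul_starL e (fun u v => Ω ![u, v]) vol) (pb J α)
    simp only [Module.End.mul_apply] at h1 h2 ⊢
    rw [pb_eps, h1, ← h2]

theorem Compatible.starL_met_sq (h : Compatible Ω J) (hn : Fintype.card ι = 2 * n)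
    (hvol : single (2 * n) vol = divPow Ω n) :
    starL e (met Ω J) vol * starL e (met Ω J) vol = parity := by
  rw [h.starL_met, mul_assoc, ← mul_assoc (pb J), h.pb_mul_star hvol, mul_assoc,
    h.pb_mul_pb e, ← mul_assoc, starΩ_mul_starΩ h.nondeg hn hvol, one_mul]

theorem Compatible.star_lef_star (h : Compatible Ω J) (hn : Fintype.card ι = 2 * n)
    (hvol : single (2 * n) vol = divPow Ω n) :
    starL e (met Ω J) vol * lef Ω * starL e (met Ω J) vol = lam e Ω * parity := by
  rw [← lam_eq_star_lef_star h.nondeg hn hvol, ← h.pb_mul_pb e, h.starL_met]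
  have h1 := h.pb_mul_star (e := e) hvol
  have h2 := h.pb_mul_lef
  set s := starΩ e Ω vol
  set j : Module.End ℝ (Forms V) := pb J
  linear_combination (norm := noncomm_ring) s * h2 * s * j + s * lef Ω * h1 * j

end

section Volume

variable {n : ℕ} {e : Module.Basis (Fin (2 * n)) ℝ V} {vol : V [⋀^Fin (2 * n)]→L[ℝ] ℝ}

theorem top_form_apply (e : Module.Basis (Fin (2 * n)) ℝ V) (η : V [⋀^Fin (2 * n)]→L[ℝ] ℝ)
    (v : Fin (2 * n) → V) : η v = η e * e.det v := by
  have h := AlternatingMap.eq_smul_basis_det e η.toAlternatingMap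
  have h2 := congrArg (fun f => f v) h
  simpa using h2

/-- The square of the Liouville volume of a basis is the determinant of `Ω` in that basis. -/
theorem vol_sq (hΩ : Nondeg Ω) (hvol : single (2 * n) vol = divPow Ω n) :
    vol e ^ 2 = (gramΩ e Ω).det := by
  have h1 := congrArg (fun α : Forms V => α 0 ![]) (starΩ_vol (e := e) hΩ (by simp) hvol)
  have h2 : vol = vol e • decomposable (2 * n) (dualCov e) := by
    ext v
    rw [top_form_apply e, ContinuousAlternatingMap.smul_apply, decomposable_apply, smul_eq_mul,
      Module.Basis.det_apply]
    rfl
  have h3 : starΩ e Ω vol (single (2 * n) vol) 0 ![] = vol e * (vol e * (gramΩ e Ω)⁻¹.det) := by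
    rw [starL_single_apply]
    conv_lhs => rw [h2]
    rw [star_smul, ContinuousAlternatingMap.smul_apply, ← h2, star_decomposable (add_zero _),
      contract_apply, smul_eq_mul]
    refine congrArg (vol e * ·) ((top_form_apply e vol _).trans (congrArg (vol e * ·) ?_))
    rw [Module.Basis.det_apply]
    refine congrArg (Matrix.det : Matrix (Fin (2 * n)) (Fin (2 * n)) ℝ → ℝ)
      (Matrix.ext fun i j => ?_)
    have : (Fin.append (fun a => sharpΩ e Ω (dualCov e a)) ![] : Fin (2 * n + 0) → V)
        (Fin.cast (add_zero (2 * n)).symm j) = sharpΩ e Ω (dualCov e j) :=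
      Fin.append_left (fun a => sharpΩ e Ω (dualCov e a)) ![] j
    rw [Module.Basis.toMatrix_apply, this, repr_sharp]
    simp [Finsupp.single_apply]
  rw [h3, single_same] at h1
  have h4 : (oneForm V) ![] = 1 := rfl
  rw [h4, Matrix.det_nonsing_inv, Ring.inverse_eq_inv'] at h1
  have h5 : (gramΩ e Ω).det ≠ 0 := (hΩ.isUnit e).ne_zero
  field_simp at h1
  exact h1

theorem Compatible.det_gram (h : Compatible Ω J) (hvol : single (2 * n) vol = divPow Ω n) :
    (gram e (met Ω J)).det = vol e ^ 2 := by
  have h1 : gram e (met Ω J) = gramΩ e Ω * LinearMap.toMatrix e e (J : V →ₗ[ℝ] V) := by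
    ext i j
    rw [Matrix.mul_apply]
    simp only [gram, Matrix.of_apply, LinearMap.toMatrix_apply, ContinuousLinearMap.coe_coe]
    conv_lhs => rw [met, ← e.sum_repr (J (e j)), ← bil_apply, map_sum]
    refine Finset.sum_congr rfl fun k _ => ?_
    rw [map_smul, smul_eq_mul, mul_comm, bil_apply]
  have h2 : (LinearMap.toMatrix e e (J : V →ₗ[ℝ] V)).det ^ 2 = 1 := by
    rw [pow_two, ← Matrix.det_mul, ← LinearMap.toMatrix_mul]
    have : (J : V →ₗ[ℝ] V) * (J : V →ₗ[ℝ] V) = -1 := by ext v; simp [h.sq]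
    rw [this, map_neg, LinearMap.toMatrix_one, Matrix.det_neg]
    simp
  have h3 : 0 < (gram e (met Ω J)).det := by
    refine Matrix.PosDef.det_pos (Matrix.PosDef.of_dotProduct_mulVec_pos ?_ ?_)
    · ext i j
      simp only [Matrix.conjTranspose_apply, gram, Matrix.of_apply, star_trivial]
      exact h.met_symm _ _
    · intro c hc
      have h4 : ∑ i, c i • e i ≠ 0 := fun h0 =>
        hc (funext (Fintype.linearIndependent_iff.mp e.linearIndependent _ h0))
      have h5 := h.pos _ h4
      rw [← metHom_apply, map_sum (metHom Ω J), LinearMap.sum_apply] at h5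
      simp only [map_smul, LinearMap.smul_apply, map_sum, smul_eq_mul] at h5
      refine lt_of_lt_of_eq h5 (Eq.symm ?_)
      change ∑ i, Star.star c i * ((gram e (met Ω J)).mulVec c) i = _
      refine Finset.sum_congr rfl fun i _ => ?_
      rw [Pi.star_apply, star_trivial]
      rw [show (gram e (met Ω J)).mulVec c i = ∑ j, gram e (met Ω J) i j * c j from by
        simp only [Matrix.mulVec, dotProduct], Finset.mul_sum]
      refine Finset.sum_congr rfl fun j _ => ?_
      rw [metHom_apply, gram, Matrix.of_apply]
      ring
  rw [h1, Matrix.det_mul, ← vol_sq h.nondeg hvol] at h3 ⊢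
  have h4 : (LinearMap.toMatrix e e (J : V →ₗ[ℝ] V)).det = 1 := by
    have h5 : 0 < (LinearMap.toMatrix e e (J : V →ₗ[ℝ] V)).det :=
      (pos_iff_pos_of_mul_pos h3).mp (by
        rcases (sq_nonneg (vol e)).lt_or_eq with h | h
        · exact h
        · rw [← h, zero_mul] at h3; exact absurd h3 (lt_irrefl _))
    nlinarith
  rw [h4, mul_one]

/-- The Riemannian and the Liouville volume forms agree. -/
theorem Compatible.vol_eq (h : Compatible Ω J) (e : Module.Basis (Fin (2 * n)) ℝ V) :
    (√(gram e (met Ω J)).det / |formPow Ω n e|) • formPow Ω n =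
      (n.factorial : ℝ)⁻¹ • formPow Ω n := by
  have hvol : single (2 * n) ((n.factorial : ℝ)⁻¹ • formPow Ω n) = divPow Ω n := by
    rw [map_smul, single_formPow, divPow]
  have h1 := h.det_gram (e := e) hvol
  have h2 := vol_sq (e := e) h.nondeg hvol
  have h3 : formPow Ω n e ≠ 0 := by
    intro h0
    rw [ContinuousAlternatingMap.smul_apply, h0] at h2
    exact (h.nondeg.isUnit e).ne_zero (by rw [← h2]; simp)
  rw [h1, Real.sqrt_sq_eq_abs, ContinuousAlternatingMap.smul_apply, smul_eq_mul, abs_mul,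
    mul_div_assoc, div_self (abs_ne_zero.mpr h3), mul_one, abs_of_nonneg (by positivity)]

end Volume

end Compatible

/-! ### Lefschetz triples in an abstract ring -/

section Triple

variable {R : Type*} [Ring R]

/-- The commutation relations of `sl₂` with a nilpotency bound, for the raising operator `L`, the
lowering operator `Λ` and the weight operator `H`, with the sign convention `[Λ, L] = H`. -/
structure IsLefschetzTriple (n : ℕ) (L Λ H : R) : Prop where
  lef_pow : L ^ (n + 1) = 0
  lam_pow : Λ ^ (n + 1) = 0
  lam_mul_lef : Λ * L = L * Λ + H
  weight_mul_lef : H * L = L * H - 2 * L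
  weight_mul_lam : H * Λ = Λ * H + 2 * Λ

variable {n : ℕ} {L Λ H : R}

theorem IsLefschetzTriple.swap (h : IsLefschetzTriple n L Λ H) :
    IsLefschetzTriple n Λ L (-H) where
  lef_pow := h.lam_pow
  lam_pow := h.lef_pow
  lam_mul_lef := by rw [h.lam_mul_lef]; abel
  weight_mul_lef := by rw [neg_mul, h.weight_mul_lam]; noncomm_ring
  weight_mul_lam := by rw [neg_mul, h.weight_mul_lef]; noncomm_ring

variable [Algebra ℝ R]

/-- An element of weight `-1` that commutes with `L` generates a two-dimensional representation:
`[Λ, [Λ, d]] = 0`. On the string `x₀ = d`, `x_{j+1} = [Λ, x_j]` one has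
`[L, x_{j+1}] = (1 - j²) x_j`, so the vanishing of `x_j` for large `j` descends to `j = 2`. -/
theorem IsLefschetzTriple.lam_mul_commutator (h : IsLefschetzTriple n L Λ H) {d : R}
    (hL : L * d = d * L) (hH : H * d = d * H - d) :
    Λ * (Λ * d - d * Λ) = (Λ * d - d * Λ) * Λ := by
  let x : ℕ → R := fun j => ((LinearMap.mulLeft ℝ Λ - LinearMap.mulRight ℝ Λ) ^ j) d
  have hx : ∀ j, x (j + 1) = Λ * x j - x j * Λ := fun j => by
    simp only [x, pow_succ', Module.End.mul_apply, LinearMap.sub_apply, LinearMap.mulLeft_apply,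
      LinearMap.mulRight_apply]
  have hx0 : x 0 = d := rfl
  have hHx : ∀ j, H * x j = x j * H + (2 * (j : ℝ) - 1) • x j := by
    intro j
    induction j with
    | zero => rw [hx0, hH, Nat.cast_zero, mul_zero, zero_sub, neg_one_smul, sub_eq_add_neg]
    | succ j ih =>
      have e : (2 * ((j + 1 : ℕ) : ℝ) - 1) • x (j + 1) =
          (2 * (j : ℝ) - 1) • x (j + 1) + 2 * x (j + 1) := by
        push_cast
        rw [two_mul (x (j + 1))]
        module
      rw [e, hx]
      have hw := h.weight_mul_lam
      have e2 : (2 * (j : ℝ) - 1) • (Λ * x j - x j * Λ) =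
          Λ * ((2 * (j : ℝ) - 1) • x j) - ((2 * (j : ℝ) - 1) • x j) * Λ := by
        rw [mul_smul_comm, smul_mul_assoc, smul_sub]
      rw [e2]
      generalize (2 * (j : ℝ) - 1) • x j = y at *
      linear_combination (norm := noncomm_ring) hw * x j + Λ * ih - ih * Λ - x j * hw
  have hLx : ∀ j, L * x (j + 1) = x (j + 1) * L + (1 - (j : ℝ) ^ 2) • x j := by
    intro j
    induction j with
    | zero =>
      have e := h.lam_mul_lef
      rw [hx, hx0, Nat.cast_zero]
      norm_num
      linear_combination (norm := noncomm_ring) -e * d + Λ * hL - hH - hL * Λ + d * e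
    | succ j ih =>
      have e := h.lam_mul_lef
      have e3 := hHx (j + 1)
      have e2 : (1 - ((j + 1 : ℕ) : ℝ) ^ 2) • x (j + 1) =
          Λ * ((1 - (j : ℝ) ^ 2) • x j) - ((1 - (j : ℝ) ^ 2) • x j) * Λ -
            (2 * ((j + 1 : ℕ) : ℝ) - 1) • x (j + 1) := by
        rw [mul_smul_comm, smul_mul_assoc, ← smul_sub, ← hx]
        push_cast
        module
      rw [hx (j + 1), e2]
      generalize (1 - (j : ℝ) ^ 2) • x j = y at *
      generalize (2 * ((j + 1 : ℕ) : ℝ) - 1) • x (j + 1) = z at *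
      linear_combination (norm := noncomm_ring)
        -e * x (j + 1) + Λ * ih - ih * Λ + x (j + 1) * e - e3
  have hnil : ∃ N, x (N + 2) = 0 := by
    have hΛ : IsNilpotent Λ := ⟨n + 1, h.lam_pow⟩
    obtain ⟨N, hN⟩ := (LinearMap.commute_mulLeft_right (R := ℝ) Λ Λ).isNilpotent_sub
      ((LinearMap.isNilpotent_mulLeft_iff ℝ Λ).mpr hΛ)
      ((LinearMap.isNilpotent_mulRight_iff ℝ Λ).mpr hΛ)
    exact ⟨N, by simp only [x]; rw [add_comm, pow_add, hN, mul_zero]; rfl⟩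
  have h2 : x 2 = 0 := by
    obtain ⟨N, hN⟩ := hnil
    induction N with
    | zero => exact hN
    | succ N ih =>
      refine ih ?_
      have e := hLx (N + 2)
      rw [hN, mul_zero, zero_mul, zero_add] at e
      refine (smul_eq_zero.mp e.symm).resolve_left ?_
      push_cast
      nlinarith [(Nat.cast_nonneg N : (0 : ℝ) ≤ N)]
  rw [hx 1, hx 0, hx0] at h2
  exact sub_eq_zero.mp h2

theorem IsLefschetzTriple.lef_mul_lam_pow (h : IsLefschetzTriple n L Λ H) (j : ℕ) {m : ℝ} {p : R}
    (hp : H * p = m • p) :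
    L * (Λ * (Λ ^ j * p)) = Λ ^ j * (L * Λ * p - (j * (m + j + 1)) • p) := by
  induction j generalizing m p with
  | zero => simp [mul_assoc]
  | succ j ih =>
    have hw : H * (Λ * p) = (m + 2) • (Λ * p) := by
      rw [← mul_assoc, h.weight_mul_lam, add_mul, mul_assoc, hp, mul_smul_comm, add_smul,
        two_smul, mul_assoc, two_mul]
    have e : L * Λ * (Λ * p) = Λ * (L * Λ * p) - (m + 2) • (Λ * p) := by
      rw [← hw]
      linear_combination (norm := noncomm_ring) -h.lam_mul_lef * Λ * p
    rw [pow_succ, mul_assoc (Λ ^ j), ih hw, e, mul_assoc (Λ ^ j), mul_sub Λ, mul_smul_comm _ Λ]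
    congr 1
    push_cast
    module

/-- `L^j Λ^j` acts on elements of weight `m` as a polynomial in `L Λ`. -/
theorem IsLefschetzTriple.lef_pow_mul_lam_pow (h : IsLefschetzTriple n L Λ H) (j : ℕ) {m : ℝ}
    {p : R} (hp : H * p = m • p) :
    L ^ j * Λ ^ j * p = Polynomial.aeval (L * Λ)
      (∏ i ∈ Finset.range j, (Polynomial.X - Polynomial.C (i * (m + i + 1)))) * p := by
  induction j generalizing p with
  | zero => simp
  | succ j ih =>
    have hc : H * (L * Λ) = L * Λ * H := by
      linear_combination (norm := noncomm_ring) h.weight_mul_lef * Λ + L * h.weight_mul_lam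
    have hq : H * (L * Λ * p - (j * (m + j + 1)) • p) =
        m • (L * Λ * p - (j * (m + j + 1)) • p) := by
      rw [mul_sub, ← mul_assoc, hc, mul_assoc, hp, mul_smul_comm, mul_smul_comm, hp, smul_sub,
        smul_comm m]
    rw [Finset.prod_range_succ, map_mul, map_sub, Polynomial.aeval_X, Polynomial.aeval_C, mul_assoc,
      mul_assoc (Polynomial.aeval _ _), sub_mul, ← Algebra.smul_def, ← ih hq, pow_succ, pow_succ',
      mul_assoc (L ^ j), mul_assoc (L ^ j)]
    rw [mul_assoc Λ, h.lef_mul_lam_pow j hp]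

/-- `Λ^j L^j` acts on elements of weight `m` as a polynomial in `L Λ`. -/
theorem IsLefschetzTriple.lam_pow_mul_lef_pow (h : IsLefschetzTriple n L Λ H) (j : ℕ) {m : ℝ}
    {p : R} (hp : H * p = m • p) :
    Λ ^ j * L ^ j * p = Polynomial.aeval (L * Λ)
      (∏ i ∈ Finset.range j, (Polynomial.X - Polynomial.C (-((i + 1) * (m - i))))) * p := by
  induction j generalizing p with
  | zero => simp
  | succ j ih =>
    have hc : H * (L * Λ) = L * Λ * H := by
      linear_combination (norm := noncomm_ring) h.weight_mul_lef * Λ + L * h.weight_mul_lam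
    have hq : H * (L * Λ * p - (-((j + 1) * (m - j))) • p) =
        m • (L * Λ * p - (-((j + 1) * (m - j))) • p) := by
      rw [mul_sub, ← mul_assoc, hc, mul_assoc, hp, mul_smul_comm, mul_smul_comm, hp, smul_sub,
        smul_comm m]
    have h1 := h.swap.lef_mul_lam_pow j (m := -m) (p := p) (by rw [neg_mul, hp, neg_smul])
    have h2 : Λ * L * p - (j * (-m + j + 1)) • p =
        L * Λ * p - (-((j + 1) * (m - j))) • p := by
      rw [h.lam_mul_lef, add_mul, hp]
      module
    rw [Finset.prod_range_succ, map_mul, map_sub, Polynomial.aeval_X, Polynomial.aeval_C, mul_assoc,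
      mul_assoc (Polynomial.aeval _ _), sub_mul, ← Algebra.smul_def, ← ih hq, pow_succ, pow_succ',
      mul_assoc (Λ ^ j), mul_assoc (Λ ^ j)]
    rw [mul_assoc L, h1, h2]

/-- On elements of weight `m`, the operator `Λ^m L^m` is a polynomial in `L Λ` with negative roots,
while `L Λ` is annihilated by a polynomial with non-negative roots. The two are coprime, and the
Bézout coefficient inverts `Λ^m L^m`; it depends on `n` and `m` only. -/
theorem exists_inverse_polynomial (n m : ℕ) : ∃ v : Polynomial ℝ,
    ∀ {R : Type*} [Ring R] [Algebra ℝ R] {L Λ H p : R}, IsLefschetzTriple n L Λ H →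
      H * p = (m : ℝ) • p →
      Polynomial.aeval (L * Λ) v * (Λ ^ m * (L ^ m * p)) = p ∧
      Λ ^ m * (L ^ m * (Polynomial.aeval (L * Λ) v * p)) = p := by
  let P : Polynomial ℝ :=
    ∏ i ∈ Finset.range (n + 1), (Polynomial.X - Polynomial.C ((i : ℝ) * ((m : ℝ) + i + 1)))
  let B : Polynomial ℝ :=
    ∏ i ∈ Finset.range m, (Polynomial.X - Polynomial.C (-(((i : ℝ) + 1) * ((m : ℝ) - i))))
  have hcop : IsCoprime P B := by
    refine IsCoprime.prod_left fun i _ => IsCoprime.prod_right fun j hj => ?_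
    refine Polynomial.isCoprime_X_sub_C_of_isUnit_sub (Ne.isUnit (ne_of_gt ?_))
    have h1 : (j : ℝ) < m := by exact_mod_cast Finset.mem_range.mp hj
    have h2 : 0 < ((j : ℝ) + 1) * ((m : ℝ) - j) := mul_pos (by positivity) (by linarith)
    have h3 : 0 ≤ (i : ℝ) * ((m : ℝ) + i + 1) := by positivity
    linarith
  obtain ⟨u, v, huv⟩ := hcop
  refine ⟨v, fun {R} _ _ {L Λ H p} h hp => ?_⟩
  have h1 : Polynomial.aeval (L * Λ) P * p = 0 := by
    rw [← h.lef_pow_mul_lam_pow (n + 1) hp, h.lef_pow, zero_mul, zero_mul]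
  have hc : H * (L * Λ) = L * Λ * H := by
    linear_combination (norm := noncomm_ring) h.weight_mul_lef * Λ + L * h.weight_mul_lam
  have hq : H * (Polynomial.aeval (L * Λ) v * p) =
      (m : ℝ) • (Polynomial.aeval (L * Λ) v * p) := by
    have h2 : Commute H (Polynomial.aeval (L * Λ) v) :=
      Polynomial.induction_on v (fun a => by
          rw [Polynomial.aeval_C]; exact (Algebra.commutes a H).symm)
        (fun p q hp hq => by rw [map_add]; exact hp.add_right hq)
        fun k a _ => by
          rw [map_mul, Polynomial.aeval_C, map_pow, Polynomial.aeval_X]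
          exact Commute.mul_right (Algebra.commutes a H).symm
            (Commute.pow_right (show Commute H (L * Λ) from hc) _)
    rw [← mul_assoc, h2.eq, mul_assoc, hp, mul_smul_comm]
  have h3 := congrArg (fun q => Polynomial.aeval (L * Λ) q * p) huv
  simp only [map_add, map_mul, map_one, one_mul, add_mul, mul_assoc, h1, mul_zero, zero_add] at h3
  constructor
  · rw [← mul_assoc (Λ ^ m), h.lam_pow_mul_lef_pow m hp]
    exact h3
  · rw [← mul_assoc (Λ ^ m), h.lam_pow_mul_lef_pow m hq, ← mul_assoc, ← map_mul, mul_comm,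
      map_mul, mul_assoc]
    exact h3

end Triple

/-! ### Commutation of the Lefschetz operator with the Laplacians -/

section Laplacian

variable {R : Type*} [Ring R] [Algebra ℝ R]

/-- The relations between the operators on the differential forms of an almost Kähler manifold: the
Lefschetz triple `L`, `Λ`, `H`, the exterior derivative `d`, the parity `ε = (-1)^k`, the sign
`κ`, the symplectic star operator `s` and the Hodge star operator `h`. -/
structure KahlerRelations (n : ℕ) (L Λ H d ε κ s h : R) : Prop where
  triple : IsLefschetzTriple n L Λ H
  lef_mul_d : L * d = d * L
  weight_mul_d : H * d = d * H - d
  d_mul_d : d * d = 0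
  sign_mul_d : κ * d = -(d * κ * ε)
  parity_mul_d : ε * d = -(d * ε)
  parity_sq : ε * ε = 1
  parity_mul_star : ε * s = s * ε
  parity_mul_hodge : ε * h = h * ε
  parity_mul_lef : ε * L = L * ε
  parity_mul_lam : ε * Λ = Λ * ε
  star_eq : s = weyl n L Λ * κ
  star_sq : s * s = 1
  hodge_sq : h * h = ε
  hodge_lef_hodge : h * L * h = Λ * ε

namespace KahlerRelations

variable {n : ℕ} {L Λ H d ε κ s h : R}

/-- The symplectic codifferential is the commutator `[d, Λ]`, because the symplectic star is the
Weyl element of the Lefschetz triple up to sign. -/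
theorem star_d_star (K : KahlerRelations n L Λ H d ε κ s h) :
    -(s * d * s * ε) = d * Λ - Λ * d := by
  have h1 := (weyl_mul (a := d) (f := Λ * d - d * Λ) K.triple.lef_pow K.triple.lam_pow K.lef_mul_d
    (by abel) (K.triple.lam_mul_commutator K.lef_mul_d K.weight_mul_d) (by
      linear_combination (norm := noncomm_ring) -K.triple.lam_mul_lef * d + Λ * K.lef_mul_d -
        K.lef_mul_d * Λ + d * K.triple.lam_mul_lef - K.weight_mul_d)).1
  have h2 := K.star_eq
  have h3 := K.sign_mul_d
  have h4 := K.star_sq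
  have h5 := K.parity_mul_star
  have h6 := K.parity_sq
  have h7 : s * d = (Λ * d - d * Λ) * s * ε := by
    rw [h2]
    linear_combination (norm := noncomm_ring) weyl n L Λ * h3 - h1 * κ * ε
  linear_combination (norm := noncomm_ring) -h7 * s * ε - (Λ * d - d * Λ) * s * h5 * ε -
    (Λ * d - d * Λ) * s * s * h6 - (Λ * d - d * Λ) * h4

theorem lef_mul_hodge (K : KahlerRelations n L Λ H d ε κ s h) : L * h = h * Λ := by
  have h1 := K.hodge_sq
  have h2 := K.hodge_lef_hodge
  have h3 := K.parity_sq
  have h4 := K.parity_mul_hodge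
  have h5 : ε * (L * h) = ε * (h * Λ) := by
    linear_combination (norm := noncomm_ring) -h1 * L * h + h * h2 - h * K.parity_mul_lam
      - h4 * Λ
  have h6 := congrArg (ε * ·) h5
  simpa only [← mul_assoc, h3, one_mul] using h6

theorem hodge_mul_lef (K : KahlerRelations n L Λ H d ε κ s h) : h * L = Λ * h := by
  have h5 : h * L * ε = Λ * h * ε := by
    linear_combination (norm := noncomm_ring) -h * L * K.hodge_sq + K.hodge_lef_hodge * h +
      Λ * K.parity_mul_hodge
  have h6 := congrArg (· * ε) h5
  simpa only [mul_assoc, K.parity_sq, mul_one] using h6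

/-- The Lefschetz operator commutes with both fourth-order Laplacians, written in terms of the
symplectic codifferential `δ = d^Λ`, since `[L, δ] = -d`, `[L, d^*] = d^{Λ*}`, and `L` commutes
with `d`, `d^{Λ*}`, `d δ` and `(d δ)^*`. -/
theorem lef_mul_laplacian (K : KahlerRelations n L Λ H d ε κ s h) (c : ℝ) {δ dS δS A : R}
    (hδ : δ = -(s * d * s * ε)) (hdS : dS = -(h * d * h)) (hδS : δS = h * δ * h)
    (hA : A = -(h * d * δ * h * ε)) :
    L * (d * δ * A + c • (dS * d + δS * δ)) = (d * δ * A + c • (dS * d + δS * δ)) * L ∧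
      L * (A * (d * δ) + c • (d * dS + δ * δS)) = (A * (d * δ) + c • (d * dS + δ * δS)) * L := by
  have e1 : δ * δ = 0 := by
    rw [hδ]
    linear_combination (norm := noncomm_ring) s * d * K.star_sq * d * s +
      s * d * s * K.parity_mul_star * d * s * ε + s * d * s * s * K.parity_mul_d * s * ε +
      s * d * K.star_sq * (-d * ε) * s * ε - s * K.d_mul_d * ε * s * ε - s * d * K.star_sq * d * s
  rw [K.star_d_star] at hδ
  have e2 : L * δ = δ * L - d := by
    rw [hδ]
    linear_combination (norm := noncomm_ring) K.lef_mul_d * Λ - d * K.triple.lam_mul_lef +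
      K.triple.lam_mul_lef * d - Λ * K.lef_mul_d + K.weight_mul_d
  have e3 : Λ * δ = δ * Λ := by
    have := K.triple.lam_mul_commutator K.lef_mul_d K.weight_mul_d
    rw [hδ]
    linear_combination (norm := noncomm_ring) -this
  have e4 : L * dS = dS * L + δS := by
    rw [hdS, hδS, hδ]
    linear_combination (norm := noncomm_ring) -K.lef_mul_hodge * d * h + h * d * K.hodge_mul_lef
  have e5 : L * δS = δS * L := by
    rw [hδS]
    linear_combination (norm := noncomm_ring) K.lef_mul_hodge * δ * h - h * δ * K.hodge_mul_lef
      + h * e3 * h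
  have e6 : L * A = A * L := by
    rw [hA]
    linear_combination (norm := noncomm_ring) -K.lef_mul_hodge * d * δ * h * ε
      + h * d * δ * K.hodge_mul_lef * ε + h * d * δ * h * K.parity_mul_lef - h * hδ * δ * h * ε
      + h * e1 * h * ε - h * d * e3 * h * ε
  have e7 := K.lef_mul_d
  have e8 := K.d_mul_d
  have e9 : L * (dS * d + δS * δ) = (dS * d + δS * δ) * L := by
    linear_combination (norm := noncomm_ring) e4 * d + dS * e7 + e5 * δ + δS * e2
  have e10 : L * (d * dS + δ * δS) = (d * dS + δ * δS) * L := by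
    linear_combination (norm := noncomm_ring) e7 * dS + d * e4 + e2 * δS + δ * e5
  constructor
  · rw [mul_add, add_mul, mul_smul_comm, smul_mul_assoc, e9]
    congr 1
    linear_combination (norm := noncomm_ring) e7 * δ * A + d * e2 * A + d * δ * e6 - e8 * A
  · rw [mul_add, add_mul, mul_smul_comm, smul_mul_assoc, e10]
    congr 1
    linear_combination (norm := noncomm_ring) e6 * d * δ + A * e7 * δ + A * d * e2 - A * e8

end KahlerRelations

end Laplacian

/-! ### Smooth families of forms on the model space -/

section FiniteDim

variable {V : Type*} [AddCommGroup V] [Module ℝ V] [TopologicalSpace V] [IsTopologicalAddGroup V]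
  [ContinuousSMul ℝ V] [T2Space V]
  {ι : Type*} [Fintype ι]

/-- The components of a form in a basis. -/
def components (e : Module.Basis ι ℝ V) (k : ℕ) :
    (V [⋀^Fin k]→L[ℝ] ℝ) →ₗ[ℝ] ((Fin k → ι) → ℝ) where
  toFun α I := α fun a => e (I a)
  map_add' _ _ := rfl
  map_smul' _ _ := rfl

theorem components_injective (e : Module.Basis ι ℝ V) (k : ℕ) :
    Function.Injective (components e k) := by
  intro α β h
  ext v
  rw [apply_eq_sum_basis e α, apply_eq_sum_basis e β]
  exact Finset.sum_congr rfl fun I _ => congrArg _ (congrFun h I)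

theorem finiteDimensional_forms (e : Module.Basis ι ℝ V) (k : ℕ) :
    FiniteDimensional ℝ (V [⋀^Fin k]→L[ℝ] ℝ) :=
  FiniteDimensional.of_injective (components e k) (components_injective e k)

end FiniteDim

theorem lefschetz_one {V : Type*} [AddCommGroup V] [Module ℝ V] [TopologicalSpace V]
    (Ω : V [⋀^Fin 2]→L[ℝ] ℝ) : lefschetz Ω (oneForm V) = Ω := by
  have h1 : lefschetz Ω (oneForm V) = wedge Ω (oneForm V) := toDegree_self (wedge Ω (oneForm V))
  rw [h1]
  ext v
  rw [wedge_apply]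
  have h2 : ∀ σ : Equiv.Perm (Fin (2 + 0)), Equiv.Perm.sign σ •
      (Ω (fun i => v (σ (Fin.castAdd 0 i))) * oneForm V fun i => v (σ (Fin.natAdd 2 i))) = Ω v := by
    intro σ
    have h3 : Ω (fun i => v (σ (Fin.castAdd 0 i))) = Equiv.Perm.sign σ • Ω v :=
      Ω.toAlternatingMap.map_perm v σ
    have h4 : (oneForm V fun i => v (σ (Fin.natAdd 2 i))) = 1 := rfl
    rw [h3, h4, mul_one, smul_smul, Int.units_mul_self, one_smul]
  rw [Finset.sum_congr rfl fun σ _ => h2 σ]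
  simp [Fintype.card_perm]

section Model

variable {E : Type*} [NormedAddCommGroup E] [NormedSpace ℝ E] {ι : Type*} [Fintype ι]
  {U : Set E} {k : ℕ}

/-- A family of forms is smooth if its components are. -/
theorem contDiffOn_of_components (e : Module.Basis ι ℝ E) {α : E → E [⋀^Fin k]→L[ℝ] ℝ}
    (h : ∀ I : Fin k → ι, ContDiffOn ℝ ∞ (fun y => α y fun a => e (I a)) U) :
    ContDiffOn ℝ ∞ α U := by
  have := finiteDimensional_forms e k
  obtain ⟨g, hg⟩ := (components e k).exists_leftInverse_of_injective
    (LinearMap.ker_eq_bot.mpr (components_injective e k))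
  have h1 : α = fun y => LinearMap.toContinuousLinearMap g (components e k (α y)) := by
    funext y
    exact (LinearMap.congr_fun hg (α y)).symm
  rw [h1]
  exact (ContinuousLinearMap.contDiff _).comp_contDiffOn (contDiffOn_pi.mpr h)

theorem contDiffOn_apply {α : E → E [⋀^Fin k]→L[ℝ] ℝ} (h : ContDiffOn ℝ ∞ α U) (v : Fin k → E) :
    ContDiffOn ℝ ∞ (fun y => α y v) U :=
  (ContinuousAlternatingMap.apply ℝ E ℝ v).contDiff.comp_contDiffOn h

theorem contDiffOn_det [DecidableEq ι] {A : E → Matrix ι ι ℝ}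
    (h : ∀ i j, ContDiffOn ℝ ∞ (fun y => A y i j) U) :
    ContDiffOn ℝ ∞ (fun y => (A y).det) U := by
  simp only [Matrix.det_apply]
  exact ContDiffOn.sum fun σ _ => (contDiffOn_prod fun i _ => h _ _).const_smul _

theorem contDiffOn_inv [DecidableEq ι] {A : E → Matrix ι ι ℝ}
    (h : ∀ i j, ContDiffOn ℝ ∞ (fun y => A y i j) U) (hU : ∀ y ∈ U, IsUnit (A y).det) (i j : ι) :
    ContDiffOn ℝ ∞ (fun y => (A y)⁻¹ i j) U := by
  simp only [Matrix.inv_def, Ring.inverse_eq_inv', Matrix.smul_apply, smul_eq_mul,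
    Matrix.adjugate_apply]
  refine ((contDiffOn_det h).inv fun y hy => (hU y hy).ne_zero).mul (contDiffOn_det fun a b => ?_)
  by_cases hj : a = j
  · subst hj; simpa using contDiffOn_const
  · simpa [Matrix.updateRow_ne hj] using h a b

theorem contDiffOn_toDegree {α : E → E [⋀^Fin k]→L[ℝ] ℝ} (h : ContDiffOn ℝ ∞ α U) (l : ℕ) :
    ContDiffOn ℝ ∞ (fun y => toDegree l (α y)) U := by
  by_cases hk : k = l
  · subst hk; simpa only [toDegree_self] using h
  · simp only [toDegree_of_ne hk]; exact contDiffOn_const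

theorem contDiffOn_lefschetz (e : Module.Basis ι ℝ E) {Ω : E → E [⋀^Fin 2]→L[ℝ] ℝ}
    {α : E → E [⋀^Fin k]→L[ℝ] ℝ} (hΩ : ContDiffOn ℝ ∞ Ω U) (h : ContDiffOn ℝ ∞ α U) :
    ContDiffOn ℝ ∞ (fun y => lefschetz (Ω y) (α y)) U := by
  refine contDiffOn_toDegree (contDiffOn_of_components e fun I => ?_) _
  simp only [wedge_apply]
  exact contDiffOn_const.mul (ContDiffOn.sum fun σ _ =>
    ((contDiffOn_apply hΩ _).mul (contDiffOn_apply h _)).const_smul _)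

theorem contDiffOn_star [DecidableEq ι] (e : Module.Basis ι ℝ E) {B : E → E → E → ℝ} {N : ℕ}
    {vol : E → E [⋀^Fin N]→L[ℝ] ℝ} {α : E → E [⋀^Fin k]→L[ℝ] ℝ}
    (hB : ∀ i j, ContDiffOn ℝ ∞ (fun y => B y (e i) (e j)) U)
    (hU : ∀ y ∈ U, IsUnit (gram e (B y)).det) (hvol : ContDiffOn ℝ ∞ vol U)
    (h : ContDiffOn ℝ ∞ α U) (l : ℕ) :
    ContDiffOn ℝ ∞ (fun y => star e (B y) (vol y) l (α y)) U := by
  by_cases hk : k + l = N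
  · simp only [star, hk, dif_pos]
    refine ContDiffOn.const_smul _ (ContDiffOn.sum fun I _ => ContDiffOn.sum fun J _ => ?_)
    refine ContDiffOn.smul ((contDiffOn_prod fun a _ => contDiffOn_inv hB hU _ _).mul
      (contDiffOn_apply h _)) (contDiffOn_of_components e fun K => ?_)
    simp only [contract_apply]
    exact contDiffOn_apply hvol _
  · simp only [star, hk, dif_neg, not_false_eq_true]
    exact contDiffOn_const

theorem contDiffOn_pairing [DecidableEq ι] (e : Module.Basis ι ℝ E) {B : E → E → E → ℝ}
    {α β : E → E [⋀^Fin k]→L[ℝ] ℝ}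
    (hB : ∀ i j, ContDiffOn ℝ ∞ (fun y => B y (e i) (e j)) U)
    (hU : ∀ y ∈ U, IsUnit (gram e (B y)).det)
    (hα : ContDiffOn ℝ ∞ α U) (hβ : ContDiffOn ℝ ∞ β U) :
    ContDiffOn ℝ ∞ (fun y => pairing e (B y) (α y) (β y)) U := by
  unfold pairing
  exact contDiffOn_const.mul (ContDiffOn.sum fun I _ => ContDiffOn.sum fun J _ =>
    (contDiffOn_prod fun a _ => contDiffOn_inv hB hU _ _).mul
      ((contDiffOn_apply hα _).mul (contDiffOn_apply hβ _)))

theorem contDiffOn_extDeriv {α : E → E [⋀^Fin k]→L[ℝ] ℝ} (hU : IsOpen U)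
    (h : ContDiffOn ℝ ∞ α U) : ContDiffOn ℝ ∞ (extDeriv α) U :=
  (ContinuousAlternatingMap.alternatizeUncurryFinCLM ℝ E ℝ (n := k)).contDiff.comp_contDiffOn
    (h.fderiv_of_isOpen hU (by simp))

theorem alternatizeUncurryFin_eq_sum (e : Module.Basis ι ℝ E)
    (f : E →L[ℝ] E [⋀^Fin k]→L[ℝ] ℝ) :
    ContinuousAlternatingMap.alternatizeUncurryFin f =
      ∑ i, extMul (dualCov e i) (f (e i)) := by
  ext v
  rw [ContinuousAlternatingMap.alternatizeUncurryFin_apply, ContinuousAlternatingMap.sum_apply]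
  simp only [extMul_apply]
  rw [Finset.sum_comm]
  refine Finset.sum_congr rfl fun j _ => ?_
  conv_lhs => rw [← e.sum_repr (v j)]
  simp only [map_sum, map_smul, ContinuousAlternatingMap.sum_apply,
    ContinuousAlternatingMap.smul_apply, dualCov_apply, smul_eq_mul, zsmul_eq_mul, Finset.mul_sum]
  push_cast
  rfl

theorem fderiv_lefschetz (e : Module.Basis ι ℝ E) {Ω : E → E [⋀^Fin 2]→L[ℝ] ℝ}
    {α : E → E [⋀^Fin k]→L[ℝ] ℝ} {y : E} (hΩ : DifferentiableAt ℝ Ω y)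
    (h : DifferentiableAt ℝ α y) (u : E) :
    fderiv ℝ (fun y => lefschetz (Ω y) (α y)) y u =
      lefschetz (Ω y) (fderiv ℝ α y u) + lefschetz (fderiv ℝ Ω y u) (α y) := by
  have := finiteDimensional_forms e k
  have := finiteDimensional_forms e 2
  let B := LinearMap.toContinuousBilinearMap (lefschetzHom (V := E) k)
  have h1 := (B.hasFDerivAt_of_bilinear hΩ.hasFDerivAt h.hasFDerivAt).fderiv
  exact DFunLike.congr_fun h1 u

/-- Exterior multiplication by a closed two-form commutes with the exterior derivative. -/
theorem extDeriv_lefschetz (e : Module.Basis ι ℝ E) {Ω : E → E [⋀^Fin 2]→L[ℝ] ℝ}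
    {α : E → E [⋀^Fin k]→L[ℝ] ℝ} {y : E} (hΩ : DifferentiableAt ℝ Ω y)
    (h : DifferentiableAt ℝ α y) (hd : extDeriv Ω y = 0) :
    extDeriv (fun y => lefschetz (Ω y) (α y)) y = lefschetz (Ω y) (extDeriv α y) := by
  classical
  let A : Module.End ℝ (Forms E) := ∑ i, eps (dualCov e i) * lef (fderiv ℝ Ω y (e i))
  -- `A` is exterior multiplication by `dΩ`, as both anticommute with exterior multiplication.
  have hA : A = 0 := by
    refine end_ext e (fun ξ => -eps ξ) ?_ (fun ξ => ?_) fun ξ => by simp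
    · ext1 l
      rw [LinearMap.sum_apply, Forms.sum_apply]
      match l with
      | 0 => simp
      | 1 => simp
      | 2 => simp
      | 3 =>
        simp only [Module.End.mul_apply, eps_succ, lef_add_two, single_same, lefschetz_one]
        rw [← alternatizeUncurryFin_eq_sum]
        exact hd
      | l + 4 =>
        simp only [Module.End.mul_apply, eps_succ, lef_add_two,
          single_of_ne (show l + 1 ≠ 0 by omega), ← lefschetzHom_apply, map_zero]
        simp
    · rw [Finset.sum_mul, Finset.mul_sum]
      refine Finset.sum_congr rfl fun i _ => ?_
      rw [mul_assoc, lef_mul_eps e, ← mul_assoc, eps_mul_eps, neg_mul, neg_mul, mul_assoc]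
  have h1 : ∑ i, extMul (dualCov e i) (lefschetz (fderiv ℝ Ω y (e i)) (α y)) = 0 := by
    have := congrArg (fun T : Module.End ℝ (Forms E) => T (single k (α y)) (k + 3)) hA
    simpa only [A, LinearMap.sum_apply, Forms.sum_apply, Module.End.mul_apply, eps_succ,
      lef_add_two, single_same, LinearMap.zero_apply, Forms.zero_apply] using this
  have h2 : ∀ i, extMul (dualCov e i) (lefschetz (Ω y) (fderiv ℝ α y (e i))) =
      lefschetz (Ω y) (extMul (dualCov e i) (fderiv ℝ α y (e i))) := fun i => by
    have := congrArg (fun T : Module.End ℝ (Forms E) => T (single k (fderiv ℝ α y (e i))) (k + 3))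
      (lef_mul_eps e (Ω y) (dualCov e i))
    simpa only [Module.End.mul_apply, eps_succ, lef_add_two, single_same] using this.symm
  rw [extDeriv, extDeriv, alternatizeUncurryFin_eq_sum e, alternatizeUncurryFin_eq_sum e]
  simp only [fderiv_lefschetz e hΩ h, map_add, Finset.sum_add_distrib]
  rw [h1, add_zero, ← lefschetzHom_apply, map_sum]
  exact Finset.sum_congr rfl fun i _ => h2 i

end Model

/-! ### Local representations in charts -/

section Charts

theorem two_le_smoothness : minSmoothness ℝ 2 ≤ (∞ : WithTop ℕ∞) := by
  rw [minSmoothness_of_isRCLikeNormedField]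
  exact ENat.LEInfty.out

variable {m : ℕ} {M : Type*} [TopologicalSpace M] [ChartedSpace (Model m) M]

instance (x : M) : T2Space (TangentSpace (𝓡 m) x) := inferInstanceAs (T2Space (Model m))

/-- The derivative of the inverse of the preferred chart at `x₀`, the map by which `localRep`
pulls back. -/
abbrev chartDeriv (x₀ : M) (y : Model m) :
    Model m →L[ℝ] TangentSpace (𝓡 m) ((chartAt (Model m) x₀).symm y) :=
  mfderiv (𝓡 m) (𝓡 m) (chartAt (Model m) x₀).symm y

theorem localRep_eq {k : ℕ} (α : Form m M k) (x₀ : M) (y : Model m) :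
    localRep α x₀ y =
      (α ((chartAt (Model m) x₀).symm y)).compContinuousLinearMap (chartDeriv x₀ y) := rfl

theorem form_congr {k : ℕ} (α : Form m M k) {p q : M} (h : p = q) (v : Fin k → Model m) :
    (α p : Model m [⋀^Fin k]→L[ℝ] ℝ) v = (α q : Model m [⋀^Fin k]→L[ℝ] ℝ) v := by
  subst h; rfl

variable [IsManifold (𝓡 m) ∞ M]

theorem mfderiv_chart_comp_chartDeriv (x₀ : M) {y : Model m}
    (hy : y ∈ (chartAt (Model m) x₀).target) :
    (mfderiv (𝓡 m) (𝓡 m) (chartAt (Model m) x₀) ((chartAt (Model m) x₀).symm y)).comp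
      (chartDeriv x₀ y) = ContinuousLinearMap.id ℝ (Model m) := by
  have : IsManifold (𝓡 m) 1 M := IsManifold.of_le (n := ∞) (by simp)
  exact (mdifferentiable_chart (I := 𝓡 m) x₀).comp_symm_deriv hy

theorem chartDeriv_comp_mfderiv_chart (x₀ : M) {x : M} (hx : x ∈ (chartAt (Model m) x₀).source) :
    (mfderiv (𝓡 m) (𝓡 m) (chartAt (Model m) x₀).symm (chartAt (Model m) x₀ x)).comp
      (mfderiv (𝓡 m) (𝓡 m) (chartAt (Model m) x₀) x) =
      ContinuousLinearMap.id ℝ (TangentSpace (𝓡 m) x) := by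
  have : IsManifold (𝓡 m) 1 M := IsManifold.of_le (n := ∞) (by simp)
  exact (mdifferentiable_chart (I := 𝓡 m) x₀).symm_comp_deriv hx

theorem chartDeriv_bijective (x₀ : M) {y : Model m} (hy : y ∈ (chartAt (Model m) x₀).target) :
    Function.Bijective (chartDeriv x₀ y) := by
  have h1 := mfderiv_chart_comp_chartDeriv x₀ hy
  have h2 := chartDeriv_comp_mfderiv_chart x₀ ((chartAt (Model m) x₀).map_target hy)
  rw [(chartAt (Model m) x₀).right_inv hy] at h2
  constructor
  · intro u v huv
    have := fun w => DFunLike.congr_fun h1 w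
    refine (this u).symm.trans (Eq.trans ?_ (this v))
    exact congrArg (mfderiv (𝓡 m) (𝓡 m) (chartAt (Model m) x₀) ((chartAt (Model m) x₀).symm y)) huv
  · intro u
    exact ⟨_, DFunLike.congr_fun h2 u⟩

/-- The coordinate change between two preferred charts. -/
abbrev transition (x₀ x : M) : Model m → Model m :=
  chartAt (Model m) x ∘ (chartAt (Model m) x₀).symm

variable {x₀ x : M} {y : Model m}

theorem contDiffAt_transition (hy : y ∈ (chartAt (Model m) x₀).target)
    (hx : (chartAt (Model m) x₀).symm y ∈ (chartAt (Model m) x).source) :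
    ContDiffAt ℝ ∞ (transition x₀ x) y := by
  rw [← contMDiffAt_iff_contDiffAt]
  exact ContMDiffAt.comp y
    ((contMDiffOn_chart (I := 𝓡 m)).contMDiffAt ((chartAt (Model m) x).open_source.mem_nhds hx))
    ((contMDiffOn_chart_symm (I := 𝓡 m)).contMDiffAt
      ((chartAt (Model m) x₀).open_target.mem_nhds hy))

theorem mdifferentiableAt_chart_symm (hy : y ∈ (chartAt (Model m) x₀).target) :
    MDifferentiableAt (𝓡 m) (𝓡 m) (chartAt (Model m) x₀).symm y := by
  have : IsManifold (𝓡 m) 1 M := IsManifold.of_le (n := ∞) (by simp)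
  exact (mdifferentiable_chart (I := 𝓡 m) x₀).mdifferentiableAt_symm hy

theorem mdifferentiableAt_chart (hx : x ∈ (chartAt (Model m) x₀).source) :
    MDifferentiableAt (𝓡 m) (𝓡 m) (chartAt (Model m) x₀) x := by
  have : IsManifold (𝓡 m) 1 M := IsManifold.of_le (n := ∞) (by simp)
  exact (mdifferentiable_chart (I := 𝓡 m) x₀).mdifferentiableAt hx

/-- Local representations in two charts are related by pull-back along the coordinate change. -/
theorem localRep_transition {k : ℕ} (α : Form m M k) (hy : y ∈ (chartAt (Model m) x₀).target)
    (hx : (chartAt (Model m) x₀).symm y ∈ (chartAt (Model m) x).source) :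
    localRep α x₀ y = (localRep α x (transition x₀ x y)).compContinuousLinearMap
      (fderiv ℝ (transition x₀ x) y) := by
  ext v
  have hp : (chartAt (Model m) x).symm (transition x₀ x y) = (chartAt (Model m) x₀).symm y :=
    (chartAt (Model m) x).left_inv hx
  refine Eq.trans ?_ (form_congr α hp.symm _)
  change α ((chartAt (Model m) x₀).symm y) _ = _
  congr 1
  funext i
  have h1 : mfderiv (𝓡 m) (𝓡 m) ((chartAt (Model m) x).symm ∘ transition x₀ x) y =
      mfderiv (𝓡 m) (𝓡 m) (chartAt (Model m) x₀).symm y := by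
    refine Filter.EventuallyEq.mfderiv_eq ?_
    have : (chartAt (Model m) x₀).symm ⁻¹' (chartAt (Model m) x).source ∈ nhds y :=
      ((chartAt (Model m) x₀).symm.continuousAt hy).preimage_mem_nhds
        ((chartAt (Model m) x).open_source.mem_nhds hx)
    filter_upwards [this] with z hz
    exact (chartAt (Model m) x).left_inv hz
  have h2 : mfderiv (𝓡 m) (𝓡 m) ((chartAt (Model m) x).symm ∘ transition x₀ x) y =
      (mfderiv (𝓡 m) (𝓡 m) (chartAt (Model m) x).symm (transition x₀ x y)).comp
        (mfderiv (𝓡 m) (𝓡 m) (transition x₀ x) y) :=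
    mfderiv_comp y (mdifferentiableAt_chart_symm ((chartAt (Model m) x).map_source hx))
      ((contDiffAt_transition hy hx).contMDiffAt.mdifferentiableAt (by simp))
  rw [mfderiv_eq_fderiv] at h2
  exact (DFunLike.congr_fun (h1.symm.trans h2) (v i))

theorem differentiableAt_localRep {k : ℕ} {α : Form m M k} (hα : IsSmoothForm α)
    (hy : y ∈ (chartAt (Model m) x₀).target) : DifferentiableAt ℝ (localRep α x₀) y :=
  ((hα x₀).contDiffAt ((chartAt (Model m) x₀).open_target.mem_nhds hy)).differentiableAt (by simp)

/-- The exterior derivative is computed by the exterior derivative of the local representation in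
every chart. -/
theorem localRep_extD {k : ℕ} {α : Form m M k} (hα : IsSmoothForm α)
    (hy : y ∈ (chartAt (Model m) x₀).target) :
    localRep (extD α) x₀ y = extDeriv (localRep α x₀) y := by
  set x := (chartAt (Model m) x₀).symm y with hxdef
  have hx : x ∈ (chartAt (Model m) x).source := mem_chart_source _ x
  have h1 : localRep α x₀ =ᶠ[nhds y] fun z =>
      (localRep α x (transition x₀ x z)).compContinuousLinearMap
        (fderiv ℝ (transition x₀ x) z) := by
    have h2 : (chartAt (Model m) x₀).symm ⁻¹' (chartAt (Model m) x).source ∈ nhds y :=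
      ((chartAt (Model m) x₀).symm.continuousAt hy).preimage_mem_nhds
        ((chartAt (Model m) x).open_source.mem_nhds hx)
    filter_upwards [h2, (chartAt (Model m) x₀).open_target.mem_nhds hy] with z hz hz'
    exact localRep_transition α hz' hz
  have h3 := extDeriv_pullback (r := ∞) (f := transition x₀ x) (x := y)
    (differentiableAt_localRep hα ((chartAt (Model m) x).map_source hx))
    (contDiffAt_transition hy hx) two_le_smoothness
  rw [h1.extDeriv_eq, h3]
  ext v
  change extDeriv (localRep α x) (chartAt (Model m) x x) _ = extDeriv (localRep α x) _ _
  congr 1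
  funext i
  have h2 : mfderiv (𝓡 m) (𝓡 m) (transition x₀ x) y =
      (mfderiv (𝓡 m) (𝓡 m) (chartAt (Model m) x) x).comp (chartDeriv x₀ y) :=
    mfderiv_comp y (mdifferentiableAt_chart hx) (mdifferentiableAt_chart_symm hy)
  rw [mfderiv_eq_fderiv] at h2
  exact (DFunLike.congr_fun h2 (v i)).symm

theorem IsSmoothForm.extD {k : ℕ} {α : Form m M k} (hα : IsSmoothForm α) :
    IsSmoothForm (extD α) := fun x₀ =>
  (contDiffOn_extDeriv (chartAt (Model m) x₀).open_target (hα x₀)).congr fun _ hy =>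
    localRep_extD hα hy

/-- A form is determined by its local representations. -/
theorem ext_localRep {k : ℕ} {α β : Form m M k}
    (h : ∀ x₀ : M, ∀ y ∈ (chartAt (Model m) x₀).target, localRep α x₀ y = localRep β x₀ y) :
    α = β := by
  funext x
  have hx := mem_chart_source (Model m) x
  have hy := (chartAt (Model m) x).map_source hx
  have h1 := h x _ hy
  have hp := (chartAt (Model m) x).left_inv hx
  ext v
  obtain ⟨w, hw⟩ : ∃ w : Fin k → Model m, ∀ i, chartDeriv x (chartAt (Model m) x x) (w i) = v i :=
    ⟨fun i => mfderiv (𝓡 m) (𝓡 m) (chartAt (Model m) x) x (v i), fun i =>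
      DFunLike.congr_fun (chartDeriv_comp_mfderiv_chart x hx) (v i)⟩
  have h2 := DFunLike.congr_fun h1 w
  have h3 : ∀ γ : Form m M k, localRep γ x (chartAt (Model m) x x) w = γ x v := fun γ => by
    refine Eq.trans ?_ (form_congr γ hp v)
    change γ _ _ = γ _ _
    congr 1
    funext i
    exact hw i
  rw [← h3, ← h3, h2]

theorem extD_extD {k : ℕ} {α : Form m M k} (hα : IsSmoothForm α) :
    SymplecticHodge.extD (SymplecticHodge.extD α) = 0 := by
  refine ext_localRep fun x₀ y hy => ?_
  have h1 : localRep (SymplecticHodge.extD α) x₀ =ᶠ[nhds y] extDeriv (localRep α x₀) := by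
    filter_upwards [(chartAt (Model m) x₀).open_target.mem_nhds hy] with z hz
    exact localRep_extD hα hz
  rw [localRep_extD hα.extD hy, h1.extDeriv_eq]
  exact extDeriv_extDeriv_apply (r := ∞)
    ((hα x₀).contDiffAt ((chartAt (Model m) x₀).open_target.mem_nhds hy)) two_le_smoothness

theorem extD_add {k : ℕ} {α β : Form m M k} (hα : IsSmoothForm α) (hβ : IsSmoothForm β) :
    SymplecticHodge.extD (α + β) = SymplecticHodge.extD α + SymplecticHodge.extD β := by
  funext x
  have hy := (chartAt (Model m) x).map_source (mem_chart_source (Model m) x)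
  change (extDeriv (localRep α x + localRep β x) _).compContinuousLinearMap _ = _
  rw [extDeriv_add (differentiableAt_localRep hα hy) (differentiableAt_localRep hβ hy)]
  rfl

theorem extD_smul {k : ℕ} (c : ℝ) (α : Form m M k) :
    SymplecticHodge.extD (c • α) = c • SymplecticHodge.extD α := by
  funext x
  change (extDeriv (c • localRep α x) _).compContinuousLinearMap _ = _
  rw [extDeriv_smul]
  rfl

theorem IsSmoothForm.add {k : ℕ} {α β : Form m M k} (hα : IsSmoothForm α) (hβ : IsSmoothForm β) :
    IsSmoothForm (α + β) := fun x₀ => (hα x₀).add (hβ x₀)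

theorem IsSmoothForm.const_smul {k : ℕ} {α : Form m M k} (hα : IsSmoothForm α) (c : ℝ) :
    IsSmoothForm (c • α) := fun x₀ => (hα x₀).const_smul c

theorem IsSmoothForm.zero {k : ℕ} : IsSmoothForm (0 : Form m M k) := fun _ =>
  (contDiffOn_const (c := 0)).congr fun _ _ => rfl

theorem IsSmoothForm.lefschetz {k : ℕ} {Ω : Form m M 2} {α : Form m M k} (hΩ : IsSmoothForm Ω)
    (hα : IsSmoothForm α) : IsSmoothForm fun x => lefschetz (Ω x) (α x) := fun x₀ =>
  (contDiffOn_lefschetz (EuclideanSpace.basisFun (Fin m) ℝ).toBasis (hΩ x₀) (hα x₀)).congr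
    fun _ _ => lefschetz_comp _ _ _

/-- Exterior multiplication by a closed two-form commutes with the exterior derivative. -/
theorem extD_lefschetz {k : ℕ} {Ω : Form m M 2} {α : Form m M k} (hΩ : IsSmoothForm Ω)
    (hα : IsSmoothForm α) (hd : SymplecticHodge.extD Ω = 0) :
    (SymplecticHodge.extD fun x => SymplecticHodge.lefschetz (Ω x) (α x)) =
      fun x => SymplecticHodge.lefschetz (Ω x) (SymplecticHodge.extD α x) := by
  refine ext_localRep fun x₀ y hy => ?_
  have h1 : localRep (fun x => SymplecticHodge.lefschetz (Ω x) (α x)) x₀ =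
      fun y => SymplecticHodge.lefschetz (localRep Ω x₀ y) (localRep α x₀ y) := by
    funext y
    exact lefschetz_comp _ _ _
  have h2 : localRep (fun x => SymplecticHodge.lefschetz (Ω x) (SymplecticHodge.extD α x)) x₀ y =
      SymplecticHodge.lefschetz (localRep Ω x₀ y) (localRep (SymplecticHodge.extD α) x₀ y) :=
    lefschetz_comp _ _ _
  rw [h2, localRep_extD (hΩ.lefschetz hα) hy, h1, localRep_extD hα hy]
  refine extDeriv_lefschetz (EuclideanSpace.basisFun (Fin m) ℝ).toBasis
    (differentiableAt_localRep hΩ hy) (differentiableAt_localRep hα hy) ?_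
  rw [← localRep_extD hΩ hy, hd]
  rfl

end Charts

/-! ### Smoothness of the star operators -/

section Linear

variable {V W : Type*} [AddCommGroup V] [Module ℝ V] [TopologicalSpace V]
  [AddCommGroup W] [Module ℝ W] [TopologicalSpace W]

theorem Nondeg.comp {Ω : W [⋀^Fin 2]→L[ℝ] ℝ} (hΩ : Nondeg Ω) {φ : V →L[ℝ] W}
    (hφ : Function.Bijective φ) : Nondeg (Ω.compContinuousLinearMap φ) := by
  intro u hu
  refine hφ.1 ?_
  rw [map_zero]
  refine hΩ _ fun w => ?_
  obtain ⟨v, rfl⟩ := hφ.2 w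
  refine Eq.trans ?_ (hu v)
  rw [ContinuousAlternatingMap.compContinuousLinearMap_apply]
  congr 1
  funext a; fin_cases a <;> rfl

theorem comp_apply_two (Ω : W [⋀^Fin 2]→L[ℝ] ℝ) (φ : V →L[ℝ] W) (u v : V) :
    Ω.compContinuousLinearMap φ ![u, v] = Ω ![φ u, φ v] := by
  rw [ContinuousAlternatingMap.compContinuousLinearMap_apply]
  congr 1
  funext a; fin_cases a <;> rfl

end Linear

section Metric

variable {n : ℕ} {M : Type*} [TopologicalSpace M] [ChartedSpace (Model (2 * n)) M]
  [Bundle.RiemannianBundle (fun x : M => TangentSpace (𝓡 (2 * n)) x)]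
  [IsManifold (𝓡 (2 * n)) ∞ M]

/-- The components of the metric in a chart. -/
abbrev chartMetric (n : ℕ) {M : Type*} [TopologicalSpace M] [ChartedSpace (Model (2 * n)) M]
    [Bundle.RiemannianBundle (fun x : M => TangentSpace (𝓡 (2 * n)) x)] (x₀ : M)
    (y u v : Model (2 * n)) : ℝ :=
  metric n ((chartAt (Model (2 * n)) x₀).symm y) (chartDeriv x₀ y u) (chartDeriv x₀ y v)

theorem contDiffOn_chartMetric [IsContMDiffRiemannianBundle (𝓡 (2 * n)) ∞ (Model (2 * n))
      (fun x : M => TangentSpace (𝓡 (2 * n)) x)] (x₀ : M) (u v : Model (2 * n)) :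
    ContDiffOn ℝ ∞ (fun y => chartMetric n x₀ y u v) (chartAt (Model (2 * n)) x₀).target := by
  have key : ∀ w : Model (2 * n), ContMDiffOn (𝓡 (2 * n)) (𝓡 (2 * n)).tangent ∞
      (fun y => (⟨(chartAt (Model (2 * n)) x₀).symm y, chartDeriv x₀ y w⟩ :
        TangentBundle (𝓡 (2 * n)) M)) (chartAt (Model (2 * n)) x₀).target := by
    intro w
    have h1 := (contMDiffOn_chart_symm (I := 𝓡 (2 * n)) (n := ∞) (x := x₀)
      ).contMDiffOn_tangentMapWithin (m := ∞) (by simp)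
      (chartAt (Model (2 * n)) x₀).open_target.uniqueMDiffOn
    have h2 : ContMDiff (𝓡 (2 * n)) (𝓡 (2 * n)).tangent ∞
        (fun y : Model (2 * n) => (⟨y, w⟩ : TangentBundle (𝓡 (2 * n)) (Model (2 * n)))) :=
      contMDiff_vectorSpace_iff_contDiff.mpr contDiff_const
    refine (h1.comp h2.contMDiffOn fun y hy => hy).congr fun y hy => ?_
    simp only [Function.comp_apply, tangentMapWithin]
    rw [mfderivWithin_of_isOpen (chartAt (Model (2 * n)) x₀).open_target hy]
    rfl
  exact contMDiffOn_iff_contDiffOn.mp ((key u).inner_bundle (key v))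

variable (S : AlmostKahlerStructure n M)

namespace AlmostKahlerStructure

theorem compatible (x : M) : Compatible (S.Ω x) (S.J x) where
  sq := S.J_J x
  invariant := S.Ω_J x
  pos u hu := by
    rw [← S.metric_eq]
    exact real_inner_self_pos.mpr hu

theorem metric_eq_met (x : M) : metric n x = met (S.Ω x) (S.J x) := by
  funext u v
  exact S.metric_eq x u v

theorem riemVol_eq : S.riemVol = S.sympVol := by
  funext x
  rw [riemVol, sympVol, S.metric_eq_met]
  exact (S.compatible x).vol_eq (tangentBasis x)

theorem single_sympVol (x : M) : single (2 * n) (S.sympVol x) = divPow (S.Ω x) n := by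
  rw [sympVol, map_smul, single_formPow, divPow]

theorem localRep_starS {k : ℕ} (l : ℕ) (α : Form (2 * n) M k) (x₀ : M) {y : Model (2 * n)}
    (hy : y ∈ (chartAt (Model (2 * n)) x₀).target) :
    localRep (S.starS l α) x₀ y = star (EuclideanSpace.basisFun (Fin (2 * n)) ℝ).toBasis
      (fun u v => localRep S.Ω x₀ y ![u, v]) (localRep S.sympVol x₀ y) l (localRep α x₀ y) := by
  have h := congrArg (fun β : Forms (Model (2 * n)) => β l)
    (pb_starL (chartDeriv x₀ y) (chartDeriv_bijective x₀ hy)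
      (EuclideanSpace.basisFun (Fin (2 * n)) ℝ).toBasis
      (tangentBasis ((chartAt (Model (2 * n)) x₀).symm y)) (bil (S.Ω _)) (S.compatible _).nondeg
      (S.sympVol _) (single k (α _)))
  simp only [pb_apply, pb_single, starL_single_apply] at h
  refine h.trans ?_
  congr 1
  funext u v
  exact (comp_apply_two _ _ u v).symm

theorem localRep_starG {k : ℕ} (l : ℕ) (α : Form (2 * n) M k) (x₀ : M) {y : Model (2 * n)}
    (hy : y ∈ (chartAt (Model (2 * n)) x₀).target) :
    localRep (S.starG l α) x₀ y = star (EuclideanSpace.basisFun (Fin (2 * n)) ℝ).toBasis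
      (chartMetric n x₀ y) (localRep S.sympVol x₀ y) l (localRep α x₀ y) := by
  have h := congrArg (fun β : Forms (Model (2 * n)) => β l)
    (pb_starL (chartDeriv x₀ y) (chartDeriv_bijective x₀ hy)
      (EuclideanSpace.basisFun (Fin (2 * n)) ℝ).toBasis
      (tangentBasis ((chartAt (Model (2 * n)) x₀).symm y)) (metHom (S.Ω _) (S.J _))
      (S.compatible _).met_nondeg (S.sympVol _) (single k (α _)))
  simp only [pb_apply, pb_single, starL_single_apply] at h
  rw [localRep_eq, starG, S.riemVol_eq, S.metric_eq_met]
  refine h.trans ?_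
  congr 1
  funext u v
  exact (S.metric_eq _ _ _).symm

theorem isSmoothForm_sympVol : IsSmoothForm S.sympVol := by
  intro x₀
  have key : ∀ c : ℕ, ∀ l, ContDiffOn ℝ ∞
      (fun y => (lef (localRep S.Ω x₀ y) ^ c) (single 0 (oneForm (Model (2 * n)))) l)
      (chartAt (Model (2 * n)) x₀).target := by
    intro c
    induction c with
    | zero => intro l; exact contDiffOn_const
    | succ c ih =>
      intro l
      simp only [pow_succ', Module.End.mul_apply]
      match l with
      | 0 => exact contDiffOn_const
      | 1 => exact contDiffOn_const
      | l + 2 =>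
        exact contDiffOn_lefschetz (EuclideanSpace.basisFun (Fin (2 * n)) ℝ).toBasis
          (S.smooth_Ω x₀) (ih l)
  refine ((key n (2 * n)).const_smul ((n.factorial : ℝ)⁻¹)).congr fun y _ => ?_
  have h := congrArg (fun β : Forms (Model (2 * n)) => β (2 * n))
    (pb_divPow (chartDeriv x₀ y) (S.Ω _) n)
  rw [← S.single_sympVol] at h
  simp only [pb_apply, single_same] at h
  exact h

theorem isUnit_chart_gram (S : AlmostKahlerStructure n M) (x₀ : M) {y : Model (2 * n)}
    (hy : y ∈ (chartAt (Model (2 * n)) x₀).target) :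
    IsUnit (gram (EuclideanSpace.basisFun (Fin (2 * n)) ℝ).toBasis (chartMetric n x₀ y)).det := by
  have hB : ∀ u : Model (2 * n), (∀ v, ((metHom (S.Ω _) (S.J _)).compl₁₂
      (chartDeriv x₀ y).toLinearMap (chartDeriv x₀ y).toLinearMap) v u = 0) → u = 0 := by
    intro u hu
    refine (chartDeriv_bijective x₀ hy).1 ?_
    rw [map_zero]
    refine (S.compatible _).met_nondeg _ fun w => ?_
    obtain ⟨v, rfl⟩ := (chartDeriv_bijective x₀ hy).2 w
    exact hu v
  have h := gram_isUnit (EuclideanSpace.basisFun (Fin (2 * n)) ℝ).toBasis _ hB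
  have h2 : chartMetric n x₀ y = fun u v => ((metHom (S.Ω _) (S.J _)).compl₁₂
      (chartDeriv x₀ y).toLinearMap (chartDeriv x₀ y).toLinearMap) u v := by
    funext u v
    exact S.metric_eq _ _ _
  rw [h2]
  exact h

theorem isSmoothForm_starS {k : ℕ} (l : ℕ) {α : Form (2 * n) M k} (hα : IsSmoothForm α) :
    IsSmoothForm (S.starS l α) := fun x₀ =>
  (contDiffOn_star (EuclideanSpace.basisFun (Fin (2 * n)) ℝ).toBasis
    (B := fun y u v => localRep S.Ω x₀ y ![u, v])
    (fun _ _ => contDiffOn_apply (S.smooth_Ω x₀) _)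
    (fun _ hy => ((S.compatible _).nondeg.comp (chartDeriv_bijective x₀ hy)).isUnit _)
    (S.isSmoothForm_sympVol x₀) (hα x₀) l).congr fun _ hy => S.localRep_starS l α x₀ hy

variable [IsContMDiffRiemannianBundle (𝓡 (2 * n)) ∞ (Model (2 * n))
      (fun x : M => TangentSpace (𝓡 (2 * n)) x)]

theorem isSmoothForm_starG {k : ℕ} (l : ℕ) {α : Form (2 * n) M k} (hα : IsSmoothForm α) :
    IsSmoothForm (S.starG l α) := fun x₀ =>
  (contDiffOn_star (EuclideanSpace.basisFun (Fin (2 * n)) ℝ).toBasis (B := chartMetric n x₀)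
    (fun _ _ => contDiffOn_chartMetric x₀ _ _) (fun _ hy => S.isUnit_chart_gram x₀ hy)
    (S.isSmoothForm_sympVol x₀) (hα x₀) l).congr fun _ hy => S.localRep_starG l α x₀ hy

end AlmostKahlerStructure

end Metric

/-! ### Operators on smooth differential forms of all degrees -/

section Grading

variable {V : Type*} [AddCommGroup V] [Module ℝ V] [TopologicalSpace V]

theorem weight_mul_lef (n : ℕ) (Ω : V [⋀^Fin 2]→L[ℝ] ℝ) :
    weight n * lef Ω = lef Ω * weight n - (lef Ω + lef Ω) := by
  ext1 α
  ext1 k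
  match k with
  | 0 => simp [weight]
  | 1 => simp [weight]
  | k + 2 =>
    simp only [weight, Module.End.mul_apply, LinearMap.sub_apply, LinearMap.add_apply, lef_add_two,
      diag_apply, Forms.sub_apply, Forms.add_apply, ← lefschetzHom_apply, map_smul]
    push_cast
    module

theorem weight_mul_lam [IsTopologicalAddGroup V] [ContinuousSMul ℝ V] [T2Space V] {ι : Type*}
    [Fintype ι] [DecidableEq ι] (n : ℕ) (e : Module.Basis ι ℝ V) (Ω : V [⋀^Fin 2]→L[ℝ] ℝ) :
    weight n * lam e Ω = lam e Ω * weight n + (lam e Ω + lam e Ω) := by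
  have h : ∀ i j, weight n * (iota (e i) * iota (e j)) = iota (e i) * iota (e j) * weight n +
      (iota (e i) * iota (e j) + iota (e i) * iota (e j)) := by
    intro i j
    ext1 α
    ext1 k
    simp only [weight, Module.End.mul_apply, LinearMap.add_apply, diag_apply, Forms.add_apply,
      iota_apply, map_smul]
    push_cast
    module
  simp only [lam, smul_mul_assoc, mul_smul_comm, Finset.sum_mul, Finset.mul_sum, h]
  rw [← smul_add, ← smul_add]
  simp only [← Finset.sum_add_distrib, smul_add]

theorem diag_weight_sub (n : ℕ) :
    (diag fun k => (n : ℝ) - k - 1 : Module.End ℝ (Forms V)) = weight n - 1 := by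
  ext1 α
  ext1 k
  simp only [weight, LinearMap.sub_apply, diag_apply, Forms.sub_apply, Module.End.one_apply]
  module

theorem diag_neg_parity :
    (diag fun k => -(-1) ^ k : Module.End ℝ (Forms V)) = -parity := by
  ext1 α
  ext1 k
  simp only [parity, LinearMap.neg_apply, diag_apply, Forms.neg_apply]
  module

theorem diag_triSign_succ :
    (diag fun k => (-1) ^ (k + 2).choose 2 : Module.End ℝ (Forms V)) = -(triSign * parity) := by
  ext1 α
  ext1 k
  simp only [parity, triSign, Module.End.mul_apply, LinearMap.neg_apply, diag_apply,
    Forms.neg_apply, smul_smul]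
  rw [Nat.choose_succ_succ' (k + 1) 1, Nat.choose_one_right, pow_add, pow_succ]
  module

end Grading

section Families

variable {m : ℕ} {M : Type*} [TopologicalSpace M] [ChartedSpace (Model m) M]
  [IsManifold (𝓡 m) ∞ M]

variable (m M) in
/-- The subspace of the families of smooth differential forms, one of each degree. -/
def smoothForms : Submodule ℝ ((k : ℕ) → Form m M k) where
  carrier := {α | ∀ k, IsSmoothForm (α k)}
  add_mem' ha hb k := (ha k).add (hb k)
  zero_mem' _ := IsSmoothForm.zero
  smul_mem' c _ ha k := (ha k).const_smul c

variable (m M) in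
/-- Families of smooth differential forms, one of each degree. -/
def SmoothForms : Type _ := smoothForms m M

namespace SmoothForms

instance : AddCommGroup (SmoothForms m M) := inferInstanceAs (AddCommGroup (smoothForms m M))

instance : Module ℝ (SmoothForms m M) := inferInstanceAs (Module ℝ (smoothForms m M))

/-- The value of a family of differential forms at a point. -/
def ev (x : M) : SmoothForms m M →ₗ[ℝ] Forms (TangentSpace (𝓡 m) x) where
  toFun α := ⟨fun k => α.1 k x⟩
  map_add' _ _ := rfl
  map_smul' _ _ := rfl

@[simp] theorem ev_apply (x : M) (α : SmoothForms m M) (k : ℕ) : ev x α k = α.1 k x := rfl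

theorem ext_ev {α β : SmoothForms m M} (h : ∀ x, ev x α = ev x β) : α = β := by
  refine Subtype.ext (funext fun k => funext fun x => ?_)
  rw [← ev_apply, h, ev_apply]

theorem end_ext_ev {A B : Module.End ℝ (SmoothForms m M)}
    (h : ∀ x α, ev x (A α) = ev x (B α)) : A = B :=
  LinearMap.ext fun α => ext_ev fun x => h x α

/-- The operator acting pointwise by `T`. -/
def lift (T : (x : M) → Module.End ℝ (Forms (TangentSpace (𝓡 m) x)))
    (hT : ∀ α : SmoothForms m M, ∀ k, IsSmoothForm fun x => T x (ev x α) k) :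
    Module.End ℝ (SmoothForms m M) where
  toFun α := ⟨fun k x => T x (ev x α) k, hT α⟩
  map_add' α β := ext_ev fun x => map_add (T x) (ev x α) (ev x β)
  map_smul' c α := ext_ev fun x => map_smul (T x) c (ev x α)

theorem ev_pow {X : Module.End ℝ (SmoothForms m M)} {x : M}
    {Y : Module.End ℝ (Forms (TangentSpace (𝓡 m) x))} (h : ∀ α, ev x (X α) = Y (ev x α)) (p : ℕ)
    (α : SmoothForms m M) : ev x ((X ^ p) α) = (Y ^ p) (ev x α) := by
  induction p generalizing α with
  | zero => rfl
  | succ p ih => rw [pow_succ, Module.End.mul_apply, ih, h, pow_succ, Module.End.mul_apply]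

theorem ev_expSum {X : Module.End ℝ (SmoothForms m M)} {x : M}
    {Y : Module.End ℝ (Forms (TangentSpace (𝓡 m) x))} (h : ∀ α, ev x (X α) = Y (ev x α)) (N : ℕ)
    (α : SmoothForms m M) : ev x (expSum N X α) = expSum N Y (ev x α) := by
  simp only [expSum, LinearMap.sum_apply, map_sum, LinearMap.smul_apply, map_smul, ev_pow h]

theorem ev_weyl {X Y : Module.End ℝ (SmoothForms m M)} {x : M}
    {X' Y' : Module.End ℝ (Forms (TangentSpace (𝓡 m) x))} (hX : ∀ α, ev x (X α) = X' (ev x α))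
    (hY : ∀ α, ev x (Y α) = Y' (ev x α)) (n : ℕ)
    (α : SmoothForms m M) : ev x (weyl n X Y α) = weyl n X' Y' (ev x α) := by
  rw [weyl, Module.End.mul_apply, Module.End.mul_apply, ev_expSum hX,
    ev_expSum (Y := -Y') (fun α => by rw [LinearMap.neg_apply, map_neg, hY]; rfl), ev_expSum hX]
  rfl

/-- The operator multiplying `k`-forms by `c k`. -/
def scale (c : ℕ → ℝ) : Module.End ℝ (SmoothForms m M) :=
  lift (fun _ => diag c) fun α k => (α.2 k).const_smul (c k)

theorem ev_scale (c : ℕ → ℝ) (x : M) (α : SmoothForms m M) :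
    ev x (scale c α) = diag c (ev x α) := rfl

/-- The exterior derivative. -/
def d : Module.End ℝ (SmoothForms m M) where
  toFun α := ⟨fun k => match k with
    | 0 => 0
    | k + 1 => extD (α.1 k), fun k => match k with
    | 0 => IsSmoothForm.zero
    | k + 1 => (α.2 k).extD⟩
  map_add' α β := by
    refine Subtype.ext (funext fun k => ?_)
    cases k with
    | zero => exact (add_zero _).symm
    | succ k => exact extD_add (α.2 k) (β.2 k)
  map_smul' c α := by
    refine Subtype.ext (funext fun k => ?_)
    cases k with
    | zero => exact (smul_zero c).symm
    | succ k => exact extD_smul c (α.1 k)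

theorem d_succ (α : SmoothForms m M) (k : ℕ) : (d α).1 (k + 1) = extD (α.1 k) := rfl

theorem d_mul_d : (d * d : Module.End ℝ (SmoothForms m M)) = 0 := by
  ext1 α
  refine Subtype.ext (funext fun k => ?_)
  match k with
  | 0 => rfl
  | 1 =>
    have h := extD_smul (m := m) (M := M) 0 (0 : Form m M 0)
    rw [zero_smul, zero_smul] at h
    exact h
  | k + 2 => exact extD_extD (α.2 k)

theorem scale_mul_d {c c' : ℕ → ℝ} (h : ∀ k, c (k + 1) = c' k) :
    (scale c * d : Module.End ℝ (SmoothForms m M)) = d * scale c' := by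
  ext1 α
  refine Subtype.ext (funext fun k => ?_)
  match k with
  | 0 => exact smul_zero (c 0)
  | k + 1 =>
    change c (k + 1) • extD (α.1 k) = extD (c' k • α.1 k)
    rw [extD_smul, h]

/-- A smooth form as a family concentrated in its degree. -/
def sg (k : ℕ) (α : Form m M k) (hα : IsSmoothForm α) : SmoothForms m M :=
  ⟨fun l x => single k (α x) l, fun l x₀ => (contDiffOn_toDegree (hα x₀) l).congr fun _ _ =>
    toDegree_comp _ _ _⟩

theorem ev_sg (k : ℕ) (α : Form m M k) (hα : IsSmoothForm α) (x : M) :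
    ev x (sg k α hα) = single k (α x) := rfl

theorem sg_same (k : ℕ) (α : Form m M k) (hα : IsSmoothForm α) : (sg k α hα).1 k = α :=
  funext fun x => single_same k (α x)

theorem sg_of_ne {k l : ℕ} (h : l ≠ k) (α : Form m M k) (hα : IsSmoothForm α) :
    (sg k α hα).1 l = 0 :=
  funext fun x => single_of_ne h (α x)

theorem sg_congr {k : ℕ} {α β : Form m M k} (h : α = β) (hα : IsSmoothForm α)
    (hβ : IsSmoothForm β) : sg k α hα = sg k β hβ := by
  subst h; rfl

theorem sg_eq {k : ℕ} {α : SmoothForms m M} (h : ∀ l, l ≠ k → α.1 l = 0) :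
    α = sg k (α.1 k) (α.2 k) := by
  refine Subtype.ext (funext fun l => ?_)
  by_cases hl : l = k
  · subst hl; rw [sg_same]
  · rw [sg_of_ne hl, h l hl]

theorem extD_zero {k : ℕ} : extD (0 : Form m M k) = 0 := by
  have h := extD_smul (m := m) (M := M) 0 (0 : Form m M k)
  rwa [zero_smul, zero_smul] at h

theorem d_sg {k : ℕ} {α : Form m M k} (hα : IsSmoothForm α) :
    d (sg k α hα) = sg (k + 1) (extD α) hα.extD := by
  refine Subtype.ext (funext fun l => ?_)
  match l with
  | 0 => exact (sg_of_ne (Nat.succ_ne_zero k).symm _ _).symm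
  | l + 1 =>
    rw [d_succ]
    by_cases h : l = k
    · subst h; rw [sg_same, sg_same]
    · rw [sg_of_ne h, sg_of_ne (by omega), extD_zero]

end SmoothForms

end Families

section Kahler

variable {n : ℕ} {M : Type*} [TopologicalSpace M] [ChartedSpace (Model (2 * n)) M]
  [Bundle.RiemannianBundle (fun x : M => TangentSpace (𝓡 (2 * n)) x)]
  [IsManifold (𝓡 (2 * n)) ∞ M]
  (S : AlmostKahlerStructure n M)

namespace AlmostKahlerStructure

open SmoothForms

/-- The Lefschetz operator on families. -/
def opL : Module.End ℝ (SmoothForms (2 * n) M) :=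
  lift (fun x => lef (S.Ω x)) fun α k => match k with
    | 0 => IsSmoothForm.zero
    | 1 => IsSmoothForm.zero
    | k + 2 => S.smooth_Ω.lefschetz (α.2 k)

/-- The symplectic star operator on families. -/
def opS : Module.End ℝ (SmoothForms (2 * n) M) :=
  lift (fun x => starΩ (tangentBasis x) (S.Ω x) (S.sympVol x)) fun α k =>
    S.isSmoothForm_starS k (α.2 (2 * n - k))

/-- The dual Lefschetz operator on families. -/
def opΛ : Module.End ℝ (SmoothForms (2 * n) M) := S.opS * S.opL * S.opS

theorem ev_opL (x : M) (α : SmoothForms (2 * n) M) : ev x (S.opL α) = lef (S.Ω x) (ev x α) := rfl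

theorem ev_opS (x : M) (α : SmoothForms (2 * n) M) :
    ev x (S.opS α) = starΩ (tangentBasis x) (S.Ω x) (S.sympVol x) (ev x α) := rfl

theorem card_fin : Fintype.card (Fin (2 * n)) = 2 * n := Fintype.card_fin _

theorem ev_opΛ (x : M) (α : SmoothForms (2 * n) M) :
    ev x (S.opΛ α) = lam (tangentBasis x) (S.Ω x) (ev x α) := by
  rw [← lam_eq_star_lef_star (S.compatible x).nondeg card_fin (S.single_sympVol x)]
  rfl

theorem triple : IsLefschetzTriple n S.opL S.opΛ (scale fun k => (n : ℝ) - k) where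
  lef_pow := end_ext_ev fun x α => by
    rw [ev_pow (S.ev_opL x), lef_pow_eq_zero (tangentBasis x) _ card_fin]; rfl
  lam_pow := end_ext_ev fun x α => by
    rw [ev_pow (S.ev_opΛ x), lam_pow_eq_zero (tangentBasis x) _ card_fin]; rfl
  lam_mul_lef := end_ext_ev fun x α => by
    rw [LinearMap.add_apply, map_add, Module.End.mul_apply, Module.End.mul_apply, S.ev_opΛ,
      S.ev_opL, S.ev_opL, S.ev_opΛ, ev_scale]
    exact LinearMap.congr_fun (lam_mul_lef (tangentBasis x) (S.compatible x).nondeg card_fin) _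
  weight_mul_lef := by
    rw [two_mul S.opL]
    exact end_ext_ev fun x α => LinearMap.congr_fun (weight_mul_lef n (S.Ω x)) (ev x α)
  weight_mul_lam := by
    rw [two_mul S.opΛ]
    refine end_ext_ev fun x α => ?_
    have h := LinearMap.congr_fun (weight_mul_lam n (tangentBasis x) (S.Ω x)) (ev x α)
    simp only [LinearMap.add_apply, Module.End.mul_apply] at h
    simp only [LinearMap.add_apply, map_add, Module.End.mul_apply, ev_scale, S.ev_opΛ]
    exact h

theorem opL_mul_d : S.opL * d = d * S.opL := by
  ext1 α
  refine Subtype.ext (funext fun k => ?_)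
  match k with
  | 0 => rfl
  | 1 => exact extD_zero.symm
  | 2 =>
    refine Eq.trans ?_ (extD_zero (k := 1)).symm
    funext x
    exact map_zero (lefschetzHom 0 (S.Ω x))
  | k + 3 => exact (extD_lefschetz S.smooth_Ω (α.2 k) S.closed_Ω).symm

variable [IsContMDiffRiemannianBundle (𝓡 (2 * n)) ∞ (Model (2 * n))
      (fun x : M => TangentSpace (𝓡 (2 * n)) x)]

/-- The Hodge star operator on families. -/
def opH : Module.End ℝ (SmoothForms (2 * n) M) :=
  lift (fun x => starL (tangentBasis x) (metric n x) (S.riemVol x)) fun α k =>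
    S.isSmoothForm_starG k (α.2 (2 * n - k))

theorem ev_opH (x : M) (α : SmoothForms (2 * n) M) :
    ev x (S.opH α) = starL (tangentBasis x) (met (S.Ω x) (S.J x)) (S.sympVol x) (ev x α) := by
  rw [← S.riemVol_eq, ← S.metric_eq_met]; rfl

theorem opH_mul_opH : S.opH * S.opH = scale fun k => (-1) ^ k :=
  end_ext_ev fun x α => by
    rw [Module.End.mul_apply, S.ev_opH, S.ev_opH, ← Module.End.mul_apply,
      (S.compatible x).starL_met_sq card_fin (S.single_sympVol x)]
    rfl

theorem opH_mul_opL_mul_opH : S.opH * S.opL * S.opH = S.opΛ * scale fun k => (-1) ^ k :=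
  end_ext_ev fun x α => by
    rw [Module.End.mul_apply, Module.End.mul_apply, S.ev_opH, S.ev_opL, S.ev_opH,
      Module.End.mul_apply, S.ev_opΛ, ← Module.End.mul_apply, ← Module.End.mul_apply,
      (S.compatible x).star_lef_star card_fin (S.single_sympVol x)]
    rfl

theorem opS_mul_opS : S.opS * S.opS = 1 :=
  end_ext_ev fun x α => by
    rw [Module.End.mul_apply, S.ev_opS, S.ev_opS, ← Module.End.mul_apply,
      starΩ_mul_starΩ (S.compatible x).nondeg card_fin (S.single_sympVol x)]
    rfl

theorem opS_eq_weyl : S.opS = weyl n S.opL S.opΛ * scale fun k => (-1) ^ (k + 1).choose 2 :=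
  end_ext_ev fun x α => by
    rw [Module.End.mul_apply, ev_weyl (S.ev_opL x) (S.ev_opΛ x), S.ev_opS,
      starΩ_eq_weyl (S.compatible x).nondeg card_fin (S.single_sympVol x)]
    rfl

theorem parity_mul_opS :
    (scale fun k => (-1) ^ k) * S.opS = S.opS * scale fun k => (-1) ^ k :=
  end_ext_ev fun x α => by
    rw [Module.End.mul_apply, Module.End.mul_apply, ev_scale, S.ev_opS, S.ev_opS, ev_scale]
    exact LinearMap.congr_fun (parity_mul_starL (tangentBasis x) _ _) (ev x α)

theorem parity_mul_opH :
    (scale fun k => (-1) ^ k) * S.opH = S.opH * scale fun k => (-1) ^ k :=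
  end_ext_ev fun x α => by
    rw [Module.End.mul_apply, Module.End.mul_apply, ev_scale, S.ev_opH, S.ev_opH, ev_scale]
    exact LinearMap.congr_fun (parity_mul_starL (tangentBasis x) _ _) (ev x α)

theorem parity_mul_opΛ :
    (scale fun k => (-1) ^ k) * S.opΛ = S.opΛ * scale fun k => (-1) ^ k :=
  end_ext_ev fun x α => by
    rw [Module.End.mul_apply, Module.End.mul_apply, ev_scale, S.ev_opΛ, S.ev_opΛ, ev_scale]
    exact LinearMap.congr_fun (parity_mul_lam (tangentBasis x) _) (ev x α)

theorem weight_mul_d : ((scale fun k => (n : ℝ) - k) * d : Module.End ℝ (SmoothForms (2 * n) M)) =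
    d * (scale fun k => (n : ℝ) - k) - d := by
  have h : (scale fun k => (n : ℝ) - k - 1 : Module.End ℝ (SmoothForms (2 * n) M)) =
      (scale fun k => (n : ℝ) - k) - 1 :=
    end_ext_ev fun x α => LinearMap.congr_fun (diag_weight_sub n) (ev x α)
  rw [scale_mul_d (c' := fun k => (n : ℝ) - k - 1) (fun k => by push_cast; ring), h, mul_sub,
    mul_one]

theorem parity_mul_d : ((scale fun k => (-1) ^ k) * d : Module.End ℝ (SmoothForms (2 * n) M)) =
    -(d * scale fun k => (-1) ^ k) := by
  have h : (scale fun k => -(-1) ^ k : Module.End ℝ (SmoothForms (2 * n) M)) =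
      -(scale fun k => (-1) ^ k) :=
    end_ext_ev fun x α => LinearMap.congr_fun diag_neg_parity (ev x α)
  rw [scale_mul_d (c' := fun k => -(-1) ^ k) (fun k => by ring), h, mul_neg]

theorem triSign_mul_d :
    ((scale fun k => (-1) ^ (k + 1).choose 2) * d : Module.End ℝ (SmoothForms (2 * n) M)) =
      -(d * (scale fun k => (-1) ^ (k + 1).choose 2) * scale fun k => (-1) ^ k) := by
  have h : (scale fun k => (-1) ^ (k + 2).choose 2 : Module.End ℝ (SmoothForms (2 * n) M)) =
      -((scale fun k => (-1) ^ (k + 1).choose 2) * scale fun k => (-1) ^ k) :=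
    end_ext_ev fun x α => LinearMap.congr_fun diag_triSign_succ (ev x α)
  rw [scale_mul_d (c' := fun k => (-1) ^ (k + 2).choose 2) (fun k => rfl), h, mul_neg, mul_assoc]

theorem kahlerRelations : KahlerRelations n S.opL S.opΛ (scale fun k => (n : ℝ) - k) d
    (scale fun k => (-1) ^ k) (scale fun k => (-1) ^ (k + 1).choose 2) S.opS S.opH where
  triple := S.triple
  lef_mul_d := S.opL_mul_d
  weight_mul_d := weight_mul_d
  d_mul_d := d_mul_d
  sign_mul_d := triSign_mul_d
  parity_mul_d := parity_mul_d
  parity_sq := end_ext_ev fun x α => LinearMap.congr_fun parity_mul_parity (ev x α)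
  parity_mul_star := S.parity_mul_opS
  parity_mul_hodge := S.parity_mul_opH
  parity_mul_lef := end_ext_ev fun x α => LinearMap.congr_fun (parity_mul_lef (S.Ω x)) (ev x α)
  parity_mul_lam := S.parity_mul_opΛ
  star_eq := S.opS_eq_weyl
  star_sq := S.opS_mul_opS
  hodge_sq := S.opH_mul_opH
  hodge_lef_hodge := S.opH_mul_opL_mul_opH

end AlmostKahlerStructure

end Kahler

/-! ### The Laplacians as operators on families of all degrees -/

section Bridge

variable {n : ℕ} {M : Type*} [TopologicalSpace M] [ChartedSpace (Model (2 * n)) M]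
  [Bundle.RiemannianBundle (fun x : M => TangentSpace (𝓡 (2 * n)) x)]
  [IsManifold (𝓡 (2 * n)) ∞ M]
  (S : AlmostKahlerStructure n M) {k : ℕ} {α : Form (2 * n) M k}

namespace AlmostKahlerStructure

open SmoothForms

theorem starS_of_ne {l : ℕ} (h : k + l ≠ 2 * n) (α : Form (2 * n) M k) : S.starS l α = 0 :=
  funext fun x => star_of_ne (tangentBasis x) _ _ h (α x)

theorem starG_of_ne {l : ℕ} (h : k + l ≠ 2 * n) (α : Form (2 * n) M k) : S.starG l α = 0 :=
  funext fun x => star_of_ne (tangentBasis x) _ _ h (α x)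

theorem starS_zero (l : ℕ) : S.starS l (0 : Form (2 * n) M k) = 0 :=
  funext fun x => star_zero (tangentBasis x) _ _ l

theorem starG_zero (l : ℕ) : S.starG l (0 : Form (2 * n) M k) = 0 :=
  funext fun x => star_zero (tangentBasis x) _ _ l

theorem dLam_of_ne {l : ℕ} (h : l + 1 ≠ k) (α : Form (2 * n) M k) : S.dLam l α = 0 := by
  rw [dLam]
  by_cases hk : k ≤ 2 * n
  · rw [S.starS_of_ne (k := 2 * n - k + 1) (by omega), smul_zero]
  · rw [S.starS_of_ne (l := 2 * n - k) (by omega), extD_zero, S.starS_zero, smul_zero]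

theorem dStar_of_ne {l : ℕ} (h : l + 1 ≠ k) (α : Form (2 * n) M k) : S.dStar l α = 0 := by
  rw [dStar]
  by_cases hk : k ≤ 2 * n
  · rw [S.starG_of_ne (k := 2 * n - k + 1) (by omega), neg_zero]
  · rw [S.starG_of_ne (l := 2 * n - k) (by omega), extD_zero, S.starG_zero, neg_zero]

theorem dLamStar_of_ne {l : ℕ} (h : l ≠ k + 1) (α : Form (2 * n) M k) : S.dLamStar l α = 0 := by
  rw [dLamStar]
  by_cases hl : l ≤ 2 * n
  · by_cases hk : k ≤ 2 * n
    · rw [S.dLam_of_ne (by omega), S.starG_zero]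
    · rw [S.dLam_of_ne (by omega), S.starG_zero]
  · rw [S.starG_of_ne (k := 2 * n - l) (by omega)]

theorem isSmoothForm_dLam (l : ℕ) (hα : IsSmoothForm α) : IsSmoothForm (S.dLam l α) :=
  (S.isSmoothForm_starS l (S.isSmoothForm_starS _ hα).extD).const_smul _

theorem IsSmoothForm.toDegree {k : ℕ} {α : Form (2 * n) M k} (hα : IsSmoothForm α) (l : ℕ) :
    IsSmoothForm fun x => SymplecticHodge.toDegree l (α x) := fun x₀ =>
  (contDiffOn_toDegree (hα x₀) l).congr fun _ _ => toDegree_comp _ _ _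

theorem isSmoothForm_ddLam (hα : IsSmoothForm α) : IsSmoothForm (S.ddLam α) :=
  IsSmoothForm.toDegree (S.isSmoothForm_dLam _ hα).extD k

theorem opS_sg (hα : IsSmoothForm α) : S.opS (sg k α hα) =
    sg (2 * n - k) (S.starS (2 * n - k) α) (S.isSmoothForm_starS _ hα) :=
  ext_ev fun x => starL_single (tangentBasis x) _ _ (α x)

theorem opS_sg_apply (hα : IsSmoothForm α) (l : ℕ) : (S.opS (sg k α hα)).1 l = S.starS l α :=
  funext fun x => starL_single_apply (tangentBasis x) _ _ (α x) l

theorem parity_sg (hα : IsSmoothForm α) :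
    scale (fun k => (-1) ^ k) (sg k α hα) = (-1 : ℝ) ^ k • sg k α hα :=
  ext_ev fun x => by
    rw [ev_scale, map_smul, ev_sg, diag_single]

/-- The symplectic codifferential `d^Λ` on families. -/
def opδ : Module.End ℝ (SmoothForms (2 * n) M) :=
  -(S.opS * d * S.opS * scale fun k => (-1) ^ k)

theorem opδ_sg_apply (hα : IsSmoothForm α) (l : ℕ) : (S.opδ (sg k α hα)).1 l = S.dLam l α := by
  have h : S.opδ (sg k α hα) = (-1 : ℝ) ^ (k + 1) • S.opS (d (S.opS (sg k α hα))) := by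
    rw [opδ, LinearMap.neg_apply, Module.End.mul_apply, parity_sg, map_smul, Module.End.mul_apply,
      Module.End.mul_apply, ← neg_smul, pow_succ, mul_neg_one]
  rw [h, S.opS_sg, d_sg]
  exact congrArg ((-1 : ℝ) ^ (k + 1) • ·) (S.opS_sg_apply _ l)

theorem opδ_sg (hα : IsSmoothForm α) :
    S.opδ (sg k α hα) = sg (k - 1) (S.dLam (k - 1) α) (S.isSmoothForm_dLam _ hα) := by
  rw [sg_eq (α := S.opδ (sg k α hα)) (k := k - 1) fun l hl => by
    rw [S.opδ_sg_apply, S.dLam_of_ne (by omega)]]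
  exact sg_congr (S.opδ_sg_apply hα _) _ _

theorem sg_zero (h : IsSmoothForm (0 : Form (2 * n) M k)) : sg k 0 h = 0 :=
  ext_ev fun x => by rw [ev_sg, map_zero]; exact map_zero (single k)

theorem sg_toDegree {l : ℕ} (h : k = l) (hα : IsSmoothForm α)
    (hα' : IsSmoothForm fun x => SymplecticHodge.toDegree l (α x)) :
    sg l (fun x => SymplecticHodge.toDegree l (α x)) hα' = sg k α hα :=
  ext_ev fun x => by rw [ev_sg, ev_sg, single_toDegree h]

theorem opδ_d_sg (hα : IsSmoothForm α) :
    d (S.opδ (sg k α hα)) = sg k (S.ddLam α) (S.isSmoothForm_ddLam hα) := by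
  rw [S.opδ_sg, d_sg]
  cases k with
  | zero =>
    have h : S.dLam (0 - 1) α = 0 := S.dLam_of_ne (by omega) α
    have h1 : extD (S.dLam (0 - 1) α) = 0 := by rw [h, extD_zero]
    have h2 : S.ddLam α = 0 := by
      funext x
      rw [ddLam, h1]
      exact toDegree_of_ne (by omega) _
    rw [sg_congr h1 _ IsSmoothForm.zero, sg_congr h2 _ IsSmoothForm.zero, sg_zero, sg_zero]
  | succ k => exact (sg_toDegree rfl _ _).symm

variable [IsContMDiffRiemannianBundle (𝓡 (2 * n)) ∞ (Model (2 * n))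
      (fun x : M => TangentSpace (𝓡 (2 * n)) x)]

theorem isSmoothForm_dStar (l : ℕ) (hα : IsSmoothForm α) : IsSmoothForm (S.dStar l α) := by
  rw [dStar, ← neg_one_smul ℝ]
  exact (S.isSmoothForm_starG l (S.isSmoothForm_starG _ hα).extD).const_smul _

theorem isSmoothForm_dLamStar (l : ℕ) (hα : IsSmoothForm α) : IsSmoothForm (S.dLamStar l α) :=
  S.isSmoothForm_starG l (S.isSmoothForm_dLam _ (S.isSmoothForm_starG _ hα))

theorem isSmoothForm_ddLamStar (hα : IsSmoothForm α) : IsSmoothForm (S.ddLamStar α) :=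
  (S.isSmoothForm_starG k (S.isSmoothForm_ddLam (S.isSmoothForm_starG _ hα))).const_smul _

theorem isSmoothForm_ddStar (hα : IsSmoothForm α) : IsSmoothForm (S.ddStar α) :=
  IsSmoothForm.toDegree (S.isSmoothForm_dStar _ hα).extD k

theorem isSmoothForm_laplacianAdd (c : ℝ) (hα : IsSmoothForm α) :
    IsSmoothForm (S.laplacianAdd c α) :=
  (S.isSmoothForm_ddLam (S.isSmoothForm_ddLamStar hα)).add
    (((S.isSmoothForm_dStar k hα.extD).add
      (S.isSmoothForm_dLamStar k (S.isSmoothForm_dLam _ hα))).const_smul c)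

theorem isSmoothForm_laplacianMul (c : ℝ) (hα : IsSmoothForm α) :
    IsSmoothForm (S.laplacianMul c α) :=
  (S.isSmoothForm_ddLamStar (S.isSmoothForm_ddLam hα)).add
    (((S.isSmoothForm_ddStar hα).add
      (S.isSmoothForm_dLam k (S.isSmoothForm_dLamStar _ hα))).const_smul c)

theorem opH_sg (hα : IsSmoothForm α) : S.opH (sg k α hα) =
    sg (2 * n - k) (S.starG (2 * n - k) α) (S.isSmoothForm_starG _ hα) :=
  ext_ev fun x => starL_single (tangentBasis x) _ _ (α x)

theorem opH_sg_apply (hα : IsSmoothForm α) (l : ℕ) : (S.opH (sg k α hα)).1 l = S.starG l α :=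
  funext fun x => starL_single_apply (tangentBasis x) _ _ (α x) l

/-- The codifferential `d^*` on families. -/
def opdS : Module.End ℝ (SmoothForms (2 * n) M) := -(S.opH * d * S.opH)

/-- The operator `d^{Λ*}` on families. -/
def opδS : Module.End ℝ (SmoothForms (2 * n) M) := S.opH * S.opδ * S.opH

/-- The operator `(d d^Λ)^*` on families. -/
def opdδS : Module.End ℝ (SmoothForms (2 * n) M) :=
  -(S.opH * d * S.opδ * S.opH * scale fun k => (-1) ^ k)

theorem opdS_sg_apply (hα : IsSmoothForm α) (l : ℕ) : (S.opdS (sg k α hα)).1 l = S.dStar l α := by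
  rw [opdS, LinearMap.neg_apply, Module.End.mul_apply, Module.End.mul_apply, S.opH_sg, d_sg]
  exact congrArg (- ·) (S.opH_sg_apply _ l)

theorem opdS_sg (hα : IsSmoothForm α) :
    S.opdS (sg k α hα) = sg (k - 1) (S.dStar (k - 1) α) (S.isSmoothForm_dStar _ hα) := by
  rw [sg_eq (α := S.opdS (sg k α hα)) (k := k - 1) fun l hl => by
    rw [S.opdS_sg_apply, S.dStar_of_ne (by omega)]]
  exact sg_congr (S.opdS_sg_apply hα _) _ _

theorem opδS_sg_apply (hα : IsSmoothForm α) (l : ℕ) :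
    (S.opδS (sg k α hα)).1 l = S.dLamStar l α := by
  rw [opδS, Module.End.mul_apply, Module.End.mul_apply, S.opH_sg]
  change S.starG l ((S.opδ _).1 (2 * n - l)) = _
  rw [S.opδ_sg_apply]
  rfl

theorem opδS_sg (hα : IsSmoothForm α) :
    S.opδS (sg k α hα) = sg (k + 1) (S.dLamStar (k + 1) α) (S.isSmoothForm_dLamStar _ hα) := by
  rw [sg_eq (α := S.opδS (sg k α hα)) (k := k + 1) fun l hl => by
    rw [S.opδS_sg_apply, S.dLamStar_of_ne hl]]
  exact sg_congr (S.opδS_sg_apply hα _) _ _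

theorem opdδS_sg (hα : IsSmoothForm α) :
    S.opdδS (sg k α hα) = sg k (S.ddLamStar α) (S.isSmoothForm_ddLamStar hα) := by
  have h : S.opdδS (sg k α hα) = (-1 : ℝ) ^ (k + 1) • S.opH (d (S.opδ (S.opH (sg k α hα)))) := by
    rw [opdδS, LinearMap.neg_apply, Module.End.mul_apply, parity_sg, map_smul, Module.End.mul_apply,
      Module.End.mul_apply, Module.End.mul_apply, ← neg_smul, pow_succ, mul_neg_one]
  have h2 : ∀ l, (S.opdδS (sg k α hα)).1 l =
      (-1 : ℝ) ^ (k + 1) • S.starG l (S.ddLam (S.starG (2 * n - k) α)) := fun l => by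
    rw [h, S.opH_sg, S.opδ_d_sg]
    exact congrArg ((-1 : ℝ) ^ (k + 1) • ·) (S.opH_sg_apply _ l)
  rw [sg_eq (α := S.opdδS (sg k α hα)) (k := k) fun l hl => by
    rw [h2]
    by_cases hk : k ≤ 2 * n
    · rw [S.starG_of_ne (by omega), smul_zero]
    · rw [← h2, h, S.opH_sg, sg_congr (S.starG_of_ne (by omega) α) _ IsSmoothForm.zero, sg_zero]
      simp only [map_zero, smul_zero]
      rfl]
  exact sg_congr (h2 k) _ _

theorem d_opdS_sg (hα : IsSmoothForm α) :
    d (S.opdS (sg k α hα)) = sg k (S.ddStar α) (S.isSmoothForm_ddStar hα) := by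
  rw [S.opdS_sg, d_sg]
  cases k with
  | zero =>
    have h : S.dStar (0 - 1) α = 0 := S.dStar_of_ne (by omega) α
    have h1 : extD (S.dStar (0 - 1) α) = 0 := by rw [h, extD_zero]
    have h2 : S.ddStar α = 0 := by
      funext x
      rw [ddStar, h1]
      exact toDegree_of_ne (by omega) _
    rw [sg_congr h1 _ IsSmoothForm.zero, sg_congr h2 _ IsSmoothForm.zero, sg_zero, sg_zero]
  | succ k => exact (sg_toDegree rfl _ _).symm

/-- The Laplacian `Δ_{d+d^Λ}` on families. -/
def opAdd (c : ℝ) : Module.End ℝ (SmoothForms (2 * n) M) :=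
  d * S.opδ * S.opdδS + c • (S.opdS * d + S.opδS * S.opδ)

/-- The Laplacian `Δ_{dd^Λ}` on families. -/
def opMul (c : ℝ) : Module.End ℝ (SmoothForms (2 * n) M) :=
  S.opdδS * (d * S.opδ) + c • (d * S.opdS + S.opδ * S.opδS)

theorem opL_mul_laplacian (c : ℝ) :
    S.opL * S.opAdd c = S.opAdd c * S.opL ∧ S.opL * S.opMul c = S.opMul c * S.opL :=
  S.kahlerRelations.lef_mul_laplacian c rfl rfl rfl rfl

theorem sg_add {β : Form (2 * n) M k} (hα : IsSmoothForm α) (hβ : IsSmoothForm β) :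
    sg k (α + β) (hα.add hβ) = sg k α hα + sg k β hβ :=
  ext_ev fun x => map_add (single k) (α x) (β x)

theorem sg_smul (c : ℝ) (hα : IsSmoothForm α) :
    sg k (c • α) (hα.const_smul c) = c • sg k α hα :=
  ext_ev fun x => map_smul (single k) c (α x)

theorem opAdd_sg (c : ℝ) (hα : IsSmoothForm α) :
    S.opAdd c (sg k α hα) = sg k (S.laplacianAdd c α) (S.isSmoothForm_laplacianAdd c hα) := by
  have h1 : S.opδS (S.opδ (sg k α hα)) = sg k (S.dLamStar k (S.dLam (k - 1) α))
      (S.isSmoothForm_dLamStar _ (S.isSmoothForm_dLam _ hα)) := by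
    rw [S.opδ_sg]
    cases k with
    | zero =>
      have h : S.dLam (0 - 1) α = 0 := S.dLam_of_ne (by omega) α
      have h2 : S.dLamStar 0 (S.dLam (0 - 1) α) = 0 := S.dLamStar_of_ne (by omega) _
      rw [sg_congr h _ IsSmoothForm.zero, sg_zero, map_zero, sg_congr h2 _ IsSmoothForm.zero,
        sg_zero]
    | succ k => exact S.opδS_sg _
  have h2 : S.opdS (d (sg k α hα)) = sg k (S.dStar k (extD α))
      (S.isSmoothForm_dStar _ hα.extD) := by
    rw [d_sg]
    exact S.opdS_sg _
  rw [opAdd, LinearMap.add_apply, LinearMap.smul_apply, LinearMap.add_apply, Module.End.mul_apply,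
    Module.End.mul_apply, Module.End.mul_apply, Module.End.mul_apply, h1, h2, S.opdδS_sg,
    S.opδ_d_sg, ← sg_add, ← sg_smul, ← sg_add]
  rfl

theorem opMul_sg (c : ℝ) (hα : IsSmoothForm α) :
    S.opMul c (sg k α hα) = sg k (S.laplacianMul c α) (S.isSmoothForm_laplacianMul c hα) := by
  have h1 : S.opδ (S.opδS (sg k α hα)) = sg k (S.dLam k (S.dLamStar (k + 1) α))
      (S.isSmoothForm_dLam _ (S.isSmoothForm_dLamStar _ hα)) := by
    rw [S.opδS_sg]
    exact S.opδ_sg _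
  rw [opMul, LinearMap.add_apply, LinearMap.smul_apply, LinearMap.add_apply, Module.End.mul_apply,
    Module.End.mul_apply, Module.End.mul_apply, Module.End.mul_apply, h1, S.opδ_d_sg, S.opdδS_sg,
    S.d_opdS_sg, ← sg_add, ← sg_smul, ← sg_add]
  rfl

end AlmostKahlerStructure

end Bridge

/-! ### The pairing of forms in orthonormal bases -/

section Pairing

variable {V W : Type*} [AddCommGroup V] [Module ℝ V] [TopologicalSpace V]
  [AddCommGroup W] [Module ℝ W] [TopologicalSpace W]
  [IsTopologicalAddGroup W] [ContinuousSMul ℝ W] [T2Space W]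
  {ι : Type*} [Fintype ι] [DecidableEq ι]

/-- The pairing is natural: with `P` the matrix of `φ`, the Gram matrices are related by
`G = Pᵀ G' P`, so that `P G⁻¹ Pᵀ = G'⁻¹`. -/
theorem pairing_comp (φ : V →L[ℝ] W) (e : Module.Basis ι ℝ V) (e' : Module.Basis ι ℝ W)
    (B : W →ₗ[ℝ] W →ₗ[ℝ] ℝ) (hu : IsUnit (gram e fun u v => B (φ u) (φ v)).det) {k : ℕ}
    (α β : W [⋀^Fin k]→L[ℝ] ℝ) :
    pairing e (fun u v => B (φ u) (φ v)) (α.compContinuousLinearMap φ)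
      (β.compContinuousLinearMap φ) = pairing e' (fun u v => B u v) α β := by
  set G := gram e fun u v => B (φ u) (φ v) with hG
  set G' := gram e' fun u v => B u v with hG'
  let P : Matrix ι ι ℝ := Matrix.of fun p i => e'.repr (φ (e i)) p
  have hGP : G = P.transpose * G' * P := by
    ext i j
    simp only [hG, gram, Matrix.of_apply, Matrix.mul_apply, hG', Matrix.transpose_apply, P]
    conv_lhs => rw [← e'.sum_repr (φ (e i)), ← e'.sum_repr (φ (e j))]
    simp only [map_sum, LinearMap.sum_apply, map_smul, LinearMap.smul_apply, smul_eq_mul,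
      Finset.sum_mul, Finset.mul_sum]
    exact Finset.sum_congr rfl fun q _ => Finset.sum_congr rfl fun p _ => by ring
  have hdet := hu
  rw [hGP, Matrix.det_mul, Matrix.det_mul, Matrix.det_transpose, IsUnit.mul_iff, IsUnit.mul_iff]
    at hdet
  have hP : IsUnit P.det := hdet.2
  have hPt : IsUnit P.transpose.det := by rwa [Matrix.det_transpose]
  have hinv : P * G⁻¹ * P.transpose = G'⁻¹ := by
    rw [hGP, Matrix.mul_inv_rev, Matrix.mul_inv_rev, ← Matrix.mul_assoc,
      Matrix.mul_nonsing_inv _ hP, Matrix.one_mul, Matrix.mul_assoc,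
      Matrix.nonsing_inv_mul _ hPt, Matrix.mul_one]
  have hexp : ∀ (γ : W [⋀^Fin k]→L[ℝ] ℝ) (i : Fin k → ι),
      γ.compContinuousLinearMap φ (fun a => e (i a)) =
        ∑ p : Fin k → ι, (∏ a, P (p a) (i a)) * γ (fun a => e' (p a)) := fun γ i =>
    apply_eq_sum_basis e' γ _
  have hprod : ∀ p q : Fin k → ι, ∑ i : Fin k → ι, ∑ j : Fin k → ι,
      (∏ a, G⁻¹ (i a) (j a)) * ((∏ a, P (p a) (i a)) * ∏ a, P (q a) (j a)) =
        ∏ a, G'⁻¹ (p a) (q a) := by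
    intro p q
    have h1 : ∀ a, G'⁻¹ (p a) (q a) =
        ∑ i, ∑ j, G⁻¹ i j * (P (p a) i * P (q a) j) := by
      intro a
      rw [← hinv, Matrix.mul_apply, Finset.sum_comm]
      refine Finset.sum_congr rfl fun j _ => ?_
      rw [Matrix.mul_apply, Finset.sum_mul]
      exact Finset.sum_congr rfl fun i _ => by rw [Matrix.transpose_apply]; ring
    simp only [h1]
    rw [Finset.prod_univ_sum, Fintype.piFinset_univ]
    refine Finset.sum_congr rfl fun i _ => ?_
    rw [Finset.prod_univ_sum, Fintype.piFinset_univ]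
    refine Finset.sum_congr rfl fun j _ => ?_
    rw [Finset.prod_mul_distrib, Finset.prod_mul_distrib]
  unfold pairing
  rw [← hG, ← hG']
  congr 1
  simp only [hexp]
  calc _ = ∑ i : Fin k → ι, ∑ j : Fin k → ι, ∑ p : Fin k → ι, ∑ q : Fin k → ι,
        ((∏ a, G⁻¹ (i a) (j a)) * ((∏ a, P (p a) (i a)) * ∏ a, P (q a) (j a))) *
          (α (fun a => e' (p a)) * β (fun a => e' (q a))) := by
        refine Finset.sum_congr rfl fun i _ => Finset.sum_congr rfl fun j _ => ?_
        rw [Finset.sum_mul_sum, Finset.mul_sum]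
        refine Finset.sum_congr rfl fun p _ => ?_
        rw [Finset.mul_sum]
        exact Finset.sum_congr rfl fun q _ => by ring
    _ = ∑ p : Fin k → ι, ∑ q : Fin k → ι, ∑ i : Fin k → ι, ∑ j : Fin k → ι,
        ((∏ a, G⁻¹ (i a) (j a)) * ((∏ a, P (p a) (i a)) * ∏ a, P (q a) (j a))) *
          (α (fun a => e' (p a)) * β (fun a => e' (q a))) := by
        rw [Finset.sum_congr rfl fun i _ => Finset.sum_comm, Finset.sum_comm]
        refine Finset.sum_congr rfl fun p _ => ?_
        rw [Finset.sum_congr rfl fun i _ => Finset.sum_comm, Finset.sum_comm]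
    _ = _ := by
        refine Finset.sum_congr rfl fun p _ => Finset.sum_congr rfl fun q _ => ?_
        rw [← hprod p q, Finset.sum_mul]
        exact Finset.sum_congr rfl fun i _ => by rw [Finset.sum_mul]

theorem pairing_basis_indep [IsTopologicalAddGroup V] [ContinuousSMul ℝ V] [T2Space V]
    (e e' : Module.Basis ι ℝ V) (B : V →ₗ[ℝ] V →ₗ[ℝ] ℝ)
    (hu : IsUnit (gram e fun u v => B u v).det) {k : ℕ} (α β : V [⋀^Fin k]→L[ℝ] ℝ) :
    pairing e (fun u v => B u v) α β = pairing e' (fun u v => B u v) α β :=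
  pairing_comp (ContinuousLinearMap.id ℝ V) e e' B hu α β

/-- In an orthonormal basis, `|α|² = (1/k!) ∑ α_{i₁ … i_k}²`. -/
theorem pairing_self_of_orthonormal (e : Module.Basis ι ℝ V) {B : V → V → ℝ} (h : gram e B = 1)
    {k : ℕ} (α : V [⋀^Fin k]→L[ℝ] ℝ) :
    pairing e B α α = (k.factorial : ℝ)⁻¹ * ∑ i : Fin k → ι, α (fun a => e (i a)) ^ 2 := by
  unfold pairing
  rw [h, inv_one]
  congr 1
  refine Finset.sum_congr rfl fun i _ => ?_
  rw [Finset.sum_eq_single i]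
  · simp [sq]
  · intro j _ hj
    have hz : ∀ a, i a ≠ j a → (1 : Matrix ι ι ℝ) (i a) (j a) = 0 := fun a => Matrix.one_apply_ne
    obtain ⟨a, ha⟩ : ∃ a, i a ≠ j a := by
      by_contra! hc
      exact hj (funext fun a => (hc a).symm)
    exact mul_eq_zero_of_left (Finset.prod_eq_zero (Finset.mem_univ a)
      (hz a ha)) _
  · simp

end Pairing

section Bounds

variable {V : Type*} [AddCommGroup V] [Module ℝ V] [TopologicalSpace V]
  [IsTopologicalAddGroup V] [ContinuousSMul ℝ V] [T2Space V]
  {ι : Type*} [Fintype ι] [DecidableEq ι]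

/-- All components of `α` in the basis `e` are at most `c` in absolute value. -/
def SupLE (e : Module.Basis ι ℝ V) (c : ℝ) (α : Forms V) : Prop :=
  ∀ k (i : Fin k → ι), |α k (fun a => e (i a))| ≤ c

variable {e : Module.Basis ι ℝ V} {c c' : ℝ} {α β : Forms V}

theorem SupLE.nonneg (h : SupLE e c α) : 0 ≤ c := (abs_nonneg _).trans (h 0 Fin.elim0)

theorem SupLE.mono (h : SupLE e c α) (hc : c ≤ c') : SupLE e c' α :=
  fun k i => (h k i).trans hc

theorem SupLE.add (h : SupLE e c α) (h' : SupLE e c' β) : SupLE e (c + c') (α + β) :=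
  fun k i => (abs_add_le _ _).trans (add_le_add (h k i) (h' k i))

theorem SupLE.smul (a : ℝ) (h : SupLE e c α) : SupLE e (|a| * c) (a • α) := fun k i => by
  rw [Forms.smul_apply, ContinuousAlternatingMap.smul_apply, smul_eq_mul, abs_mul]
  exact mul_le_mul_of_nonneg_left (h k i) (abs_nonneg a)

theorem SupLE.smul_of_le_one {a : ℝ} (ha : |a| ≤ 1) (h : SupLE e c α) : SupLE e c (a • α) :=
  (h.smul a).mono (mul_le_of_le_one_left h.nonneg ha)

theorem SupLE.sum {κ : Type*} (s : Finset κ) {f : κ → Forms V} (h : ∀ j ∈ s, SupLE e c (f j)) :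
    SupLE e (s.card * c) (∑ j ∈ s, f j) := fun k i => by
  rw [Forms.sum_apply, ContinuousAlternatingMap.sum_apply]
  refine (Finset.abs_sum_le_sum_abs _ _).trans ?_
  rw [← nsmul_eq_mul]
  exact Finset.sum_le_card_nsmul _ _ _ fun j hj => h j hj k i

theorem SupLE.iota (h : SupLE e c α) (i : ι) : SupLE e c (iota (e i) α) := fun k I => by
  rw [iota_apply, contr_apply]
  have : (Fin.cons (e i) fun a => e (I a) : Fin (k + 1) → V) =
      fun a => e ((Fin.cons i I : Fin (k + 1) → ι) a) := by
    funext a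
    refine Fin.cases ?_ (fun b => ?_) a <;> simp
  rw [this]
  exact h (k + 1) _

/-- The alternating sum has as many terms as the degree, and there are no nonzero forms of degree
above the dimension. -/
theorem SupLE.eps (h : SupLE e c α) (i : ι) :
    SupLE e (Fintype.card ι * c) (eps (dualCov e i) α) := fun k I => by
  have hc := h.nonneg
  by_cases hk : Fintype.card ι < k
  · rw [eq_zero_of_card_lt e hk (SymplecticHodge.eps (dualCov e i) α k)]
    simpa using by positivity
  push Not at hk
  cases k with
  | zero => simpa using by positivity
  | succ k =>
    rw [eps_succ, extMul_apply]
    refine (Finset.abs_sum_le_sum_abs _ _).trans ?_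
    refine (Finset.sum_le_card_nsmul _ _ c fun a _ => ?_).trans ?_
    · rw [abs_mul, abs_pow, abs_neg, abs_one, one_pow, one_mul, abs_mul]
      have h1 : |dualCov e i (e (I a))| ≤ 1 := by
        rw [dualCov_apply, e.repr_self, Finsupp.single_apply]
        split_ifs <;> simp
      exact (mul_le_of_le_one_left (abs_nonneg _) h1).trans (h k fun b => I (a.succAbove b))
    · rw [Finset.card_univ, Fintype.card_fin, nsmul_eq_mul]
      exact mul_le_mul_of_nonneg_right (by exact_mod_cast hk) hc

theorem SupLE.lef (h : SupLE e c α) {Ω : V [⋀^Fin 2]→L[ℝ] ℝ} (hΩ : ∀ i j, |Ω ![e i, e j]| ≤ 1) :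
    SupLE e (Fintype.card ι ^ 4 * c) (lef Ω α) := by
  rw [lef_eq_sum e]
  simp only [LinearMap.smul_apply, LinearMap.sum_apply, Module.End.mul_apply]
  refine SupLE.smul_of_le_one (by norm_num) ?_
  refine (SupLE.sum Finset.univ fun i _ => SupLE.sum Finset.univ fun j _ =>
    ((h.eps j).eps i).smul_of_le_one (hΩ i j)).mono (le_of_eq ?_)
  rw [Finset.card_univ]
  ring

theorem SupLE.lam (h : SupLE e c α) {Ω : V [⋀^Fin 2]→L[ℝ] ℝ}
    (hΩ : ∀ i j, |(gramΩ e Ω)⁻¹ i j| ≤ 1) :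
    SupLE e (Fintype.card ι ^ 2 * c) (lam e Ω α) := by
  simp only [SymplecticHodge.lam, LinearMap.smul_apply, LinearMap.sum_apply, Module.End.mul_apply]
  refine SupLE.smul_of_le_one (by norm_num) ?_
  refine (SupLE.sum Finset.univ fun i _ => SupLE.sum Finset.univ fun j _ =>
    ((h.iota j).iota i).smul_of_le_one (hΩ i j)).mono (le_of_eq ?_)
  rw [Finset.card_univ]
  ring

/-- `Λ` is characterized by `Λ 1 = 0` and `[Λ, ξ ∧ ·] = ι(ξ^#)`. -/
theorem lam_basis_indep (e e' : Module.Basis ι ℝ V) {Ω : V [⋀^Fin 2]→L[ℝ] ℝ} (hΩ : Nondeg Ω) :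
    lam e Ω = lam e' Ω := by
  rw [← sub_eq_zero]
  refine end_ext e (fun ξ => SymplecticHodge.eps ξ) ?_ (fun ξ => ?_) fun ξ => by simp
  · rw [LinearMap.sub_apply, lam_oneForm, lam_oneForm, sub_zero]; rfl
  · rw [sub_mul, mul_sub, lam_mul_eps, lam_mul_eps,
      hΩ.sharp_unique e ξ (hΩ.apply_sharp e' ξ)]
    abel

theorem SupLE.of_pairing {B : V → V → ℝ} (h : gram e B = 1) {k : ℕ}
    (α : V [⋀^Fin k]→L[ℝ] ℝ) :
    SupLE e (√(k.factorial * pairing e B α α)) (single k α) := fun l i => by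
  by_cases hl : l = k
  · subst hl
    rw [single_same, pairing_self_of_orthonormal e h, ← mul_assoc,
      mul_inv_cancel₀ (by positivity), one_mul]
    refine Real.abs_le_sqrt ?_
    exact Finset.single_le_sum (f := fun i : Fin l → ι => α (fun a => e (i a)) ^ 2)
      (fun _ _ => sq_nonneg _) (Finset.mem_univ i)
  · rw [single_of_ne hl]
    exact (abs_zero (α := ℝ)).le.trans (Real.sqrt_nonneg _)

theorem SupLE.pairing_le {B : V → V → ℝ} (hB : gram e B = 1) (h : SupLE e c α) (k : ℕ) :
    pairing e B (α k) (α k) ≤ Fintype.card ι ^ k * c ^ 2 := by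
  rw [pairing_self_of_orthonormal e hB]
  have h1 : ∑ i : Fin k → ι, α k (fun a => e (i a)) ^ 2 ≤ Fintype.card ι ^ k * c ^ 2 := by
    refine (Finset.sum_le_card_nsmul _ _ (c ^ 2) fun i _ => ?_).trans (le_of_eq ?_)
    · exact sq_le_sq.mpr ((h k i).trans (le_abs_self c))
    · simp
  refine (mul_le_of_le_one_left (Finset.sum_nonneg fun _ _ => sq_nonneg _) ?_).trans h1
  exact inv_le_one_of_one_le₀ (by exact_mod_cast Nat.one_le_iff_ne_zero.mpr k.factorial_ne_zero)

end Bounds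

section Orthonormal

theorem exists_orthonormal_basis {V : Type*} [NormedAddCommGroup V] [InnerProductSpace ℝ V]
    [FiniteDimensional ℝ V] {m : ℕ} (hm : Module.finrank ℝ V = m) :
    ∃ e : Module.Basis (Fin m) ℝ V, Orthonormal ℝ e :=
  ⟨((stdOrthonormalBasis ℝ V).reindex (finCongr hm)).toBasis, by
    rw [OrthonormalBasis.coe_toBasis]
    exact OrthonormalBasis.orthonormal _⟩

variable {V : Type*} [AddCommGroup V] [Module ℝ V] [TopologicalSpace V]
  {Ω : V [⋀^Fin 2]→L[ℝ] ℝ} {J : V →L[ℝ] V} {ι : Type*} [Fintype ι] [DecidableEq ι]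

theorem gram_eq_one_iff (e : Module.Basis ι ℝ V) {B : V → V → ℝ} :
    gram e B = 1 ↔ ∀ i j, B (e i) (e j) = if i = j then 1 else 0 := by
  rw [← Matrix.ext_iff]
  rfl

theorem Compatible.abs_met_le_one (h : Compatible Ω J) {u v : V} (hu : met Ω J u u = 1)
    (hv : met Ω J v v = 1) : |met Ω J u v| ≤ 1 := by
  have hpos : ∀ w, 0 ≤ metHom Ω J w w := fun w => by
    by_cases hw : w = 0
    · simp [hw]
    · exact (h.pos w hw).le
  have h2 := h.met_symm u v
  simp only [← metHom_apply] at hu hv h2 ⊢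
  have h1 := hpos (v - metHom Ω J u v • u)
  simp only [map_sub, LinearMap.sub_apply, map_smul, LinearMap.smul_apply, smul_eq_mul, hu, hv,
    ← h2] at h1
  rw [abs_le_one_iff_mul_self_le_one]
  nlinarith

theorem Compatible.apply_eq_met (h : Compatible Ω J) (u v : V) : Ω ![u, v] = -met Ω J u (J v) := by
  have h1 : Ω ![u, -v] = -Ω ![u, v] := by
    rw [← bil_apply, ← bil_apply, map_neg]
  rw [met, h.sq, h1, neg_neg]

theorem Compatible.met_J (h : Compatible Ω J) (u v : V) : met Ω J (J u) (J v) = met Ω J u v :=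
  h.invariant u (J v)

theorem Compatible.abs_apply_le_one (h : Compatible Ω J) {e : Module.Basis ι ℝ V}
    (he : gram e (met Ω J) = 1) (i j : ι) : |Ω ![e i, e j]| ≤ 1 := by
  rw [gram_eq_one_iff] at he
  rw [h.apply_eq_met, abs_neg]
  exact h.abs_met_le_one (by rw [he, if_pos rfl]) (by rw [h.met_J, he, if_pos rfl])

/-- In an orthonormal basis the matrix of `ω` is that of `J` up to sign, so it squares to `-1`. -/
theorem Compatible.gramΩ_inv (h : Compatible Ω J) {e : Module.Basis ι ℝ V}
    (he : gram e (met Ω J) = 1) : (gramΩ e Ω)⁻¹ = -gramΩ e Ω := by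
  rw [gram_eq_one_iff] at he
  refine Matrix.inv_eq_right_inv ?_
  ext i k
  have hJ : ∀ w, w = ∑ j, met Ω J (e j) w • e j := fun w => by
    conv_lhs => rw [← e.sum_repr w]
    refine Finset.sum_congr rfl fun j _ => ?_
    congr 1
    change _ = metHom Ω J (e j) w
    conv_rhs => rw [← e.sum_repr w, map_sum]
    have he' : ∀ i, metHom Ω J (e j) (e i) = if j = i then 1 else 0 := he j
    simp [he']
  have h1 : Ω ![e i, J (e k)] = if i = k then 1 else 0 := he i k
  rw [Matrix.mul_neg, Matrix.neg_apply, Matrix.mul_apply, Matrix.one_apply, ← h1, ← bil_apply,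
    hJ (J (e k)), map_sum, ← Finset.sum_neg_distrib]
  refine Finset.sum_congr rfl fun j _ => ?_
  rw [map_smul, bil_apply, smul_eq_mul]
  simp only [gram, Matrix.of_apply]
  rw [h.apply_eq_met (e j) (e k)]
  ring

theorem Compatible.abs_gramΩ_inv_le_one (h : Compatible Ω J) {e : Module.Basis ι ℝ V}
    (he : gram e (met Ω J) = 1) (i j : ι) : |(gramΩ e Ω)⁻¹ i j| ≤ 1 := by
  rw [h.gramΩ_inv he, Matrix.neg_apply, abs_neg]
  exact h.abs_apply_le_one he i j

end Orthonormal

/-! ### Pointwise and square-integral bounds -/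

section Pointwise

variable {n : ℕ} {M : Type*} [TopologicalSpace M] [ChartedSpace (Model (2 * n)) M]
  [Bundle.RiemannianBundle (fun x : M => TangentSpace (𝓡 (2 * n)) x)] {k : ℕ}

variable (n M) in
theorem exists_orthonormal_frame (x : M) :
    ∃ e : Module.Basis (Fin (2 * n)) ℝ (TangentSpace (𝓡 (2 * n)) x), gram e (metric n x) = 1 := by
  have : FiniteDimensional ℝ (TangentSpace (𝓡 (2 * n)) x) :=
    inferInstanceAs (FiniteDimensional ℝ (Model (2 * n)))
  have h : Module.finrank ℝ (TangentSpace (𝓡 (2 * n)) x) = 2 * n :=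
    (finrank_euclideanSpace_fin (𝕜 := ℝ) (n := 2 * n) :)
  obtain ⟨e, he⟩ := exists_orthonormal_basis h
  exact ⟨e, (gram_eq_one_iff e).mpr fun i j => orthonormal_iff_ite.mp he i j⟩

/-- An orthonormal basis of each tangent space (no regularity). -/
def frame (x : M) : Module.Basis (Fin (2 * n)) ℝ (TangentSpace (𝓡 (2 * n)) x) :=
  (exists_orthonormal_frame n M x).choose

theorem gram_frame (x : M) : gram (frame x) (metric n x) = 1 :=
  (exists_orthonormal_frame n M x).choose_spec

/-- The squared norm `|α|²` of a form at a point. -/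
def normSq (x : M) (α : TangentSpace (𝓡 (2 * n)) x [⋀^Fin k]→L[ℝ] ℝ) : ℝ :=
  pairing (tangentBasis x) (metric n x) α α

variable [IsManifold (𝓡 (2 * n)) ∞ M] (S : AlmostKahlerStructure n M)

namespace AlmostKahlerStructure

open SmoothForms

theorem normSq_eq (S : AlmostKahlerStructure n M) (x : M)
    (α : TangentSpace (𝓡 (2 * n)) x [⋀^Fin k]→L[ℝ] ℝ) :
    normSq x α = pairing (frame x) (metric n x) α α := by
  rw [normSq, S.metric_eq_met]
  exact pairing_basis_indep _ _ (metHom (S.Ω x) (S.J x))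
    (gram_isUnit _ _ (S.compatible x).met_nondeg) α α

theorem normSq_nonneg (S : AlmostKahlerStructure n M) (x : M)
    (α : TangentSpace (𝓡 (2 * n)) x [⋀^Fin k]→L[ℝ] ℝ) :
    0 ≤ normSq x α := by
  rw [S.normSq_eq, pairing_self_of_orthonormal _ (gram_frame x)]
  exact mul_nonneg (by positivity) (Finset.sum_nonneg fun _ _ => sq_nonneg _)

theorem normSq_smul (S : AlmostKahlerStructure n M) (x : M) (c : ℝ)
    (α : TangentSpace (𝓡 (2 * n)) x [⋀^Fin k]→L[ℝ] ℝ) :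
    normSq x (c • α) = c ^ 2 * normSq x α := by
  simp only [S.normSq_eq, pairing_self_of_orthonormal _ (gram_frame x),
    ContinuousAlternatingMap.smul_apply, smul_eq_mul, mul_pow, ← Finset.mul_sum]
  ring

theorem normSq_add_le (S : AlmostKahlerStructure n M) (x : M)
    (α β : TangentSpace (𝓡 (2 * n)) x [⋀^Fin k]→L[ℝ] ℝ) :
    normSq x (α + β) ≤ 2 * (normSq x α + normSq x β) := by
  simp only [S.normSq_eq, pairing_self_of_orthonormal _ (gram_frame x),
    ContinuousAlternatingMap.add_apply, ← mul_add, ← Finset.sum_add_distrib]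
  rw [mul_left_comm]
  refine mul_le_mul_of_nonneg_left ?_ (by positivity)
  rw [Finset.mul_sum]
  exact Finset.sum_le_sum fun i _ => add_sq_le

variable (n M) in
/-- The algebra of the operators on families of forms that are bounded at every point, uniformly in
the point and in the degree. -/
def boundedOps : Subalgebra ℝ (Module.End ℝ (SmoothForms (2 * n) M)) where
  carrier := {T | ∃ C : ℝ, 0 ≤ C ∧ ∀ x α c, SupLE (frame x) c (ev x α) →
    SupLE (frame x) (C * c) (ev x (T α))}
  mul_mem' := by
    rintro A B ⟨a, ha, hA⟩ ⟨b, hb, hB⟩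
    refine ⟨a * b, mul_nonneg ha hb, fun x α c h => ?_⟩
    rw [mul_assoc]
    exact hA x _ _ (hB x _ _ h)
  add_mem' := by
    rintro A B ⟨a, ha, hA⟩ ⟨b, hb, hB⟩
    refine ⟨a + b, add_nonneg ha hb, fun x α c h => ?_⟩
    rw [add_mul]
    exact (hA x _ _ h).add (hB x _ _ h)
  algebraMap_mem' r := ⟨|r|, abs_nonneg r, fun x α c h => h.smul r⟩

theorem opL_mem_boundedOps : S.opL ∈ boundedOps n M :=
  ⟨Fintype.card (Fin (2 * n)) ^ 4, by positivity, fun x α c h => by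
    rw [S.ev_opL]
    exact h.lef fun i j => (S.compatible x).abs_apply_le_one
      (by have := gram_frame (n := n) x; rwa [S.metric_eq_met] at this) i j⟩

theorem opΛ_mem_boundedOps : S.opΛ ∈ boundedOps n M :=
  ⟨Fintype.card (Fin (2 * n)) ^ 2, by positivity, fun x α c h => by
    rw [S.ev_opΛ, lam_basis_indep _ (frame x) (S.compatible x).nondeg]
    exact h.lam fun i j => (S.compatible x).abs_gramΩ_inv_le_one
      (by have := gram_frame (n := n) x; rwa [S.metric_eq_met] at this) i j⟩

/-- Passing between the largest component and the norm costs a constant that depends only on the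
dimension and the degrees. -/
theorem exists_normSq_le (S : AlmostKahlerStructure n M)
    {T : Module.End ℝ (SmoothForms (2 * n) M)} (hT : T ∈ boundedOps n M) (k l : ℕ) :
    ∃ C : NNReal, ∀ (α : Form (2 * n) M k) (hα : IsSmoothForm α) (x : M),
      normSq x ((T (sg k α hα)).1 l x) ≤ C * normSq x (α x) := by
  obtain ⟨C, hC, h⟩ := hT
  refine ⟨⟨Fintype.card (Fin (2 * n)) ^ l * C ^ 2 * k.factorial, by positivity⟩,
    fun α hα x => ?_⟩
  have h1 := h x (sg k α hα) _ (by rw [ev_sg]; exact SupLE.of_pairing (gram_frame x) (α x))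
  have h2 := h1.pairing_le (gram_frame x) l
  rw [← S.normSq_eq, ← S.normSq_eq, mul_pow,
    Real.sq_sqrt (mul_nonneg (by positivity) (S.normSq_nonneg x _)), ev_apply] at h2
  refine h2.trans (le_of_eq ?_)
  change _ = (Fintype.card (Fin (2 * n)) ^ l * C ^ 2 * k.factorial : ℝ) * _
  ring

/-- In a chart `|α|²` is the pairing of the local representations for the local metric. -/
theorem continuous_normSq (S : AlmostKahlerStructure n M)
    [IsContMDiffRiemannianBundle (𝓡 (2 * n)) ∞ (Model (2 * n))
      (fun x : M => TangentSpace (𝓡 (2 * n)) x)] {α : Form (2 * n) M k} (hα : IsSmoothForm α) :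
    Continuous fun x => normSq x (α x) := by
  rw [continuous_iff_continuousAt]
  intro x₀
  let φ := chartAt (Model (2 * n)) x₀
  have h1 : ContinuousOn (fun y => normSq (φ.symm y) (α (φ.symm y))) φ.target := by
    refine (contDiffOn_pairing (EuclideanSpace.basisFun (Fin (2 * n)) ℝ).toBasis
      (fun i j => contDiffOn_chartMetric x₀ _ _) (fun _ hy => S.isUnit_chart_gram x₀ hy)
      (hα x₀) (hα x₀)).continuousOn.congr fun y hy => ?_
    have h2 : chartMetric n x₀ y = fun u v => metHom (S.Ω (φ.symm y)) (S.J (φ.symm y))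
        (chartDeriv x₀ y u) (chartDeriv x₀ y v) := by
      funext u v
      exact S.metric_eq _ _ _
    have h3 := S.isUnit_chart_gram x₀ hy
    rw [h2] at h3
    dsimp only
    rw [h2, normSq, S.metric_eq_met]
    exact (pairing_comp (chartDeriv x₀ y) _ (tangentBasis (φ.symm y))
      (metHom (S.Ω (φ.symm y)) (S.J (φ.symm y))) h3 _ _).symm
  have h4 : ContinuousOn (fun x => normSq x (α x)) φ.source :=
    (h1.comp φ.continuousOn φ.mapsTo).congr fun x hx => by
      simp only [Function.comp_apply]
      rw [φ.left_inv hx]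
  exact h4.continuousAt (φ.open_source.mem_nhds (mem_chart_source _ x₀))

end AlmostKahlerStructure

end Pointwise

section L2

variable {n : ℕ} {M : Type*} [EMetricSpace M] [ChartedSpace (Model (2 * n)) M]
  [Bundle.RiemannianBundle (fun x : M => TangentSpace (𝓡 (2 * n)) x)]
  [MeasurableSpace M] [BorelSpace M] {k l : ℕ}

theorem l2NormSq_eq (α : Form (2 * n) M k) : l2NormSq α =
    ∫⁻ x, ENNReal.ofReal (normSq x (α x)) ∂(μHE[2 * n] : MeasureTheory.Measure M) := rfl

theorem l2NormSq_le_of_normSq_le {α : Form (2 * n) M k} {β : Form (2 * n) M l} {C : NNReal}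
    (h : ∀ x, normSq x (β x) ≤ C * normSq x (α x)) : l2NormSq β ≤ C * l2NormSq α := by
  rw [l2NormSq_eq, l2NormSq_eq, ← MeasureTheory.lintegral_const_mul' _ _ ENNReal.coe_ne_top]
  refine MeasureTheory.lintegral_mono fun x => ?_
  rw [← ENNReal.ofReal_coe_nnreal, ← ENNReal.ofReal_mul C.coe_nonneg]
  exact ENNReal.ofReal_le_ofReal (h x)

variable [IsManifold (𝓡 (2 * n)) ∞ M] (S : AlmostKahlerStructure n M)

namespace AlmostKahlerStructure

theorem l2NormSq_smul_lt_top (S : AlmostKahlerStructure n M)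
    {α : Form (2 * n) M k} (h : l2NormSq α < ⊤) (c : ℝ) :
    l2NormSq (c • α) < ⊤ := by
  refine (l2NormSq_le_of_normSq_le (C := ⟨c ^ 2, sq_nonneg c⟩) fun x =>
    (S.normSq_smul x c (α x)).le).trans_lt ?_
  exact ENNReal.mul_lt_top ENNReal.coe_lt_top h

theorem l2NormSq_zero_lt_top (S : AlmostKahlerStructure n M) :
    l2NormSq (0 : Form (2 * n) M k) < ⊤ := by
  have h : ∀ x, normSq x ((0 : Form (2 * n) M k) x) ≤
      (0 : NNReal) * normSq x ((0 : Form (2 * n) M k) x) := fun x => by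
    have := S.normSq_smul x 0 ((0 : Form (2 * n) M k) x)
    rw [zero_smul] at this
    refine this.le.trans (by simp)
  refine (l2NormSq_le_of_normSq_le h).trans_lt ?_
  simp

theorem l2NormSq_add_lt_top (S : AlmostKahlerStructure n M)
    [IsContMDiffRiemannianBundle (𝓡 (2 * n)) ∞ (Model (2 * n))
      (fun x : M => TangentSpace (𝓡 (2 * n)) x)] {α β : Form (2 * n) M k} (hα : IsSmoothForm α)
    (h : l2NormSq α < ⊤) (h' : l2NormSq β < ⊤) : l2NormSq (α + β) < ⊤ := by
  have h1 : l2NormSq (α + β) ≤ 2 * (l2NormSq α + l2NormSq β) := by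
    simp only [l2NormSq_eq]
    rw [← MeasureTheory.lintegral_add_left (S.continuous_normSq hα).measurable.ennreal_ofReal,
      ← MeasureTheory.lintegral_const_mul' _ _ (by simp)]
    refine MeasureTheory.lintegral_mono fun x => ?_
    dsimp only
    rw [← ENNReal.ofReal_add (S.normSq_nonneg x _) (S.normSq_nonneg x _)]
    refine (ENNReal.ofReal_le_ofReal (S.normSq_add_le x _ _)).trans (le_of_eq ?_)
    rw [ENNReal.ofReal_mul (by norm_num)]
    congr 1
    exact ENNReal.ofReal_ofNat 2
  exact h1.trans_lt (ENNReal.mul_lt_top (by simp) (ENNReal.add_lt_top.mpr ⟨h, h'⟩))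

end AlmostKahlerStructure

end L2

/-! ### The Lefschetz isomorphism on square-integrable harmonic forms -/

section Lefschetz

variable {n : ℕ} {M : Type*} [TopologicalSpace M] [ChartedSpace (Model (2 * n)) M]
  [Bundle.RiemannianBundle (fun x : M => TangentSpace (𝓡 (2 * n)) x)]
  [IsManifold (𝓡 (2 * n)) ∞ M] (S : AlmostKahlerStructure n M) {k : ℕ}
  {α : Form (2 * n) M k}

namespace AlmostKahlerStructure

open SmoothForms

/-- The projection onto the forms of degree `k`. -/
def projDeg (k : ℕ) : Module.End ℝ (SmoothForms (2 * n) M) := scale fun j => if j = k then 1 else 0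

theorem projDeg_apply (k : ℕ) (γ : SmoothForms (2 * n) M) :
    projDeg k γ = sg k (γ.1 k) (γ.2 k) := by
  have h : ∀ l, l ≠ k → (projDeg k γ).1 l = 0 := fun l hl => by
    change (if l = k then (1 : ℝ) else 0) • γ.1 l = 0
    rw [if_neg hl, zero_smul]
  rw [sg_eq h]
  refine sg_congr ?_ _ _
  change (if k = k then (1 : ℝ) else 0) • γ.1 k = γ.1 k
  rw [if_pos rfl, one_smul]

theorem projDeg_sg (hα : IsSmoothForm α) : projDeg k (sg k α hα) = sg k α hα := by
  rw [projDeg_apply]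
  exact sg_congr (sg_same k α hα) _ _

theorem weight_mul_projDeg {m : ℝ} (h : (n : ℝ) - k = m) :
    (scale fun j => (n : ℝ) - j) * projDeg k =
      m • (projDeg k : Module.End ℝ (SmoothForms (2 * n) M)) := by
  refine end_ext_ev fun x γ => ?_
  ext1 j
  change ((n : ℝ) - j) • (if j = k then (1 : ℝ) else 0) • γ.1 j x =
    m • (if j = k then (1 : ℝ) else 0) • γ.1 j x
  split_ifs with hj
  · rw [hj, h]
  · have h0 : (0 : ℝ) • γ.1 j x = 0 := zero_smul ℝ (γ.1 j x)
    rw [h0]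
    exact (smul_zero _).trans (smul_zero _).symm

theorem scale_mul_opL_pow (c : ℕ → ℝ) (m : ℕ) :
    scale c * S.opL ^ m = S.opL ^ m * scale fun j => c (j + 2 * m) := by
  have h1 : ∀ c : ℕ → ℝ, scale c * S.opL = S.opL * scale fun j => c (j + 2) := fun c =>
    end_ext_ev fun x γ => LinearMap.congr_fun (diag_mul_lef c (S.Ω x)) (ev x γ)
  induction m generalizing c with
  | zero => simp
  | succ m ih =>
    rw [pow_succ', ← mul_assoc, h1, mul_assoc, ih, ← mul_assoc]
    simp only [mul_add, add_assoc, mul_one]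

theorem sg_lefIso (hk : k ≤ n) (hα : IsSmoothForm α) (h : IsSmoothForm (S.lefIso α)) :
    sg (2 * n - k) (S.lefIso α) h = (S.opL ^ (n - k)) (sg k α hα) :=
  ext_ev fun x => by
    rw [ev_pow (S.ev_opL x), ev_sg, ev_sg, lefschetzPow_eq]
    exact single_toDegree (by omega) _

theorem lefIso_eq (hk : k ≤ n) (hα : IsSmoothForm α) :
    S.lefIso α = ((S.opL ^ (n - k)) (sg k α hα)).1 (2 * n - k) := by
  funext x
  rw [← ev_apply, ev_pow (S.ev_opL x), ev_sg, lefschetzPow_eq, lefIso, lefPow]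
  rw [← single_toDegree (show k + 2 * (n - k) = 2 * n - k by omega), single_same]

theorem isSmoothForm_lefIso (hk : k ≤ n) (hα : IsSmoothForm α) : IsSmoothForm (S.lefIso α) := by
  rw [S.lefIso_eq hk hα]
  exact ((S.opL ^ (n - k)) (sg k α hα)).2 _

/-- `L^{n-k}` on `k`-forms has a left inverse that is a polynomial in `L` and `Λ`. -/
theorem exists_leftInverse (hk : k ≤ n) : ∃ Q ∈ boundedOps n M,
    ∀ (α : Form (2 * n) M k) (hα : IsSmoothForm α),
      Q ((S.opL ^ (n - k)) (sg k α hα)) = sg k α hα := by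
  obtain ⟨v, hv⟩ := exists_inverse_polynomial n (n - k)
  refine ⟨Polynomial.aeval (S.opL * S.opΛ) v * S.opΛ ^ (n - k), ?_, fun α hα => ?_⟩
  · refine mul_mem ?_ (pow_mem S.opΛ_mem_boundedOps _)
    exact Algebra.adjoin_le (Set.singleton_subset_iff.mpr
      (mul_mem S.opL_mem_boundedOps S.opΛ_mem_boundedOps))
      (Polynomial.aeval_mem_adjoin_singleton ℝ _)
  · have h := (hv S.triple (weight_mul_projDeg (k := k) (Nat.cast_sub hk).symm)).1
    have h2 := LinearMap.congr_fun h (sg k α hα)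
    simp only [Module.End.mul_apply, projDeg_sg] at h2
    exact h2

/-- `L^{n-k}` maps `k`-forms onto `(2n-k)`-forms: exchanging `L` and `Λ` turns `(2n-k)`-forms into
elements of weight `n - k`, so `L^{n-k} Λ^{n-k}` is invertible on them by a polynomial in `Λ L`. -/
theorem exists_preimage (hk : k ≤ n) {β : Form (2 * n) M (2 * n - k)} (hβ : IsSmoothForm β) :
    ∃ (α : Form (2 * n) M k) (hα : IsSmoothForm α),
      (S.opL ^ (n - k)) (sg k α hα) = sg (2 * n - k) β hβ := by
  obtain ⟨v, hv⟩ := exists_inverse_polynomial n (n - k)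
  have hw : -(scale fun j => (n : ℝ) - j) * projDeg (2 * n - k) =
      ((n - k : ℕ) : ℝ) • (projDeg (2 * n - k) : Module.End ℝ (SmoothForms (2 * n) M)) := by
    rw [neg_mul, weight_mul_projDeg (m := -((n - k : ℕ) : ℝ))
      (by rw [Nat.cast_sub hk, Nat.cast_sub (by omega)]; push_cast; ring), neg_smul, neg_neg]
  have h := LinearMap.congr_fun (hv S.triple.swap hw).2 (sg (2 * n - k) β hβ)
  simp only [Module.End.mul_apply, projDeg_sg] at h
  -- `γ` is a preimage of `β`, and so is its component in degree `k`, because `L^{n-k}` intertwines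
  -- the projections onto the degrees `k` and `2n - k`.
  set γ := (S.opΛ ^ (n - k)) (Polynomial.aeval (S.opΛ * S.opL) v (sg (2 * n - k) β hβ))
  refine ⟨γ.1 k, γ.2 k, ?_⟩
  have h2 : projDeg (2 * n - k) * S.opL ^ (n - k) = S.opL ^ (n - k) * projDeg k := by
    rw [projDeg, scale_mul_opL_pow, projDeg]
    congr 2
    funext j
    exact if_congr (by omega) rfl rfl
  have h3 := LinearMap.congr_fun h2 γ
  rw [Module.End.mul_apply, Module.End.mul_apply, h, projDeg_sg, projDeg_apply] at h3
  exact h3.symm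

end AlmostKahlerStructure

end Lefschetz

section Harmonic

variable {n : ℕ} {M : Type*} [EMetricSpace M] [ChartedSpace (Model (2 * n)) M]
  [Bundle.RiemannianBundle (fun x : M => TangentSpace (𝓡 (2 * n)) x)]
  [MeasurableSpace M] [BorelSpace M] [IsManifold (𝓡 (2 * n)) ∞ M]
  [IsContMDiffRiemannianBundle (𝓡 (2 * n)) ∞ (Model (2 * n))
    (fun x : M => TangentSpace (𝓡 (2 * n)) x)]
  (S : AlmostKahlerStructure n M) {k : ℕ}

namespace AlmostKahlerStructure

open SmoothForms

/-- The smooth square-integrable `k`-forms in the kernel of an operator on families. -/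
def l2Kernel (S : AlmostKahlerStructure n M) (Δ : Module.End ℝ (SmoothForms (2 * n) M)) (k : ℕ) :
    Submodule ℝ (Form (2 * n) M k) where
  carrier := {α | ∃ hα : IsSmoothForm α, l2NormSq α < ⊤ ∧ Δ (sg k α hα) = 0}
  add_mem' := by
    rintro α β ⟨hα, hα', hα''⟩ ⟨hβ, hβ', hβ''⟩
    refine ⟨hα.add hβ, S.l2NormSq_add_lt_top hα hα' hβ', ?_⟩
    rw [sg_add hα hβ, map_add, hα'', hβ'', add_zero]
  zero_mem' := ⟨IsSmoothForm.zero, S.l2NormSq_zero_lt_top, by rw [sg_zero, map_zero]⟩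
  smul_mem' := by
    rintro c α ⟨hα, hα', hα''⟩
    refine ⟨hα.const_smul c, S.l2NormSq_smul_lt_top hα' c, ?_⟩
    rw [sg_smul c hα, map_smul, hα'', smul_zero]

/-- An operator that preserves degrees and commutes with `L` has isomorphic `L²` kernels in the
degrees `k` and `2n - k`, because `L^{n-k}` and its inverse are bounded pointwise. -/
theorem isL2Iso_l2Kernel {Δ : Module.End ℝ (SmoothForms (2 * n) M)} (hL : S.opL * Δ = Δ * S.opL)
    (hk : k ≤ n) (hdeg : ∀ (α : Form (2 * n) M k) (hα : IsSmoothForm α),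
      ∃ (β : Form (2 * n) M k) (hβ : IsSmoothForm β), Δ (sg k α hα) = sg k β hβ) :
    IsL2Iso S.lefIso (S.l2Kernel Δ k : Set (Form (2 * n) M k)) (S.l2Kernel Δ (2 * n - k)) := by
  obtain ⟨Q, hQ, hQL⟩ := S.exists_leftInverse hk
  obtain ⟨C₁, hC₁⟩ := S.exists_normSq_le (pow_mem S.opL_mem_boundedOps (n - k)) k (2 * n - k)
  obtain ⟨C₂, hC₂⟩ := S.exists_normSq_le hQ (2 * n - k) k
  have hcomm : ∀ γ, (S.opL ^ (n - k)) (Δ γ) = Δ ((S.opL ^ (n - k)) γ) :=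
    LinearMap.congr_fun (((show Commute S.opL Δ from hL).pow_left (n - k)).eq)
  have hle₁ : ∀ α : Form (2 * n) M k, IsSmoothForm α →
      l2NormSq (S.lefIso α) ≤ C₁ * l2NormSq α := fun α hα =>
    l2NormSq_le_of_normSq_le fun x => by
      rw [S.lefIso_eq hk hα]
      exact hC₁ α hα x
  have hle₂ : ∀ α : Form (2 * n) M k, IsSmoothForm α →
      l2NormSq α ≤ C₂ * l2NormSq (S.lefIso α) := fun α hα =>
    l2NormSq_le_of_normSq_le fun x => by
      have h := hC₂ _ (S.isSmoothForm_lefIso hk hα) x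
      rwa [S.sg_lefIso hk hα, hQL, sg_same] at h
  have hmaps : ∀ α ∈ S.l2Kernel Δ k, S.lefIso α ∈ S.l2Kernel Δ (2 * n - k) := by
    rintro α ⟨hα, hα', hα''⟩
    refine ⟨S.isSmoothForm_lefIso hk hα,
      (hle₁ α hα).trans_lt (ENNReal.mul_lt_top ENNReal.coe_lt_top hα'), ?_⟩
    rw [S.sg_lefIso hk hα, ← hcomm, hα'', map_zero]
  let f : S.l2Kernel Δ k →ₗ[ℝ] S.l2Kernel Δ (2 * n - k) :=
    { toFun := fun α => ⟨S.lefIso α.1, hmaps α.1 α.2⟩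
      map_add' := fun α β => Subtype.ext <| by
        obtain ⟨hα, -⟩ := α.2
        obtain ⟨hβ, -⟩ := β.2
        change S.lefIso (α.1 + β.1) = S.lefIso α.1 + S.lefIso β.1
        rw [S.lefIso_eq hk (hα.add hβ), sg_add, map_add, S.lefIso_eq hk hα, S.lefIso_eq hk hβ]
        rfl
      map_smul' := fun c α => Subtype.ext <| by
        obtain ⟨hα, -⟩ := α.2
        change S.lefIso (c • α.1) = c • S.lefIso α.1
        rw [S.lefIso_eq hk (hα.const_smul c), sg_smul, map_smul, S.lefIso_eq hk hα]
        rfl }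
  have hinj : Function.Injective f := by
    rintro ⟨α, hα, hα'⟩ ⟨β, hβ, hβ'⟩ h
    have h1 : S.lefIso α = S.lefIso β := congrArg Subtype.val h
    have h2 : sg k α hα = sg k β hβ := by
      rw [← hQL α hα, ← hQL β hβ, ← S.sg_lefIso hk hα (S.isSmoothForm_lefIso hk hα),
        ← S.sg_lefIso hk hβ (S.isSmoothForm_lefIso hk hβ), sg_congr h1]
    refine Subtype.ext ?_
    change α = β
    rw [← sg_same k α hα, h2, sg_same]
  have hsurj : Function.Surjective f := by
    rintro ⟨β, hβ, hβ', hβ''⟩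
    obtain ⟨α, hα, h⟩ := S.exists_preimage hk hβ
    have h1 : S.lefIso α = β := by rw [S.lefIso_eq hk hα, h, sg_same]
    refine ⟨⟨α, hα, ?_, ?_⟩, Subtype.ext h1⟩
    · refine (hle₂ α hα).trans_lt (ENNReal.mul_lt_top ENNReal.coe_lt_top ?_)
      rwa [h1]
    · -- `L^{n-k}` is injective on `k`-forms and kills `Δ α`, since `Δ L^{n-k} α = Δ β = 0`.
      obtain ⟨γ, hγ, h2⟩ := hdeg α hα
      have h3 : (S.opL ^ (n - k)) (Δ (sg k α hα)) = 0 := by rw [hcomm, h, hβ'']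
      rw [h2] at h3 ⊢
      rw [← hQL γ hγ, h3, map_zero]
  refine ⟨S.l2Kernel Δ k, S.l2Kernel Δ (2 * n - k), LinearEquiv.ofBijective f ⟨hinj, hsurj⟩,
    rfl, rfl, fun _ => rfl, max C₁ C₂, ?_⟩
  rintro ⟨α, hα, -⟩
  exact ⟨(hle₁ α hα).trans (by gcongr; exact le_max_left _ _),
    (hle₂ α hα).trans (by gcongr; exact le_max_right _ _)⟩

theorem sg_eq_zero_iff {α : Form (2 * n) M k} (hα : IsSmoothForm α) : sg k α hα = 0 ↔ α = 0 := by
  refine ⟨fun h => ?_, fun h => (sg_congr h hα IsSmoothForm.zero).trans (sg_zero _)⟩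
  rw [← sg_same k α hα, h]
  rfl

theorem harmonicAdd_eq (c : ℝ) (k : ℕ) : harmonicAdd S c k = S.l2Kernel (S.opAdd c) k := by
  ext α
  constructor
  · rintro ⟨hα, hα', hα''⟩
    exact ⟨hα, hα', by rw [S.opAdd_sg, sg_eq_zero_iff, hα'']⟩
  · rintro ⟨hα, hα', hα''⟩
    exact ⟨hα, hα', by rwa [S.opAdd_sg, sg_eq_zero_iff] at hα''⟩

theorem harmonicMul_eq (c : ℝ) (k : ℕ) : harmonicMul S c k = S.l2Kernel (S.opMul c) k := by
  ext α
  constructor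
  · rintro ⟨hα, hα', hα''⟩
    exact ⟨hα, hα', by rw [S.opMul_sg, sg_eq_zero_iff, hα'']⟩
  · rintro ⟨hα, hα', hα''⟩
    exact ⟨hα, hα', by rwa [S.opMul_sg, sg_eq_zero_iff] at hα''⟩

end AlmostKahlerStructure

end Harmonic

end SymplecticHodge

end

theorem proposition2p8 {n : ℕ} {M : Type*} [EMetricSpace M] [CompleteSpace M] [NoncompactSpace M]
    [ChartedSpace (SymplecticHodge.Model (2 * n)) M] [IsManifold (𝓡 (2 * n)) ∞ M]
    [Bundle.RiemannianBundle (fun x : M => TangentSpace (𝓡 (2 * n)) x)]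
    [IsContMDiffRiemannianBundle (𝓡 (2 * n)) ∞ (SymplecticHodge.Model (2 * n))
      (fun x : M => TangentSpace (𝓡 (2 * n)) x)]
    [IsRiemannianManifold (𝓡 (2 * n)) M] [MeasurableSpace M] [BorelSpace M]
    (S : SymplecticHodge.AlmostKahlerStructure n M) (lam : ℝ) (hlam : 0 < lam)
    (k : ℕ) (hk : k ≤ n) :
    SymplecticHodge.IsL2Iso S.lefIso
        (SymplecticHodge.harmonicAdd S lam k) (SymplecticHodge.harmonicAdd S lam (2 * n - k)) ∧
      SymplecticHodge.IsL2Iso S.lefIso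
        (SymplecticHodge.harmonicMul S lam k) (SymplecticHodge.harmonicMul S lam (2 * n - k)) := by
  rw [S.harmonicAdd_eq, S.harmonicAdd_eq, S.harmonicMul_eq, S.harmonicMul_eq]
  exact ⟨S.isL2Iso_l2Kernel (S.opL_mul_laplacian lam).1 hk
      fun _ hα => ⟨_, S.isSmoothForm_laplacianAdd lam hα, S.opAdd_sg lam hα⟩,
    S.isL2Iso_l2Kernel (S.opL_mul_laplacian lam).2 hk
      fun _ hα => ⟨_, S.isSmoothForm_laplacianMul lam hα, S.opMul_sg lam hα⟩⟩
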